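/- A colored digraph is a finite digraph whose vertex set and whose arc set each carry a linearly ordered partition into nonempty (vertex-color, respectively arc-color) classes; an isomorphism of colored digraphs is a digraph isomorphism that maps the $i$th vertex-color class to the $i$th vertex-color class and the $i$th arc-color class to the $i$th arc-color class, for every $i$. $\mathrm{Iso}(X,Y)$ is the set of all isomorphisms from $X$ to $Y$, and $\mathrm{Aut}(X)=\mathrm{Iso}(X,X)$. The maximal valency of an arc-color class is the largest number of its arcs that leave one vertex. For an integer $k\ge 1$, a colored digraph is $k$-spanning if its arcs that lie in arc-color classes of maximal valency at most $k$ form a strongly connected digraph on the whole vertex set. A colored tournament is a colored digraph without loops in which any two distinct vertices are joined by exactly one arc. Let $k\ge 1$ and $n\ge 2$, let $X$ and $Y$ be $k$-spanning colored tournaments with $n$ vertices, with vertex sets $\Omega$ and $\Delta$, and let $\alpha\in\Omega$. Then one can construct, in time polynomial in $n$ (uniformly in $k$), $n$ pairwise distinct colored tournaments $T_\beta$, $\beta\in\Delta$, on the vertex set $\Omega\sqcup\Delta\sqcup\Omega'\sqcup\{\mu\}$, where $\Omega'$ is a copy of $\Omega$ and $\alpha'\in\Omega'$ is the copy of $\alpha$,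 such that: (a) each $T_\beta$ (which has $3n+1$ vertices) is $\max\{3,k\}$-spanning and has a singleton vertex-color class; (b) if $H_\beta$ denotes the set of all $f\in\mathrm{Aut}(T_\beta)$ that send $\alpha,\beta,\alpha'$ to $\beta,\alpha',\alpha$, respectively, then every $f\in H_\beta$ maps $\Omega$ onto $\Delta$, and $$\mathrm{Iso}(X,Y)=\bigcup_{\beta\in\Delta}\{f|_{\Omega}: f\in H_\beta\}.$$ Moreover, $\mathrm{Iso}(X,Y)$ can be found efficiently in this form: given generating sets of the groups $\mathrm{Aut}(T_\beta)$, $\beta\in\Delta$, one can find all the sets $H_\beta$ in time polynomial in the size of this input, where for each $\beta$ either $H_\beta$ is found to be empty, or it is given as a coset of the point stabilizer $\mathrm{Aut}(T_\beta)_{\alpha,\beta,\alpha'}$ by a representative and a generating set of that stabilizer. -/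

import Mathlib

/-! ## Colored digraphs -/

/-- A colored digraph on `V`: a digraph with linearly ordered partitions of its vertex set and of
its arc set.  `vertexColor v` is the index of the vertex-color class of `v`; `arcColor u v` is
`none` if `(u, v)` is not an arc, and `some c` if `(u, v)` is an arc in the arc-color class with
index `c`.  The last two fields say that the indices of the (nonempty) classes form an initial
segment of `ℕ`, so that a colored digraph is exactly a digraph with two ordered partitions. -/
@[ext]
structure ColoredDigraph (V : Type*) where
  vertexColor : V → ℕ
  arcColor : V → V → Option ℕ
  vertexColor_initial : ∀ v, ∀ c ≤ vertexColor v, ∃ w, vertexColor w = c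
  arcColor_initial : ∀ u v d, arcColor u v = some d →
    ∀ c ≤ d, ∃ u' v', arcColor u' v' = some c

namespace ColoredDigraph

variable {V W : Type*}

/-- `(u, v)` is an arc of `X`. -/
def Adj (X : ColoredDigraph V) (u v : V) : Prop := ∃ c, X.arcColor u v = some c

/-- There are no loops, and any two distinct vertices are joined by exactly one arc. -/
def IsTournament (X : ColoredDigraph V) : Prop :=
  (∀ u, ¬ X.Adj u u) ∧ ∀ u v, u ≠ v → Xor (X.Adj u v) (X.Adj v u)

/-- The number of arcs with color `c` that leave `u`. -/
def outValency [Fintype V] (X : ColoredDigraph V) (c : ℕ) (u : V) : ℕ :=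
  (Finset.univ.filter fun v => X.arcColor u v = some c).card

/-- The union of the arc-color classes of maximal valency at most `k`, as a relation. -/
def SmallArc [Fintype V] (X : ColoredDigraph V) (k : ℕ) (u v : V) : Prop :=
  ∃ c, X.arcColor u v = some c ∧ ∀ w, X.outValency c w ≤ k

/-- `X` is `k`-spanning: the arcs in the classes of maximal valency at most `k` form a strongly
connected digraph on the whole vertex set. -/
def IsSpanning [Fintype V] (X : ColoredDigraph V) (k : ℕ) : Prop :=
  ∀ u v, Relation.ReflTransGen (X.SmallArc k) u v

/-- Some vertex-color class of `X` is a singleton. -/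
def HasSingletonClass (X : ColoredDigraph V) : Prop :=
  ∃ v, ∀ w, X.vertexColor w = X.vertexColor v → w = v

/-- The set of all isomorphisms from `X` to `Y`: the bijections that preserve arcs and non-arcs,
vertex colors and arc colors. -/
def Iso (X : ColoredDigraph V) (Y : ColoredDigraph W) : Set (V ≃ W) :=
  {f | (∀ v, Y.vertexColor (f v) = X.vertexColor v) ∧
    ∀ u v, Y.arcColor (f u) (f v) = X.arcColor u v}

/-- The automorphism group of `X`. -/
def Aut (X : ColoredDigraph V) : Subgroup (Equiv.Perm V) where
  carrier := Iso X X
  one_mem' := ⟨fun _ => rfl, fun _ _ => rfl⟩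
  mul_mem' := by
    rintro f g ⟨hf, hf'⟩ ⟨hg, hg'⟩
    exact ⟨fun v => (hf (g v)).trans (hg v), fun u v => (hf' (g u) (g v)).trans (hg' u v)⟩
  inv_mem' := by
    rintro f ⟨hf, hf'⟩
    refine ⟨fun v => ?_, fun u v => ?_⟩
    · simpa using (hf (f⁻¹ v)).symm
    · simpa using (hf' (f⁻¹ u) (f⁻¹ v)).symm

/-- The automorphisms of `X` that send `a`, `b`, `c` to `b`, `c`, `a`, respectively. -/
def rotating (X : ColoredDigraph V) (a b c : V) : Set (Equiv.Perm V) :=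
  {f | f ∈ X.Aut ∧ f a = b ∧ f b = c ∧ f c = a}

/-- The automorphisms of `X` that fix each of `a`, `b`, `c`. -/
def stabilizer₃ (X : ColoredDigraph V) (a b c : V) : Subgroup (Equiv.Perm V) :=
  X.Aut ⊓ MulAction.stabilizer (Equiv.Perm V) a ⊓ MulAction.stabilizer (Equiv.Perm V) b ⊓
    MulAction.stabilizer (Equiv.Perm V) c

end ColoredDigraph

/-! ## The vertex set of size `3n + 1`: three disjoint copies of `Fin n` and one more vertex -/

/-- The copy of `u` in the first block (the vertices of `X`). -/
def block₁ {n : ℕ} (u : Fin n) : Fin (3 * n + 1) := ⟨u, by omega⟩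

/-- The copy of `u` in the second block (the vertices of `Y`). -/
def block₂ {n : ℕ} (u : Fin n) : Fin (3 * n + 1) := ⟨n + u, by omega⟩

/-- The copy of `u` in the third block (the vertices of the second copy of `X`). -/
def block₃ {n : ℕ} (u : Fin n) : Fin (3 * n + 1) := ⟨2 * n + u, by omega⟩

/-! ## A random access machine with a step count

The memory consists of arrays of natural numbers, numbered by `ℕ`; a program can mention only
finitely many of them.  The only arithmetic operations are addition and truncated subtraction (no
multiplication), each at unit cost; with these operations, polynomial time is the usual notion. -/

namespace RAM

/-- `m a i` is the content of cell `i` of array `a`. -/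
abbrev Memory : Type := ℕ → ℕ → ℕ

/-- Expressions: constants, the content of a cell, sums, truncated differences. -/
inductive Expr : Type
  | lit (c : ℕ) : Expr
  | cell (a : ℕ) (i : Expr) : Expr
  | add (e₁ e₂ : Expr) : Expr
  | sub (e₁ e₂ : Expr) : Expr

/-- The value of an expression. -/
def Expr.eval (m : Memory) : Expr → ℕ
  | .lit c => c
  | .cell a i => m a (i.eval m)
  | .add e₁ e₂ => e₁.eval m + e₂.eval m
  | .sub e₁ e₂ => e₁.eval m - e₂.eval m

/-- The number of steps needed to evaluate an expression: one for each node. -/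
def Expr.cost : Expr → ℕ
  | .lit _ => 1
  | .cell _ i => i.cost + 1
  | .add e₁ e₂ => e₁.cost + e₂.cost + 1
  | .sub e₁ e₂ => e₁.cost + e₂.cost + 1

/-- Programs.  `assign a i v` writes the value of `v` into cell `i` of array `a`; `branch` and
`loop` test whether the value of an expression is nonzero. -/
inductive Program : Type
  | skip : Program
  | assign (a : ℕ) (i v : Expr) : Program
  | seq (P Q : Program) : Program
  | branch (e : Expr) (P Q : Program) : Program
  | loop (e : Expr) (P : Program) : Program

/-- Writing `x` into cell `i` of array `a`. -/
def Memory.write (m : Memory) (a i x : ℕ) : Memory :=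
  Function.update m a (Function.update (m a) i x)

/-- `Exec P m t m'`: started in memory `m`, the program `P` halts after exactly `t` steps, and
then the memory is `m'`. -/
inductive Exec : Program → Memory → ℕ → Memory → Prop
  | skip (m : Memory) : Exec .skip m 1 m
  | assign (m : Memory) (a : ℕ) (i v : Expr) :
      Exec (.assign a i v) m (i.cost + v.cost + 1) (m.write a (i.eval m) (v.eval m))
  | seq {P Q : Program} {m m' m'' : Memory} {t t' : ℕ} :
      Exec P m t m' → Exec Q m' t' m'' → Exec (.seq P Q) m (t + t') m''
  | branch_true {e : Expr} {P Q : Program} {m m' : Memory} {t : ℕ} :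
      e.eval m ≠ 0 → Exec P m t m' → Exec (.branch e P Q) m (e.cost + 1 + t) m'
  | branch_false {e : Expr} {P Q : Program} {m m' : Memory} {t : ℕ} :
      e.eval m = 0 → Exec Q m t m' → Exec (.branch e P Q) m (e.cost + 1 + t) m'
  | loop_true {e : Expr} {P : Program} {m m' m'' : Memory} {t t' : ℕ} :
      e.eval m ≠ 0 → Exec P m t m' → Exec (.loop e P) m' t' m'' →
      Exec (.loop e P) m (e.cost + 1 + t + t') m''
  | loop_false {e : Expr} {P : Program} {m : Memory} :
      e.eval m = 0 → Exec (.loop e P) m (e.cost + 1) m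

/-- The initial memory: array `0` holds the input, all other cells are `0`. -/
def initial (input : List ℕ) : Memory := fun a i => if a = 0 then input.getD i 0 else 0

/-- On the given input, `P` halts after at most `t` steps, with the given output in array `1`.
(All codes below are self-delimiting, so no lengths need to be stored.) -/
def Program.Computes (P : Program) (input output : List ℕ) (t : ℕ) : Prop :=
  ∃ s m, s ≤ t ∧ Exec P (initial input) s m ∧
    ∀ (i : ℕ) (h : i < output.length), m 1 i = output[i]

end RAM

/-! ## Codes of the objects as lists of natural numbers -/

/-- The code of an entry of the arc-color matrix: `0` for a non-arc, `c + 1` for color `c`. -/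
def codeColor : Option ℕ → ℕ
  | none => 0
  | some c => c + 1

/-- The vertex colors, followed by the rows of the arc-color matrix. -/
def codeDigraph {n : ℕ} (X : ColoredDigraph (Fin n)) : List ℕ :=
  List.ofFn X.vertexColor ++
    (List.finRange n).flatMap fun u => List.ofFn fun v => codeColor (X.arcColor u v)

/-- The code of two colored digraphs with `n` vertices and a vertex of the first one. -/
def codeInput {n : ℕ} (X Y : ColoredDigraph (Fin n)) (α : Fin n) : List ℕ :=
  [n, (α : ℕ)] ++ codeDigraph X ++ codeDigraph Y

/-- The code of a family of `n` colored digraphs. -/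
def codeFamily {n N : ℕ} (T : Fin n → ColoredDigraph (Fin N)) : List ℕ :=
  (List.finRange n).flatMap fun β => codeDigraph (T β)

/-- The list of the values of a permutation. -/
def codePerm {N : ℕ} (f : Equiv.Perm (Fin N)) : List ℕ := List.ofFn fun i => (f i : ℕ)

/-- A list of permutations, preceded by its length. -/
def codePerms {N : ℕ} (S : List (Equiv.Perm (Fin N))) : List ℕ :=
  S.length :: S.flatMap codePerm

/-- The code of `n`, a vertex `α`, and `n` lists of permutations. -/
def codeGenerators {n N : ℕ} (α : Fin n) (S : Fin n → List (Equiv.Perm (Fin N))) : List ℕ :=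
  [n, (α : ℕ)] ++ (List.finRange n).flatMap fun β => codePerms (S β)

/-- The code of the empty set (`none`), or of a coset given by a representative and a list of
generators of the subgroup. -/
def codeCoset {N : ℕ} : Option (Equiv.Perm (Fin N) × List (Equiv.Perm (Fin N))) → List ℕ
  | none => [0]
  | some (g, S) => 1 :: (codePerm g ++ codePerms S)

/-- The code of a family of `n` (possibly empty) cosets. -/
def codeCosets {n N : ℕ}
    (R : Fin n → Option (Equiv.Perm (Fin N) × List (Equiv.Perm (Fin N)))) : List ℕ :=
  (List.finRange n).flatMap fun β => codeCoset (R β)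

/-- The subgroup generated by the permutations in a list. -/
def generated {V : Type*} (S : List (Equiv.Perm V)) : Subgroup (Equiv.Perm V) :=
  Subgroup.closure {s | s ∈ S}

/-- `R` describes the set `H` as empty, or as the coset of the subgroup `K` with a given
representative, where `K` is given by generators.  (In `g * s` the factor `s` acts first.) -/
def DescribesCoset {V : Type*} (R : Option (Equiv.Perm V × List (Equiv.Perm V)))
    (K : Subgroup (Equiv.Perm V)) (H : Set (Equiv.Perm V)) : Prop :=
  match R with
  | none => H = ∅
  | some (g, S) => generated S = K ∧ H = {f | ∃ s ∈ K, f = g * s}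

/-! The tournament for `β` (`rotationTournament`) has three blocks x, y, z, which carry `X`, `Y` and
a second copy of `X`, and a vertex `top` with a vertex color of its own. Arcs between blocks go
round the cycle x → y → z → x. Outside the blocks two new arc colors are used, with codes s and s +
1. The arcs α → β → α' → α have code s, and all other arcs between blocks have code s + 1. The top
sends arcs of code s to α, β, α' and receives arcs of code s from all other vertices. So the class s
has valency at most 3 (`smallArc_newCode`), and it connects the blocks: one leaves a block for the
top at an unmarked vertex and enters any block from the top at its marked vertex. Inside the blocks
the small classes of `X` and `Y` do the rest (`isSpanning_rotationTournament`).

One obstacle remains. Colors of `X` and `Y` with the same index become one class, which may be small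
in `X` and large in `Y`. But if some color has different maximal valencies in `X` and `Y`, there are
no isomorphisms at all; in this case the colors of `Y` are shifted beyond those of `X`
(`colorShift`). The test compares the valencies with each other and not with `k`, so the
construction is uniform in `k`.

An isomorphism g extends to the automorphism that maps x to y by g, y to z by the inverse of g, and
z to x identically (`exists_rotating_of_iso`). Conversely, let an automorphism send α to β. Old
colors occur only inside blocks, and every other vertex of x is joined to α by an old color, so its
image lies in the block of β. The induced map from x to y preserves colors once the shift is seen to
be 0 (`exists_iso_of_rotating`).

For the cosets, let the group act on triples of points. The rotating automorphisms are the elements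
that take (α, β, α') to (β, α', α), and the point stabilizer is the stabilizer of one triple. The
orbit has at most (3n + 1)³ elements, so it can be enumerated together with representatives, and
Schreier's lemma yields generators of the stabilizer (`mem_closure_schreierGens`,
`describesCoset_transporter`). Working with triples makes a single Schreier step sufficient, so no
chain of stabilizers with growing generating sets arises.

The time bounds are read off from syntax. Terms and commands have only bounded loops, whose lengths
are cut off at the content of a fixed cell; hence the compiled program takes a number of steps
polynomial in that content (`Term.halts_compile`, `Cmd.halts`), and correctness becomes a statement
about the functions `eval`, `run` and `gen`. The cut-off is n for the construction; the coset search
uses n, then 3n + 1, and then the input length plus (3n + 1)³. -/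

namespace RAM

/-! ## Terms with bounded sums and suprema -/

/-- Terms: constants, variables (cell `0` of an array), cells, sums, truncated differences, case
distinctions (on whether the first argument is nonzero), and bounded sums and suprema. -/
inductive Term : Type
  | lit (c : ℕ) : Term
  | var (x : ℕ) : Term
  | cell (a : ℕ) (i : Term) : Term
  | add (s t : Term) : Term
  | sub (s t : Term) : Term
  | cond (c s t : Term) : Term
  | big (sup : Bool) (x : ℕ) (e t : Term) : Term

/-- The iteration of a function that may use the number of the round. -/
def rounds {α : Type*} (f : ℕ → α → α) (a : α) : ℕ → α
  | 0 => a
  | i + 1 => f i (rounds f a i)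

/-- Addition or supremum. -/
def bigOp (sup : Bool) (r v : ℕ) : ℕ := if sup then r + (v - r) else r + v

namespace Term

/-- The value of a term.  The ranges of sums and suprema are cut off at the content of cell `0` of
array `b`. -/
def eval (b : ℕ) : Term → Memory → ℕ
  | .lit c, _ => c
  | .var x, m => m x 0
  | .cell a i, m => m a (i.eval b m)
  | .add s t, m => s.eval b m + t.eval b m
  | .sub s t, m => s.eval b m - t.eval b m
  | .cond c s t, m => if c.eval b m = 0 then t.eval b m else s.eval b m
  | .big o x e t, m =>
    rounds (fun i r => bigOp o r (t.eval b (m.write x 0 i))) 0 (min (e.eval b m) (m b 0))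

/-- The arrays that a term reads. -/
def free : Term → List ℕ
  | .lit _ => []
  | .var _ => []
  | .cell a i => a :: i.free
  | .add s t => s.free ++ t.free
  | .sub s t => s.free ++ t.free
  | .cond c s t => c.free ++ (s.free ++ t.free)
  | .big _ _ e t => e.free ++ t.free

/-- The free variables of a term. -/
def vars : Term → List ℕ
  | .lit _ => []
  | .var x => [x]
  | .cell _ i => i.vars
  | .add s t => s.vars ++ t.vars
  | .sub s t => s.vars ++ t.vars
  | .cond c s t => c.vars ++ (s.vars ++ t.vars)
  | .big _ x e t => e.vars ++ t.vars.filter (· ≠ x)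

/-- The arrays on which the value of a term depends (besides the array of the bound). -/
def reads (t : Term) : List ℕ := t.free ++ t.vars

/-- The arrays used for bound variables. -/
def binders : Term → List ℕ
  | .lit _ => []
  | .var _ => []
  | .cell _ i => i.binders
  | .add s t => s.binders ++ t.binders
  | .sub s t => s.binders ++ t.binders
  | .cond c s t => c.binders ++ (s.binders ++ t.binders)
  | .big _ x e t => x :: (e.binders ++ t.binders)

/-- The two lists are disjoint. -/
def disj (l l' : List ℕ) : Bool := decide (∀ a ∈ l, a ∉ l')

/-- The bound variables can be stored in the arrays that carry their names. -/
def wf : Term → Bool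
  | .lit _ => true
  | .var _ => true
  | .cell a i => i.wf && decide (a ∉ i.binders)
  | .add s t => s.wf && t.wf && disj t.reads s.binders
  | .sub s t => s.wf && t.wf && disj t.reads s.binders
  | .cond c s t => c.wf && s.wf && t.wf && disj s.reads c.binders && disj t.reads c.binders
  | .big _ x e t => e.wf && t.wf && disj t.reads t.binders &&
      disj (t.free ++ t.vars.filter (· ≠ x)) e.binders && decide (x ∉ t.binders) &&
      decide (x ∉ t.free)

/-- The program that writes the value of a term into cell `0` of array `d`, where the arrays
from `d` on are available for intermediate results. -/
def compile (b : ℕ) : Term → ℕ → Program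
  | .lit c, d => .assign d (.lit 0) (.lit c)
  | .var x, d => .assign d (.lit 0) (.cell x (.lit 0))
  | .cell a i, d => .seq (i.compile b d) (.assign d (.lit 0) (.cell a (.cell d (.lit 0))))
  | .add s t, d => .seq (s.compile b d) (.seq (t.compile b (d + 1))
      (.assign d (.lit 0) (.add (.cell d (.lit 0)) (.cell (d + 1) (.lit 0)))))
  | .sub s t, d => .seq (s.compile b d) (.seq (t.compile b (d + 1))
      (.assign d (.lit 0) (.sub (.cell d (.lit 0)) (.cell (d + 1) (.lit 0)))))
  | .cond c s t, d => .seq (c.compile b d)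
      (.branch (.cell d (.lit 0)) (s.compile b d) (t.compile b d))
  | .big o x e t, d => .seq (e.compile b d) (.seq
      (.assign d (.lit 1) (.sub (.cell d (.lit 0))
        (.sub (.cell d (.lit 0)) (.cell b (.lit 0))))) (.seq
      (.assign d (.lit 0) (.lit 0)) (.seq
      (.assign x (.lit 0) (.lit 0))
      (.loop (.sub (.cell d (.lit 1)) (.cell x (.lit 0))) (.seq
        (t.compile b (d + 1)) (.seq
        (.assign d (.lit 0) (.add (.cell d (.lit 0)) (if o then
          (.sub (.cell (d + 1) (.lit 0)) (.cell d (.lit 0))) else .cell (d + 1) (.lit 0))))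
        (.assign x (.lit 0) (.add (.cell x (.lit 0)) (.lit 1)))))))))

open Polynomial in
/-- A bound for the number of steps, in terms of the cut-off. -/
noncomputable def cost : Term → Polynomial ℕ
  | .lit _ => 3
  | .var _ => 4
  | .cell _ i => i.cost + 5
  | .add s t => s.cost + t.cost + 7
  | .sub s t => s.cost + t.cost + 7
  | .cond c s t => c.cost + 3 + s.cost + t.cost
  | .big _ _ e t => e.cost + 22 + X * (t.cost + 23)

end Term

/-! ### Correctness and running time of compiled terms. -/

theorem Memory.write_apply (m : Memory) (a i x a' i' : ℕ) :
    m.write a i x a' i' = if a' = a then if i' = i then x else m a' i' else m a' i' := by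
  unfold Memory.write
  by_cases h : a' = a
  · subst h
    by_cases h' : i' = i <;> simp [h']
  · simp [h]

theorem Memory.write_of_ne (m : Memory) {a a' : ℕ} (h : a' ≠ a) (i x : ℕ) :
    m.write a i x a' = m a' := by
  simp [Memory.write, h]

/-- The program halts within `t` steps in a memory with the property `p`. -/
def Halts (P : Program) (m : Memory) (t : ℕ) (p : Memory → Prop) : Prop :=
  ∃ s m', s ≤ t ∧ Exec P m s m' ∧ p m'

theorem Halts.mono {P : Program} {m : Memory} {t t' : ℕ} {p p' : Memory → Prop}
    (h : Halts P m t p) (ht : t ≤ t') (hp : ∀ m', p m' → p' m') : Halts P m t' p' := by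
  obtain ⟨s, m', h₁, h₂, h₃⟩ := h
  exact ⟨s, m', h₁.trans ht, h₂, hp _ h₃⟩

theorem Halts.seq {P Q : Program} {m : Memory} {t t' : ℕ} {p q : Memory → Prop}
    (h : Halts P m t p) (h' : ∀ m', p m' → Halts Q m' t' q) : Halts (.seq P Q) m (t + t') q := by
  obtain ⟨s, m', h₁, h₂, h₃⟩ := h
  obtain ⟨s', m'', h₁', h₂', h₃'⟩ := h' m' h₃
  exact ⟨_, m'', Nat.add_le_add h₁ h₁', .seq h₂ h₂', h₃'⟩

theorem Halts.assign {a : ℕ} {i v : Expr} {m : Memory} {p : Memory → Prop}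
    (h : p (m.write a (i.eval m) (v.eval m))) :
    Halts (.assign a i v) m (i.cost + v.cost + 1) p :=
  ⟨_, _, le_rfl, .assign .., h⟩

/-- A loop that counts in cell `0` of array `x`. -/
theorem Halts.loop {e : Expr} {P : Program} {t N : ℕ} (I : ℕ → Memory → Prop)
    (he : ∀ i m, I i m → e.eval m = N - i)
    (hP : ∀ i m, i < N → I i m → Halts P m t (I (i + 1))) (i : ℕ) (hi : i ≤ N)
    (m : Memory) (hm : I i m) :
    Halts (.loop e P) m ((N - i) * (e.cost + 1 + t) + (e.cost + 1)) (I N) := by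
  induction hk : N - i generalizing i m with
  | zero =>
    obtain rfl : i = N := by omega
    exact ⟨_, m, by simp, .loop_false (by simp [he i m hm]), hm⟩
  | succ k ih =>
    obtain ⟨s, m', h₁, h₂, h₃⟩ := hP i m (by omega) hm
    obtain ⟨s', m'', h₁', h₂', h₃'⟩ := ih (i + 1) (by omega) m' h₃ (by omega)
    refine ⟨_, m'', ?_, .loop_true (by rw [he i m hm]; omega) h₂ h₂', h₃'⟩
    rw [add_mul]
    omega

namespace Term

theorem disj_iff {l l' : List ℕ} : disj l l' = true ↔ ∀ a ∈ l, a ∉ l' := by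
  simp [disj]

theorem rounds_congr {α : Type*} {f g : ℕ → α → α} {a : α} {n : ℕ}
    (h : ∀ i < n, ∀ r, f i r = g i r) : rounds f a n = rounds g a n := by
  induction n with
  | zero => rfl
  | succ n ih =>
    rw [rounds, rounds, ih fun i hi => h i (by omega), h n (by omega)]

/-- A variable is only read through cell `0` of its array, so for variables agreement in that cell
is enough. The array of the cut-off must not serve as a bound variable, since subterms would then
see another cut-off. -/
theorem eval_congr {b : ℕ} (t : Term) : ∀ {m m' : Memory}, (∀ a ∈ t.free, m a = m' a) →
    (∀ x ∈ t.vars, m x 0 = m' x 0) → b ∉ t.binders → m b 0 = m' b 0 →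
    t.eval b m = t.eval b m' := by
  induction t with
  | lit c => intros; rfl
  | var x => intro m m' _ h _ _; exact h x (by simp [vars])
  | cell a i ih =>
    intro m m' h hv hb h0
    simp only [free, List.mem_cons, forall_eq_or_imp] at h
    simp only [eval, ih h.2 hv hb h0, h.1]
  | add s t ihs iht =>
    intro m m' h hv hb h0
    simp only [free, vars, binders, List.mem_append, not_or, or_imp, forall_and] at h hv hb
    simp only [eval, ihs h.1 hv.1 hb.1 h0, iht h.2 hv.2 hb.2 h0]
  | sub s t ihs iht =>
    intro m m' h hv hb h0
    simp only [free, vars, binders, List.mem_append, not_or, or_imp, forall_and] at h hv hb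
    simp only [eval, ihs h.1 hv.1 hb.1 h0, iht h.2 hv.2 hb.2 h0]
  | cond c s t ihc ihs iht =>
    intro m m' h hv hb h0
    simp only [free, vars, binders, List.mem_append, not_or, or_imp, forall_and] at h hv hb
    simp only [eval, ihc h.1 hv.1 hb.1 h0, ihs h.2.1 hv.2.1 hb.2.1 h0,
      iht h.2.2 hv.2.2 hb.2.2 h0]
  | big o x e t ihe iht =>
    intro m m' h hv hb h0
    simp only [free, vars, binders, List.mem_append, List.mem_cons, not_or, or_imp,
      forall_and, List.mem_filter] at h hv hb
    simp only [eval]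
    rw [ihe h.1 hv.1 hb.2.1 h0, h0]
    apply rounds_congr
    intro i _ r
    rw [iht (m := m.write x 0 i) (m' := m'.write x 0 i) _ _ hb.2.2]
    · rw [Memory.write_of_ne _ hb.1, Memory.write_of_ne _ hb.1, h0]
    · intro a ha
      ext j
      simp only [Memory.write_apply, h.2 a ha]
    · intro y hy
      simp only [Memory.write_apply, if_true]
      split_ifs with hyx
      · rfl
      · exact hv.2 y ⟨hy, by simpa using hyx⟩

/-- A result that waits in array `d` is safe, because the next operand is compiled at `d + 1`. Below
`d` an evaluation only destroys the arrays of its bound variables, and `wf` guarantees that what is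
evaluated later does not read them. -/
theorem halts_compile {b : ℕ} (hb : b < 100) (t : Term) : ∀ (d : ℕ) (m : Memory), 100 ≤ d →
    t.wf → (∀ a ∈ t.reads, a < 100) → (∀ a ∈ t.binders, a < 100) → b ∉ t.binders →
    Halts (t.compile b d) m (t.cost.eval (m b 0))
      fun m' => m' d 0 = t.eval b m ∧ ∀ a < d, a ∉ t.binders → m' a = m a := by
  -- If an earlier subterm has overwritten only its own bound variables `l`, then a term that reads
  -- none of them keeps its value, and the cut-off is intact.
  have key : ∀ (u : Term) {m m' : Memory} {d : ℕ} {l : List ℕ}, 100 ≤ d → b ∉ l →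
      (∀ a ∈ u.reads, a < 100) → (∀ a ∈ u.reads, a ∉ l) → b ∉ u.binders →
      (∀ a < d, a ∉ l → m' a = m a) → m' b 0 = m b 0 ∧ u.eval b m' = u.eval b m := by
    intro u m m' d l hd hbl hr hl hbu h
    have h0 : m' b 0 = m b 0 := by rw [h b (by omega) hbl]
    refine ⟨h0, eval_congr u (fun a ha => h a ?_ ?_) (fun a ha => ?_) hbu h0⟩
    · have := hr a (by simp [reads, ha]); omega
    · exact hl a (by simp [reads, ha])
    · rw [h a _ (hl a (by simp [reads, ha]))]
      have := hr a (by simp [reads, ha]); omega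
  induction t with
  | lit c =>
    intro d m hd _ _ _ _
    refine (Halts.assign (p := fun m' => m' d 0 = _ ∧ ∀ a < d, a ∉ [] → m' a = m a) ?_).mono ?_
      fun m' h => h
    · refine ⟨by simp [Memory.write_apply, Expr.eval, eval], fun a ha _ =>
        Memory.write_of_ne _ (by omega) ..⟩
    · simp [Expr.cost, cost]
  | var x =>
    intro d m hd _ _ _ _
    refine (Halts.assign (p := fun m' => m' d 0 = _ ∧ ∀ a < d, a ∉ [] → m' a = m a) ?_).mono ?_
      fun m' h => h
    · refine ⟨by simp [Memory.write_apply, Expr.eval, eval], fun a ha _ =>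
        Memory.write_of_ne _ (by omega) ..⟩
    · simp [Expr.cost, cost]
  | cell a i ih =>
    intro d m hd hw hr hbd hb'
    simp only [wf, Bool.and_eq_true, decide_eq_true_eq] at hw
    have hr' : ∀ x ∈ i.reads, x < 100 := fun x hx => hr x (by
      simp only [reads, free, vars, List.mem_append, List.mem_cons] at hx ⊢; tauto)
    refine Halts.mono (Halts.seq (ih d m hd hw.1 hr' hbd hb') (t' := 5)
      (q := fun m' => m' d 0 = m a (i.eval b m) ∧ ∀ x < d, x ∉ i.binders → m' x = m x) ?_) ?_
      fun m' h => h
    · rintro m' ⟨h₁, h₂⟩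
      refine (Halts.assign ?_).mono (by simp [Expr.cost]) fun m' h => h
      have : a < 100 := hr a (by simp [reads, free])
      refine ⟨by simp [Memory.write_apply, Expr.eval, h₁, h₂ a (by omega) hw.2],
        fun x hx hxb => ?_⟩
      rw [Memory.write_of_ne _ (by omega), h₂ x hx hxb]
    · simp [cost]
  | add s t ihs iht =>
    intro d m hd hw hr hbd hb'
    simp only [wf, Bool.and_eq_true, disj_iff] at hw
    simp only [binders, List.mem_append, not_or] at hb' hbd
    have hrs : ∀ x ∈ s.reads, x < 100 := fun x hx => hr x (by
      simp only [reads, free, vars, List.mem_append] at hx ⊢; tauto)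
    have hrt : ∀ x ∈ t.reads, x < 100 := fun x hx => hr x (by
      simp only [reads, free, vars, List.mem_append] at hx ⊢; tauto)
    refine Halts.mono (Halts.seq (ihs d m hd hw.1.1 hrs (fun a ha => hbd a (.inl ha)) hb'.1)
      (t' := t.cost.eval (m b 0) + 7)
      (q := fun m' => m' d 0 = s.eval b m + t.eval b m ∧
        ∀ x < d, x ∉ s.binders ++ t.binders → m' x = m x) ?_) ?_ fun m' h => h
    · rintro m₁ ⟨h₁, h₂⟩
      obtain ⟨e₀, e₁⟩ := key t hd hb'.1 hrt hw.2 hb'.2 h₂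
      refine Halts.mono (Halts.seq (iht (d + 1) m₁ (by omega) hw.1.2 hrt
        (fun a ha => hbd a (.inr ha)) hb'.2) (t' := 7) ?_) (by rw [e₀]) fun m' h => h
      rintro m₂ ⟨h₃, h₄⟩
      refine (Halts.assign ?_).mono (by simp [Expr.cost]) fun m' h => h
      have : d ∉ t.binders := fun h => by have := hbd d (.inr h); omega
      refine ⟨by simp [Memory.write_apply, Expr.eval, h₃, h₄ d (by omega) this, h₁, e₁],
        fun x hx hxb => ?_⟩
      simp only [List.mem_append, not_or] at hxb
      rw [Memory.write_of_ne _ (by omega), h₄ x (by omega) hxb.2, h₂ x hx hxb.1]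
    · simp [cost]; omega
  | sub s t ihs iht =>
    intro d m hd hw hr hbd hb'
    simp only [wf, Bool.and_eq_true, disj_iff] at hw
    simp only [binders, List.mem_append, not_or] at hb' hbd
    have hrs : ∀ x ∈ s.reads, x < 100 := fun x hx => hr x (by
      simp only [reads, free, vars, List.mem_append] at hx ⊢; tauto)
    have hrt : ∀ x ∈ t.reads, x < 100 := fun x hx => hr x (by
      simp only [reads, free, vars, List.mem_append] at hx ⊢; tauto)
    refine Halts.mono (Halts.seq (ihs d m hd hw.1.1 hrs (fun a ha => hbd a (.inl ha)) hb'.1)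
      (t' := t.cost.eval (m b 0) + 7)
      (q := fun m' => m' d 0 = s.eval b m - t.eval b m ∧
        ∀ x < d, x ∉ s.binders ++ t.binders → m' x = m x) ?_) ?_ fun m' h => h
    · rintro m₁ ⟨h₁, h₂⟩
      obtain ⟨e₀, e₁⟩ := key t hd hb'.1 hrt hw.2 hb'.2 h₂
      refine Halts.mono (Halts.seq (iht (d + 1) m₁ (by omega) hw.1.2 hrt
        (fun a ha => hbd a (.inr ha)) hb'.2) (t' := 7) ?_) (by rw [e₀]) fun m' h => h
      rintro m₂ ⟨h₃, h₄⟩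
      refine (Halts.assign ?_).mono (by simp [Expr.cost]) fun m' h => h
      have : d ∉ t.binders := fun h => by have := hbd d (.inr h); omega
      refine ⟨by simp [Memory.write_apply, Expr.eval, h₃, h₄ d (by omega) this, h₁, e₁],
        fun x hx hxb => ?_⟩
      simp only [List.mem_append, not_or] at hxb
      rw [Memory.write_of_ne _ (by omega), h₄ x (by omega) hxb.2, h₂ x hx hxb.1]
    · simp [cost]; omega
  | cond c s t ihc ihs iht =>
    intro d m hd hw hr hbd hb'
    simp only [wf, Bool.and_eq_true, disj_iff] at hw
    simp only [binders, List.mem_append, not_or] at hb' hbd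
    have hrc : ∀ x ∈ c.reads, x < 100 := fun x hx => hr x (by
      simp only [reads, free, vars, List.mem_append] at hx ⊢; tauto)
    have hrs : ∀ x ∈ s.reads, x < 100 := fun x hx => hr x (by
      simp only [reads, free, vars, List.mem_append] at hx ⊢; tauto)
    have hrt : ∀ x ∈ t.reads, x < 100 := fun x hx => hr x (by
      simp only [reads, free, vars, List.mem_append] at hx ⊢; tauto)
    refine Halts.mono (Halts.seq (ihc d m hd hw.1.1.1.1 hrc (fun a ha => hbd a (.inl ha)) hb'.1)
      (t' := 3 + s.cost.eval (m b 0) + t.cost.eval (m b 0))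
      (q := fun m' => m' d 0 = (Term.cond c s t).eval b m ∧
        ∀ x < d, x ∉ c.binders ++ (s.binders ++ t.binders) → m' x = m x) ?_) ?_ fun m' h => h
    · rintro m₁ ⟨h₁, h₂⟩
      obtain ⟨e₀, e₁⟩ := key s hd hb'.1 hrs hw.1.2 hb'.2.1 h₂
      obtain ⟨-, e₂⟩ := key t hd hb'.1 hrt hw.2 hb'.2.2 h₂
      by_cases hc : c.eval b m = 0
      · obtain ⟨k, m₂, k₁, k₂, k₃, k₄⟩ := iht d m₁ hd hw.1.1.2 hrt
          (fun a ha => hbd a (.inr (.inr ha))) hb'.2.2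
        refine ⟨_, m₂, ?_, .branch_false (by simp [Expr.eval, h₁, hc]) k₂,
          by simp [eval, hc, k₃, e₂], fun x hx hxb => ?_⟩
        · rw [e₀] at k₁
          simp only [Expr.cost]; omega
        · simp only [List.mem_append, not_or] at hxb
          rw [k₄ x hx hxb.2.2, h₂ x hx hxb.1]
      · obtain ⟨k, m₂, k₁, k₂, k₃, k₄⟩ := ihs d m₁ hd hw.1.1.1.2 hrs
          (fun a ha => hbd a (.inr (.inl ha))) hb'.2.1
        refine ⟨_, m₂, ?_, .branch_true (by simp [Expr.eval, h₁, hc]) k₂,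
          by simp [eval, hc, k₃, e₁], fun x hx hxb => ?_⟩
        · rw [e₀] at k₁
          simp only [Expr.cost]; omega
        · simp only [List.mem_append, not_or] at hxb
          rw [k₄ x hx hxb.2.1, h₂ x hx hxb.1]
    · simp [cost]; omega
  | big o x e t ihe iht =>
    intro d m hd hw hr hbd hb'
    simp only [wf, Bool.and_eq_true, disj_iff, decide_eq_true_eq] at hw
    obtain ⟨⟨⟨⟨⟨hwe, hwt⟩, hw₁⟩, hw₂⟩, hw₃⟩, hw₄⟩ := hw
    simp only [binders, List.mem_append, List.mem_cons, not_or] at hb' hbd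
    have hx : x < 100 := hbd x (.inl rfl)
    have hre : ∀ x ∈ e.reads, x < 100 := fun y hy => hr y (by
      simp only [reads, free, vars, List.mem_append] at hy ⊢; tauto)
    have hrt : ∀ x ∈ t.reads, x < 100 := fun y hy => by
      by_cases hyx : y = x
      · omega
      · exact hr y (by
          simp only [reads, free, vars, List.mem_append, List.mem_filter] at hy ⊢
          simp [hyx]; tauto)
    set N := min (e.eval b m) (m b 0) with hN
    set f : ℕ → ℕ → ℕ := fun i r => bigOp o r (t.eval b (m.write x 0 i)) with hf
    have hbx : b ≠ x := hb'.1
    -- Cell `1` of array `d` keeps the number of rounds, which frees cell `0` for the accumulated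
    -- sum or supremum; the counter is the bound variable itself.
    let I : ℕ → Memory → Prop := fun i m' => m' d 1 = N ∧ m' x 0 = i ∧ m' d 0 = rounds f 0 i ∧
      ∀ a < d, a ∉ x :: (e.binders ++ t.binders) → m' a = m a
    have hI : ∀ i m', I i m' → m' b 0 = m b 0 ∧ t.eval b m' = t.eval b (m.write x 0 i) := by
      rintro i m' ⟨-, i₂, -, i₄⟩
      have h0 : m' b 0 = m b 0 := by
        rw [i₄ b (by omega) (by simp only [List.mem_append, List.mem_cons]; tauto)]
      have hag : ∀ a ∈ t.reads, a ≠ x → a ∉ e.binders → m' a = m a := fun a ha hax hae =>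
        i₄ a (by have := hrt a ha; omega) (by
          simp only [List.mem_append, List.mem_cons]
          have := hw₁ a ha
          tauto)
      refine ⟨h0, eval_congr t (fun a ha => ?_) (fun a ha => ?_) hb'.2.2 ?_⟩
      · have hax : a ≠ x := fun h => hw₄ (h ▸ ha)
        rw [Memory.write_of_ne _ hax]
        exact hag a (by simp [reads, ha]) hax (hw₂ a (by simp [ha]))
      · by_cases hax : a = x
        · simp [Memory.write_apply, hax, i₂]
        · rw [Memory.write_of_ne _ hax, hag a (by simp [reads, ha]) hax
            (hw₂ a (by simp [ha, hax]))]
      · rw [Memory.write_of_ne _ hbx, h0]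
    refine Halts.mono (Halts.seq (ihe d m hd hwe hre (fun a ha => hbd a (.inr (.inl ha))) hb'.2.1)
      (t' := 22 + m b 0 * (t.cost.eval (m b 0) + 23)) (q := I N) ?_) ?_ ?_
    · rintro m₁ ⟨h₁, h₂⟩
      have e₀ : m₁ b 0 = m b 0 := by rw [h₂ b (by omega) hb'.2.1]
      have hdx : d ≠ x := by omega
      have hbd' : b ≠ d := by omega
      refine Halts.mono (Halts.seq (Halts.assign (p := fun m' => m' d 1 = N ∧
        ∀ a < d, a ∉ x :: (e.binders ++ t.binders) → m' a = m a) ?_) (t' :=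
          12 + m b 0 * (t.cost.eval (m b 0) + 23)) (q := I N) ?_) ?_ fun m' h => h
      · refine ⟨?_, fun a ha hax => ?_⟩
        -- With truncated subtraction, `a - (a - c)` is the minimum of `a` and `c`.
        · simp [Memory.write_apply, Expr.eval, h₁, e₀, hN]; omega
        · simp only [List.mem_append, List.mem_cons, not_or] at hax
          rw [Memory.write_of_ne _ (by omega), h₂ a ha hax.2.1]
      · rintro m₂ ⟨i₁, i₂⟩
        refine Halts.mono (Halts.seq (Halts.assign (p := fun m' => m' d 1 = N ∧ m' d 0 = 0 ∧
          ∀ a < d, a ∉ x :: (e.binders ++ t.binders) → m' a = m a) ?_) (t' :=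
            9 + m b 0 * (t.cost.eval (m b 0) + 23)) (q := I N) ?_) ?_ fun m' h => h
        · refine ⟨?_, ?_, fun a ha hax => ?_⟩
          · simp [Memory.write_apply, Expr.eval, i₁]
          · simp [Memory.write_apply, Expr.eval]
          · rw [Memory.write_of_ne _ (by omega), i₂ a ha hax]
        · rintro m₃ ⟨j₁, j₂, j₃⟩
          refine Halts.mono (Halts.seq (Halts.assign (p := I 0) ?_) (t' :=
            6 + m b 0 * (t.cost.eval (m b 0) + 23)) (q := I N) ?_) ?_ fun m' h => h
          · refine ⟨?_, ?_, ?_, fun a ha hax => ?_⟩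
            · simp [Memory.write_apply, hdx, j₁]
            · simp [Memory.write_apply, Expr.eval]
            · simp [Memory.write_apply, hdx, j₂, rounds]
            · rw [Memory.write_of_ne _ (fun h => hax (by simp [h])), j₃ a ha hax]
          · intro m₄ hm₄
            refine (Halts.loop (t := t.cost.eval (m b 0) + 16) (N := N) I ?_ ?_ 0 (by omega) m₄
              hm₄).mono ?_ fun m' h => h
            · rintro i m' ⟨k₁, k₂, -, -⟩
              simp [Expr.eval, k₁, k₂]
            · intro i m₅ hi hm₅
              obtain ⟨k₀, k₁⟩ := hI i m₅ hm₅
              obtain ⟨l₁, l₂, l₃, l₄⟩ := hm₅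
              refine Halts.mono (Halts.seq (iht (d + 1) m₅ (by omega) hwt hrt
                (fun a ha => hbd a (.inr (.inr ha))) hb'.2.2) (t' := 16) (q := I (i + 1)) ?_)
                (by rw [k₀]) fun m' h => h
              rintro m₆ ⟨n₁, n₂⟩
              have hdt : d ∉ t.binders := fun h => by have := hbd d (.inr (.inr h)); omega
              have hd₆ := n₂ d (by omega) hdt
              have hx₆ := n₂ x (by omega) hw₃
              have hop : m₆ d 0 + (Expr.eval m₆ (if o then
                  (.sub (.cell (d + 1) (.lit 0)) (.cell d (.lit 0))) else .cell (d + 1) (.lit 0)))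
                  = rounds f 0 (i + 1) := by
                rw [show rounds f 0 (i + 1) = bigOp o (rounds f 0 i) (t.eval b (m.write x 0 i))
                  from rfl, ← k₁, ← n₁, ← l₃, ← hd₆]
                cases o <;> simp [bigOp, Expr.eval]
              refine (Halts.seq (Halts.assign (p := fun m' => m' d 1 = N ∧ m' x 0 = i ∧
                m' d 0 = rounds f 0 (i + 1) ∧
                ∀ a < d, a ∉ x :: (e.binders ++ t.binders) → m' a = m a) ?_) (t' := 6)
                (q := I (i + 1)) ?_).mono ?_ fun m' h => h
              · refine ⟨?_, ?_, ?_, fun a ha hax => ?_⟩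
                · simp [Memory.write_apply, Expr.eval, hd₆, l₁]
                · simp [Memory.write_apply, hdx.symm, hx₆, l₂]
                · simp only [Memory.write_apply, Expr.eval, if_true]
                  exact hop
                · have hax' := hax
                  simp only [List.mem_append, List.mem_cons, not_or] at hax'
                  rw [Memory.write_of_ne _ (by omega), n₂ a (by omega) hax'.2.2, l₄ a ha hax]
              · rintro m₇ ⟨o₁, o₂, o₃, o₄⟩
                refine (Halts.assign ?_).mono (by simp [Expr.cost]) fun m' h => h
                refine ⟨?_, ?_, ?_, fun a ha hax => ?_⟩
                · simp [Memory.write_apply, hdx, o₁]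
                · simp [Memory.write_apply, Expr.eval, o₂]
                · simp [Memory.write_apply, hdx, o₃]
                · rw [Memory.write_of_ne _ (fun h => hax (by simp [h])), o₄ a ha hax]
              · cases o <;> simp [Expr.cost]
            · simp only [Expr.cost, Nat.sub_zero]
              have : N ≤ m b 0 := min_le_right ..
              have := Nat.mul_le_mul_right (t.cost.eval (m b 0) + 23) this
              have := Nat.mul_le_mul_left N (show 1 + 1 + (1 + 1) + 1 + 1 +
                (t.cost.eval (m b 0) + 16) ≤ t.cost.eval (m b 0) + 23 by omega)
              omega
          · simp only [Expr.cost]; omega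
        · simp only [Expr.cost]; omega
      · simp only [Expr.cost]; omega
    · simp [cost]; omega
    · rintro m' ⟨-, -, h, h'⟩
      exact ⟨h, h'⟩

end Term
end RAM

namespace RAM

/-! ## Commands with bounded loops -/

/-- The program arrays have numbers below `50`, and the arrays of bound variables have numbers
from `50` to `99`. -/
def Term.ok (t : Term) : Bool :=
  t.wf && decide (∀ a ∈ t.reads, a < 50) && decide (∀ a ∈ t.binders, 50 ≤ a ∧ a < 100)

/-- Commands: the empty command, assignments, case distinctions and bounded loops. -/
inductive Cmd : Type
  | skip : Cmd
  | set (a : ℕ) (i v : Term) : Cmd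
  | seq (P Q : Cmd) : Cmd
  | ite (c : Term) (P Q : Cmd) : Cmd
  | loop (x : ℕ) (e : Term) (P : Cmd) : Cmd

namespace Cmd

/-- The effect of a command on the memory.  The numbers of rounds are cut off at the content of
cell `0` of array `b`. -/
def run (b : ℕ) : Cmd → Memory → Memory
  | .skip, m => m
  | .set a i v, m => m.write a (i.eval b m) (v.eval b m)
  | .seq P Q, m => Q.run b (P.run b m)
  | .ite c P Q, m => if c.eval b m = 0 then Q.run b m else P.run b m
  | .loop x e P, m =>
    rounds (fun i m' => (P.run b m').write x 0 (i + 1))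
      ((m.write x 1 (min (e.eval b m) (m b 0))).write x 0 0) (min (e.eval b m) (m b 0))

/-- The arrays that may be changed by a command. -/
def writes : Cmd → List ℕ
  | .skip => []
  | .set a _ _ => [a]
  | .seq P Q => P.writes ++ Q.writes
  | .ite _ P Q => P.writes ++ Q.writes
  | .loop x _ P => x :: P.writes

/-- The command can be compiled. -/
def ok (b : ℕ) : Cmd → Bool
  | .skip => true
  | .set a i v => i.ok && v.ok && decide (a < 50) && decide (a ≠ b)
  | .seq P Q => P.ok b && Q.ok b
  | .ite c P Q => c.ok && P.ok b && Q.ok b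
  | .loop x e P => e.ok && P.ok b && decide (x < 50) && decide (x ≠ b) && decide (x ∉ P.writes)

/-- The program that carries out a command. -/
def compile (b : ℕ) : Cmd → Program
  | .skip => .skip
  | .set a i v => .seq (i.compile b 100) (.seq (v.compile b 101)
      (.assign a (.cell 100 (.lit 0)) (.cell 101 (.lit 0))))
  | .seq P Q => .seq (P.compile b) (Q.compile b)
  | .ite c P Q => .seq (c.compile b 100) (.branch (.cell 100 (.lit 0)) (P.compile b) (Q.compile b))
  | .loop x e P => .seq (e.compile b 100) (.seq
      (.assign x (.lit 1) (.sub (.cell 100 (.lit 0))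
        (.sub (.cell 100 (.lit 0)) (.cell b (.lit 0))))) (.seq
      (.assign x (.lit 0) (.lit 0))
      (.loop (.sub (.cell x (.lit 1)) (.cell x (.lit 0))) (.seq (P.compile b)
        (.assign x (.lit 0) (.add (.cell x (.lit 0)) (.lit 1)))))))

open Polynomial in
/-- A bound for the number of steps, in terms of the cut-off. -/
noncomputable def cost : Cmd → Polynomial ℕ
  | .skip => 1
  | .set _ i v => i.cost + v.cost + 5
  | .seq P Q => P.cost + Q.cost
  | .ite c P Q => c.cost + 3 + P.cost + Q.cost
  | .loop _ e P => e.cost + 19 + X * (P.cost + 12)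

/-- The frame rule: facts about an array pass through every command that does not write to it. For
concrete commands the side condition is decidable. -/
theorem run_of_notMem {b a : ℕ} (P : Cmd) : ∀ m, a ∉ P.writes → P.run b m a = m a := by
  induction P with
  | skip => intro m _; rfl
  | set a' i v =>
    intro m h
    exact Memory.write_of_ne _ (by simpa [writes] using h) ..
  | seq P Q ihP ihQ =>
    intro m h
    simp only [writes, List.mem_append, not_or] at h
    rw [run, ihQ _ h.2, ihP _ h.1]
  | ite c P Q ihP ihQ =>
    intro m h
    simp only [writes, List.mem_append, not_or] at h
    rw [run]
    split_ifs
    · rw [ihQ _ h.2]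
    · rw [ihP _ h.1]
  | loop x e P ih =>
    intro m h
    simp only [writes, List.mem_cons, not_or] at h
    have : ∀ i, ∀ m' : Memory, m' a = m a →
        rounds (fun i m' => (P.run b m').write x 0 (i + 1)) m' i a = m a := by
      intro i m' hm'
      induction i with
      | zero => exact hm'
      | succ i IH => rw [rounds, Memory.write_of_ne _ h.1, ih _ h.2, IH]
    exact this _ _ (by rw [Memory.write_of_ne _ h.1, Memory.write_of_ne _ h.1])

/-- Loop invariants. -/
theorem run_loop {b x : ℕ} {e : Term} {P : Cmd} {m : Memory} (I : ℕ → Memory → Prop) {N : ℕ}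
    (hN : min (e.eval b m) (m b 0) = N)
    (h0 : ∀ m' : Memory, (∀ a ∉ x :: P.writes, m' a = m a) → (∀ a, a ≠ x → m' a = m a) → I 0 m')
    (hI : ∀ i < N, ∀ m' m'' : Memory, (∀ a ∉ x :: P.writes, m' a = m a) → m' x 0 = i → I i m' →
      m'' x 0 = i + 1 → (∀ a, a ≠ x → m'' a = P.run b m' a) → I (i + 1) m'') :
    I N ((loop x e P).run b m) := by
  rw [run, hN]
  have : ∀ i ≤ N, ∀ m₀ : Memory, m₀ x 0 = 0 → I 0 m₀ → (∀ a ∉ x :: P.writes, m₀ a = m a) →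
      I i (rounds (fun i m' => (P.run b m').write x 0 (i + 1)) m₀ i) ∧
      rounds (fun i m' => (P.run b m').write x 0 (i + 1)) m₀ i x 0 = i ∧
      ∀ a ∉ x :: P.writes, rounds (fun i m' => (P.run b m').write x 0 (i + 1)) m₀ i a = m a := by
    intro i hi m₀ h₁ h₂ h₃
    induction i with
    | zero => exact ⟨h₂, h₁, h₃⟩
    | succ i IH =>
      obtain ⟨k₁, k₂, k₃⟩ := IH (by omega)
      refine ⟨hI i (by omega) _ _ k₃ k₂ k₁ (by simp [rounds, Memory.write_apply]) fun a ha =>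
        by rw [rounds, Memory.write_of_ne _ ha], by simp [rounds, Memory.write_apply],
        fun a ha => ?_⟩
      have ha' := ha
      simp only [List.mem_cons, not_or] at ha'
      rw [rounds, Memory.write_of_ne _ ha'.1, run_of_notMem _ _ ha'.2, k₃ a ha]
  have hw : ∀ a, a ≠ x → ((m.write x 1 N).write x 0 0) a = m a := fun a ha => by
    rw [Memory.write_of_ne _ ha, Memory.write_of_ne _ ha]
  have hw' : ∀ a ∉ x :: P.writes, ((m.write x 1 N).write x 0 0) a = m a :=
    fun a ha => hw a fun h => ha (by simp [h])
  exact (this N le_rfl _ (by simp [Memory.write_apply]) (h0 _ hw' hw) hw').1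

end Cmd

theorem Term.ok_iff {t : Term} : t.ok = true ↔
    t.wf ∧ (∀ a ∈ t.reads, a < 50) ∧ ∀ a ∈ t.binders, 50 ≤ a ∧ a < 100 := by
  simp [Term.ok, and_assoc]

/-- The evaluation of a term inside a command. -/
theorem Term.halts_of_ok {b : ℕ} (hb : b < 50) {t : Term} (ht : t.ok) {m m₁ : Memory}
    (h : ∀ a < 50, m₁ a = m a) {d : ℕ} (hd : 100 ≤ d) :
    Halts (t.compile b d) m₁ (t.cost.eval (m b 0))
      fun m' => m' d 0 = t.eval b m ∧ (∀ a < 50, m' a = m a) ∧ ∀ a < d, 100 ≤ a → m' a = m₁ a := by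
  obtain ⟨h₁, h₂, h₃⟩ := Term.ok_iff.1 ht
  have hb' : b ∉ t.binders := fun h => by have := h₃ b h; omega
  have he : t.eval b m₁ = t.eval b m := Term.eval_congr t
    (fun a ha => h a (h₂ a (by simp [reads, ha])))
    (fun a ha => by rw [h a (h₂ a (by simp [reads, ha]))]) hb' (by rw [h b hb])
  refine (t.halts_compile (by omega) d m₁ hd h₁ (fun a ha => by have := h₂ a ha; omega)
    (fun a ha => (h₃ a ha).2) hb').mono (by rw [h b hb]) ?_
  rintro m' ⟨k₁, k₂⟩
  refine ⟨k₁.trans he, fun a ha => ?_, fun a ha ha' => ?_⟩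
  · rw [k₂ a (by omega) (fun h => by have := h₃ a h; omega), h a ha]
  · rw [k₂ a (by omega) (fun h => by have := h₃ a h; omega)]

/-- The cut-off is constant during a run, so one number bounds all loops, including nested ones. -/
theorem Cmd.run_bound {b : ℕ} (P : Cmd) (h : P.ok b) : b ∉ P.writes := by
  induction P with
  | skip => simp [writes]
  | set a i v => simp [ok] at h; simp [writes, Ne.symm h.2]
  | seq P Q ihP ihQ => simp [ok] at h; simp [writes, ihP h.1, ihQ h.2]
  | ite c P Q ihP ihQ => simp [ok] at h; simp [writes, ihP h.1.2, ihQ h.2]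
  | loop x e P ih => simp [ok] at h; simp [writes, ih h.1.1.1.2, Ne.symm h.1.2]

/-- The real memory `m₁` and the ideal memory `m` may differ from array `50` on, where bound
variables and intermediate results leave values that `run` does not model. Terms in a command depend
only on arrays below `50`, so agreement there propagates through the induction. -/
theorem Cmd.halts {b : ℕ} (hb : b < 50) (P : Cmd) : ∀ (m m₁ : Memory), P.ok b →
    (∀ a < 50, m₁ a = m a) →
    Halts (P.compile b) m₁ (P.cost.eval (m b 0)) fun m' => ∀ a < 50, m' a = P.run b m a := by
  induction P with
  | skip =>
    intro m m₁ _ h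
    exact ⟨1, m₁, by simp [cost], .skip _, h⟩
  | set a i v =>
    intro m m₁ hok h
    simp only [ok, Bool.and_eq_true, decide_eq_true_eq] at hok
    refine (Halts.seq (Term.halts_of_ok hb hok.1.1.1 h le_rfl) (t' := v.cost.eval (m b 0) + 5)
      (q := fun m' => ∀ a' < 50, m' a' = m.write a (i.eval b m) (v.eval b m) a')
      ?_).mono ?_ fun m' h => h
    · rintro m₂ ⟨h₁, h₂, -⟩
      refine (Halts.seq (Term.halts_of_ok hb hok.1.1.2 h₂ (d := 101) (by omega))
        (t' := 5) ?_).mono le_rfl fun m' h => h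
      rintro m₃ ⟨k₁, k₂, k₃⟩
      refine (Halts.assign fun a' ha' => ?_).mono (by simp [Expr.cost]) fun m' h => h
      ext j
      simp only [Expr.eval, k₁, k₃ 100 (by omega) le_rfl, h₁, Memory.write_apply, k₂ a' ha']
    · simp [cost]; omega
  | seq P Q ihP ihQ =>
    intro m m₁ hok h
    simp only [ok, Bool.and_eq_true] at hok
    refine (Halts.seq (ihP m m₁ hok.1 h) (t' := Q.cost.eval (m b 0)) fun m' hm' => ?_).mono
      (by simp [cost]) fun m' h => h
    refine (ihQ _ m' hok.2 hm').mono ?_ fun m' h => h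
    rw [run_of_notMem P m (P.run_bound hok.1)]
  | ite c P Q ihP ihQ =>
    intro m m₁ hok h
    simp only [ok, Bool.and_eq_true] at hok
    refine (Halts.seq (Term.halts_of_ok hb hok.1.1 h le_rfl) (t' := 3 + P.cost.eval (m b 0) +
      Q.cost.eval (m b 0)) (q := fun m' => ∀ a < 50, m' a = (Cmd.ite c P Q).run b m a)
      ?_).mono ?_ fun m' h => h
    · rintro m₂ ⟨h₁, h₂, -⟩
      by_cases hc : c.eval b m = 0
      · obtain ⟨k, m₃, k₁, k₂, k₃⟩ := ihQ m m₂ hok.2 h₂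
        exact ⟨_, m₃, by simp only [Expr.cost]; omega,
          .branch_false (by simp [Expr.eval, h₁, hc]) k₂, by simpa [run, hc] using k₃⟩
      · obtain ⟨k, m₃, k₁, k₂, k₃⟩ := ihP m m₂ hok.1.2 h₂
        exact ⟨_, m₃, by simp only [Expr.cost]; omega,
          .branch_true (by simp [Expr.eval, h₁, hc]) k₂, by simpa [run, hc] using k₃⟩
    · simp [cost]; omega
  | loop x e P ih =>
    intro m m₁ hok h
    simp only [ok, Bool.and_eq_true, decide_eq_true_eq] at hok
    obtain ⟨⟨⟨⟨hok₁, hok₂⟩, hx⟩, hxb⟩, hxP⟩ := hok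
    set N := min (e.eval b m) (m b 0) with hN
    set f : ℕ → Memory → Memory := fun i m' => (P.run b m').write x 0 (i + 1) with hf
    set m₀ := (m.write x 1 N).write x 0 0 with hm₀
    have hbP := P.run_bound hok₂
    -- The body writes neither to `x` nor to `b`, so the loop test stays meaningful and every round
    -- has the same cut-off.
    have hr : ∀ i, rounds f m₀ i x 0 = i ∧ rounds f m₀ i x 1 = N ∧ rounds f m₀ i b 0 = m b 0 := by
      intro i
      induction i with
      | zero => simp [rounds, hm₀, Memory.write_apply, Ne.symm hxb]
      | succ i IH =>
        simp [rounds, hf, Memory.write_apply, Ne.symm hxb, run_of_notMem P _ hxP,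
          run_of_notMem P _ hbP]
        exact IH.2
    let I : ℕ → Memory → Prop := fun i m' => ∀ a < 50, m' a = rounds f m₀ i a
    refine (Halts.seq (Term.halts_of_ok hb hok₁ h le_rfl)
      (t' := 19 + m b 0 * (P.cost.eval (m b 0) + 12)) (q := I N) ?_).mono ?_ fun m' h => h
    · rintro m₂ ⟨h₁, h₂, -⟩
      refine (Halts.seq (Halts.assign (p := fun m' => ∀ a < 50, m' a = m.write x 1 N a) ?_)
        (t' := 9 + m b 0 * (P.cost.eval (m b 0) + 12)) (q := I N) ?_).mono ?_ fun m' h => h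
      · intro a ha
        ext j
        simp only [Memory.write_apply, Expr.eval, h₁, h₂ a ha, h₂ b hb]
        rw [show e.eval b m - (e.eval b m - m b 0) = N by omega]
      · intro m₃ h₃
        refine (Halts.seq (Halts.assign (p := I 0) ?_)
          (t' := 6 + m b 0 * (P.cost.eval (m b 0) + 12)) (q := I N) ?_).mono ?_ fun m' h => h
        · intro a ha
          ext j
          simp only [rounds, hm₀, Memory.write_apply (m.write x 1 N), Expr.eval, ← h₃ a ha]
          rw [Memory.write_apply]
        · intro m₄ hm₄
          refine (Halts.loop (t := P.cost.eval (m b 0) + 6) (N := N) I ?_ ?_ 0 (by omega) m₄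
            hm₄).mono ?_ fun m' h => h
          · intro i m' hm'
            simp only [Expr.eval, hm' x hx, (hr i).1, (hr i).2.1]
          · intro i m' hi hm'
            refine (Halts.seq (ih (rounds f m₀ i) m' hok₂ hm') (t' := 6) (q := I (i + 1))
              ?_).mono (by rw [(hr i).2.2]) fun m' h => h
            intro m'' hm''
            refine (Halts.assign fun a ha => ?_).mono (by simp [Expr.cost]) fun m' h => h
            ext j
            simp only [rounds, hf, Memory.write_apply, Expr.eval, hm'' a ha, hm'' x hx,
              run_of_notMem P _ hxP]
            rw [(hr i).1]
          · simp only [Expr.cost, Nat.sub_zero]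
            have : N ≤ m b 0 := min_le_right ..
            have := Nat.mul_le_mul_right (P.cost.eval (m b 0) + 12) this
            rw [show 1 + 1 + (1 + 1) + 1 + 1 + (P.cost.eval (m b 0) + 6) =
              P.cost.eval (m b 0) + 12 by omega]
            omega
        · simp only [Expr.cost]; omega
      · simp only [Expr.cost]; omega
    · simp [cost]; omega

/-! ## Commands that write output -/

/-- The output that has been written, where cell `0` of array `2` contains its length. -/
def written (m : Memory) : List ℕ := (List.range (m 2 0)).map (m 1)

/-- Commands that append values to the output, in bounded loops. -/
inductive Emit : Type
  | one (t : Term) : Emit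
  | seq (P Q : Emit) : Emit
  | loop (x : ℕ) (e : Term) (P : Emit) : Emit

namespace Emit

/-- The command that appends the values to the output. -/
def toCmd : Emit → Cmd
  | .one t => .seq (.set 1 (.var 2) t) (.set 2 (.lit 0) (.add (.var 2) (.lit 1)))
  | .seq P Q => .seq P.toCmd Q.toCmd
  | .loop x e P => .loop x e P.toCmd

/-- The list of the appended values. -/
def gen (b : ℕ) : Emit → Memory → List ℕ
  | .one t, m => [t.eval b m]
  | .seq P Q, m => P.gen b m ++ Q.gen b m
  | .loop x e P, m =>
    (List.range (min (e.eval b m) (m b 0))).flatMap fun i => P.gen b (m.write x 0 i)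

/-- The arrays that are read. -/
def free : Emit → List ℕ
  | .one t => t.free
  | .seq P Q => P.free ++ Q.free
  | .loop _ e P => e.free ++ P.free

/-- The free variables. -/
def vars : Emit → List ℕ
  | .one t => t.vars
  | .seq P Q => P.vars ++ Q.vars
  | .loop x e P => e.vars ++ P.vars.filter (· ≠ x)

/-- The loop variables. -/
def binders : Emit → List ℕ
  | .one _ => []
  | .seq P Q => P.binders ++ Q.binders
  | .loop x _ P => x :: P.binders

/-- The output does not depend on what is changed. -/
def ok (b : ℕ) : Emit → Bool
  | .one t => t.ok && decide (1 ∉ t.reads) && decide (2 ∉ t.reads)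
  | .seq P Q => P.ok b && Q.ok b && Term.disj (Q.free ++ Q.vars) P.binders
  | .loop x e P => e.ok && P.ok b && Term.disj (P.free ++ P.vars) P.binders &&
      decide (x ∉ P.binders) && decide (x ∉ P.free) && decide (1 ∉ e.reads) &&
      decide (2 ∉ e.reads) && decide (2 < x) && decide (x < 50) &&
      decide (x ≠ b)

theorem gen_congr {b : ℕ} (hb : b < 50) (P : Emit) : ∀ {m m' : Memory}, P.ok b →
    (∀ a ∈ P.free, m a = m' a) → (∀ x ∈ P.vars, m x 0 = m' x 0) → m b 0 = m' b 0 →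
    P.gen b m = P.gen b m' := by
  have key : ∀ t : Term, t.ok → b ∉ t.binders := fun t ht h => by
    have := (Term.ok_iff.1 ht).2.2 b h; omega
  induction P with
  | one t =>
    intro m m' hok h hv h0
    simp only [ok, Bool.and_eq_true] at hok
    simp only [gen, t.eval_congr h hv (key t hok.1.1) h0]
  | seq P Q ihP ihQ =>
    intro m m' hok h hv h0
    simp only [ok, Bool.and_eq_true] at hok
    simp only [free, vars, List.mem_append, or_imp, forall_and] at h hv
    rw [gen, gen, ihP hok.1.1 h.1 hv.1 h0, ihQ hok.1.2 h.2 hv.2 h0]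
  | loop x e P ih =>
    intro m m' hok h hv h0
    simp only [ok, Bool.and_eq_true, decide_eq_true_eq] at hok
    simp only [free, vars, List.mem_append, or_imp, forall_and, List.mem_filter] at h hv
    rw [gen, gen, e.eval_congr h.1 hv.1 (key e hok.1.1.1.1.1.1.1.1.1) h0, h0]
    congr 1
    funext i
    refine ih hok.1.1.1.1.1.1.1.1.2 (fun a ha => ?_) (fun a ha => ?_) ?_
    · ext j
      simp only [Memory.write_apply, h.2 a ha]
    · simp only [Memory.write_apply, if_true]
      split_ifs with hax
      · rfl
      · exact hv.2 a ⟨ha, by simpa using hax⟩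
    · rw [Memory.write_of_ne _ (Ne.symm hok.2), Memory.write_of_ne _ (Ne.symm hok.2), h0]

theorem writes_toCmd (P : Emit) : ∀ a ∈ P.toCmd.writes, a = 1 ∨ a = 2 ∨ a ∈ P.binders := by
  induction P with
  | one t => simp [toCmd, Cmd.writes]
  | seq P Q ihP ihQ =>
    intro a ha
    simp only [toCmd, Cmd.writes, List.mem_append, binders] at ha ⊢
    rcases ha with ha | ha
    · have := ihP a ha; tauto
    · have := ihQ a ha; tauto
  | loop x e P ih =>
    intro a ha
    simp only [toCmd, Cmd.writes, List.mem_cons, binders] at ha ⊢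
    rcases ha with ha | ha
    · tauto
    · have := ih a ha; tauto

theorem ok_toCmd {b : ℕ} (hb : b ≠ 1 ∧ b ≠ 2) (P : Emit) (h : P.ok b) : P.toCmd.ok b := by
  induction P with
  | one t =>
    simp only [ok, Bool.and_eq_true] at h
    simp only [toCmd, Cmd.ok, Bool.and_eq_true, h, decide_eq_true_eq]
    refine ⟨⟨⟨⟨by decide, trivial⟩, by decide⟩, hb.1.symm⟩, ⟨⟨by decide, by decide⟩, by decide⟩,
      hb.2.symm⟩
  | seq P Q ihP ihQ =>
    simp only [ok, Bool.and_eq_true] at h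
    simp [toCmd, Cmd.ok, ihP h.1.1, ihQ h.1.2]
  | loop x e P ih =>
    simp only [ok, Bool.and_eq_true, decide_eq_true_eq] at h
    obtain ⟨⟨⟨⟨⟨⟨⟨⟨⟨h₁, h₂⟩, -⟩, h₃⟩, -⟩, -⟩, -⟩, h₄⟩, h₅⟩, h₆⟩ := h
    have : x ∉ P.toCmd.writes := fun hx => by
      rcases writes_toCmd P x hx with h | h | h
      · omega
      · omega
      · exact h₃ h
    simp [toCmd, Cmd.ok, h₁, ih h₂, h₅, h₆, this]

theorem not_binders_of_ok {b : ℕ} (P : Emit) (h : P.ok b) : ∀ a ∈ P.binders, 2 < a ∧ a ≠ b := by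
  induction P with
  | one t => simp [binders]
  | seq P Q ihP ihQ =>
    simp only [ok, Bool.and_eq_true] at h
    intro a ha
    rcases List.mem_append.1 ha with ha | ha
    · exact ihP h.1.1 a ha
    · exact ihQ h.1.2 a ha
  | loop x e P ih =>
    simp only [ok, Bool.and_eq_true, decide_eq_true_eq] at h
    simp only [binders, List.mem_cons, forall_eq_or_imp]
    exact ⟨⟨h.1.1.2, h.2⟩, ih h.1.1.1.1.1.1.1.1.2⟩

theorem not_reads_of_ok {b : ℕ} (P : Emit) (h : P.ok b) :
    ∀ a ∈ P.free ++ P.vars, a ≠ 1 ∧ a ≠ 2 := by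
  induction P with
  | one t =>
    simp only [ok, Bool.and_eq_true, decide_eq_true_eq] at h
    exact fun a ha => ⟨fun h' => h.1.2 (h' ▸ ha), fun h' => h.2 (h' ▸ ha)⟩
  | seq P Q ihP ihQ =>
    simp only [ok, Bool.and_eq_true] at h
    intro a ha
    simp only [free, vars, List.mem_append] at ha
    have h₁ := ihP h.1.1 a
    have h₂ := ihQ h.1.2 a
    simp only [List.mem_append] at h₁ h₂
    tauto
  | loop x e P ih =>
    simp only [ok, Bool.and_eq_true, decide_eq_true_eq] at h
    intro a ha
    simp only [free, vars, List.mem_append, List.mem_filter] at ha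
    have h₂ := ih h.1.1.1.1.1.1.1.1.2 a
    have h₃ : 1 ∉ e.reads := h.1.1.1.1.2
    have h₄ : 2 ∉ e.reads := h.1.1.1.2
    simp only [List.mem_append, Term.reads] at h₂ h₃ h₄
    refine ⟨?_, ?_⟩ <;> rintro rfl <;> tauto

/-- In `gen` each part is evaluated in the initial memory, whereas the running program has already
changed the output arrays `1`, `2` and some loop counters. The conditions in `ok` forbid reading
these, apart from the counters of enclosing loops, which `gen` sets explicitly; so `gen_congr`
reconciles the two. -/
theorem written_run {b : ℕ} (hb : b < 50) (hb' : b ≠ 1 ∧ b ≠ 2) (P : Emit) : ∀ m, P.ok b →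
    written (P.toCmd.run b m) = written m ++ P.gen b m := by
  have hfr : ∀ (P : Emit) (m : Memory) (a : ℕ), a ≠ 1 → a ≠ 2 → a ∉ P.binders →
      P.toCmd.run b m a = m a := fun P m a h₁ h₂ h₃ => Cmd.run_of_notMem _ _ fun h => by
    rcases writes_toCmd P a h with h | h | h
    · exact h₁ h
    · exact h₂ h
    · exact h₃ h
  induction P with
  | one t =>
    intro m hok
    simp only [toCmd, Cmd.run, gen, written, Term.eval, Memory.write_apply]
    simp only [if_true, List.range_succ, List.map_append, List.map_cons, List.map_nil,
      show (2 : ℕ) ≠ 1 by decide, if_false]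
    congr 1
    swap
    · simp [Memory.write_apply]
    apply List.map_congr_left
    intro i hi
    rw [List.mem_range] at hi
    simp [Memory.write_apply, hi.ne]
  | seq P Q ihP ihQ =>
    intro m hok
    simp only [ok, Bool.and_eq_true, Term.disj_iff] at hok
    obtain ⟨⟨hP, hQ⟩, hd⟩ := hok
    rw [toCmd, Cmd.run, ihQ _ hQ, ihP _ hP, gen, List.append_assoc]
    congr 2
    have hr := not_reads_of_ok Q hQ
    have hag : ∀ a ∈ Q.free ++ Q.vars, P.toCmd.run b m a = m a := fun a ha =>
      hfr P m a (hr a ha).1 (hr a ha).2 (hd a ha)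
    refine gen_congr hb Q hQ (fun a ha => hag a (by simp [ha]))
      (fun a ha => by rw [hag a (by simp [ha])]) ?_
    rw [hfr P m b hb'.1 hb'.2 fun h => (not_binders_of_ok P hP b h).2 rfl]
  | loop x e P ih =>
    intro m hok
    simp only [ok, Bool.and_eq_true, decide_eq_true_eq, Term.disj_iff] at hok
    obtain ⟨⟨⟨⟨⟨⟨⟨⟨⟨-, hP⟩, hd⟩, hx₁⟩, hx₂⟩, -⟩, -⟩, hx₃⟩, hx₄⟩, hxb⟩ := hok
    rw [toCmd, gen]
    refine Cmd.run_loop (fun i m' => written m' = written m ++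
      (List.range i).flatMap fun i => P.gen b (m.write x 0 i)) rfl ?_ ?_
    · intro m' _ hm'
      simp [written, hm' 1 (by omega), hm' 2 (by omega)]
    · intro i hi m' m'' h₁ h₂ h₃ h₄ h₅
      have hr := not_reads_of_ok P hP
      have : ∀ a ∈ P.free ++ P.vars, a ≠ x → m' a = m a := fun a ha hax => by
        refine h₁ a fun h => ?_
        rcases List.mem_cons.1 h with h | h
        · exact hax h
        rcases writes_toCmd P a h with h | h | h
        · exact (hr a ha).1 h
        · exact (hr a ha).2 h
        · exact hd a ha h
      have hg : P.gen b m' = P.gen b (m.write x 0 i) := by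
        refine gen_congr hb P hP (fun a ha => ?_) (fun a ha => ?_) ?_
        · have hax : a ≠ x := fun h => hx₂ (h ▸ ha)
          rw [Memory.write_of_ne _ hax, this a (by simp [ha]) hax]
        · by_cases hax : a = x
          · simp [Memory.write_apply, hax, h₂]
          · rw [Memory.write_of_ne _ hax, this a (by simp [ha]) hax]
        · rw [Memory.write_of_ne _ (Ne.symm hxb), h₁ b]
          intro h
          rcases List.mem_cons.1 h with h | h
          · exact hxb h.symm
          rcases writes_toCmd P b h with h | h | h
          · exact hb'.1 h
          · exact hb'.2 h
          · exact (not_binders_of_ok P hP b h).2 rfl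
      have hw : written m'' = written (P.toCmd.run b m') := by
        simp [written, h₅ 1 (by omega), h₅ 2 (by omega)]
      rw [hw, ih m' hP, h₃, hg, List.range_succ, List.flatMap_append, List.append_assoc]
      simp

end Emit
end RAM

namespace ColoredDigraph

variable {n : ℕ}

/-! ## Codes of arc colors -/

/-- The entry of the coded arc-color matrix. -/
def code (X : ColoredDigraph (Fin n)) (u v : Fin n) : ℕ := codeColor (X.arcColor u v)

/-- The largest code of an arc. -/
def maxCode (X : ColoredDigraph (Fin n)) : ℕ :=
  Finset.univ.sup fun u => Finset.univ.sup fun v => X.code u v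

/-- The largest vertex color. -/
def maxVertexColor (X : ColoredDigraph (Fin n)) : ℕ := Finset.univ.sup X.vertexColor

/-- The largest number of entries with code `c` in a row. -/
def maxCount (X : ColoredDigraph (Fin n)) (c : ℕ) : ℕ :=
  Finset.univ.sup fun u => (Finset.univ.filter fun v => X.code u v = c).card

/-- Some arc color has different maximal valencies in `X` and in `Y`. -/
def Mismatch (X Y : ColoredDigraph (Fin n)) : Prop :=
  ∃ u v, X.maxCount (X.code u v) ≠ Y.maxCount (X.code u v) ∨
    X.maxCount (Y.code u v) ≠ Y.maxCount (Y.code u v)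

/-- The inverse of `codeColor`. -/
def decodeColor : ℕ → Option ℕ
  | 0 => none
  | c + 1 => some c

@[simp]
theorem codeColor_decodeColor (c : ℕ) : codeColor (decodeColor c) = c := by
  cases c <;> rfl

@[simp]
theorem decodeColor_eq_some {c d : ℕ} : decodeColor c = some d ↔ c = d + 1 := by
  cases c <;> simp [decodeColor]

theorem codeColor_injective : Function.Injective codeColor := by
  intro a b h
  cases a <;> cases b <;> simp_all [codeColor]

theorem code_eq_iff {X : ColoredDigraph (Fin n)} {u v : Fin n} {c : ℕ} :
    X.code u v = c + 1 ↔ X.arcColor u v = some c := by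
  unfold code
  cases X.arcColor u v <;> simp [codeColor]

theorem code_ne_zero_iff {X : ColoredDigraph (Fin n)} {u v : Fin n} :
    X.code u v ≠ 0 ↔ X.Adj u v := by
  unfold code Adj
  cases X.arcColor u v <;> simp [codeColor]

theorem code_le_maxCode (X : ColoredDigraph (Fin n)) (u v : Fin n) : X.code u v ≤ X.maxCode :=
  (Finset.le_sup (f := fun v => X.code u v) (Finset.mem_univ v)).trans
    (Finset.le_sup (f := fun u => Finset.univ.sup fun v => X.code u v) (Finset.mem_univ u))

theorem vertexColor_le_max (X : ColoredDigraph (Fin n)) (u : Fin n) :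
    X.vertexColor u ≤ X.maxVertexColor :=
  Finset.le_sup (Finset.mem_univ u)

theorem exists_code_eq (X : ColoredDigraph (Fin n)) {c : ℕ} (h₁ : 1 ≤ c) (h₂ : c ≤ X.maxCode) :
    ∃ u v, X.code u v = c := by
  by_contra! h
  have : X.maxCode < c := by
    rw [maxCode, Finset.sup_lt_iff (show (⊥ : ℕ) < c from h₁)]
    intro u _
    rw [Finset.sup_lt_iff (show (⊥ : ℕ) < c from h₁)]
    intro v _
    by_contra! hc
    obtain ⟨d, hd⟩ : ∃ d, X.code u v = d + 1 := ⟨X.code u v - 1, by omega⟩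
    obtain ⟨u', v', h'⟩ := X.arcColor_initial u v d (code_eq_iff.1 hd) (c - 1) (by omega)
    exact h u' v' (by rw [code_eq_iff.2 h']; omega)
  omega

theorem exists_vertexColor_eq (X : ColoredDigraph (Fin n)) (hn : 0 < n) {c : ℕ}
    (h : c ≤ X.maxVertexColor) : ∃ u, X.vertexColor u = c := by
  obtain ⟨u, -, hu⟩ := Finset.exists_mem_eq_sup (Finset.univ : Finset (Fin n))
    ⟨⟨0, hn⟩, Finset.mem_univ _⟩ X.vertexColor
  exact X.vertexColor_initial u c (by rw [← hu]; exact h)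

theorem outValency_eq (X : ColoredDigraph (Fin n)) (c : ℕ) (u : Fin n) :
    X.outValency c u = (Finset.univ.filter fun v => X.code u v = c + 1).card := by
  unfold outValency
  congr 1
  ext v
  simp [code_eq_iff]

/-- The maximal valency is a number that does not involve `k`; this allows the construction to
compare classes of `X` and `Y` without knowing `k`. Codes are colors plus one. -/
theorem outValency_le_iff (X : ColoredDigraph (Fin n)) (c k : ℕ) :
    (∀ u, X.outValency c u ≤ k) ↔ X.maxCount (c + 1) ≤ k := by
  simp [maxCount, Finset.sup_le_iff, outValency_eq]

theorem maxCount_eq_zero {X : ColoredDigraph (Fin n)} {c : ℕ} (h : ∀ u v, X.code u v ≠ c) :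
    X.maxCount c = 0 := by
  simp [maxCount, h]

/-- `Mismatch` compares only codes that occur somewhere; a code that occurs in neither digraph has
count zero on both sides. -/
theorem maxCount_eq_of_not_mismatch {X Y : ColoredDigraph (Fin n)} (h : ¬ Mismatch X Y) (c : ℕ) :
    X.maxCount c = Y.maxCount c := by
  unfold Mismatch at h
  push Not at h
  by_cases hX : ∃ u v, X.code u v = c
  · obtain ⟨u, v, rfl⟩ := hX
    exact (h u v).1
  by_cases hY : ∃ u v, Y.code u v = c
  · obtain ⟨u, v, rfl⟩ := hY
    exact (h u v).2
  push Not at hX hY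
  rw [maxCount_eq_zero hX, maxCount_eq_zero hY]

theorem maxCount_eq_of_iso {X Y : ColoredDigraph (Fin n)} {g : Fin n ≃ Fin n} (hg : g ∈ Iso X Y)
    (c : ℕ) : X.maxCount c = Y.maxCount c := by
  have h : ∀ u, (Finset.univ.filter fun v => X.code u v = c).card =
      (Finset.univ.filter fun v => Y.code (g u) v = c).card := by
    intro u
    refine Finset.card_bij (fun v _ => g v) ?_ (fun _ _ _ _ h => g.injective h) ?_
    · intro v hv
      exact Finset.mem_filter.2
        ⟨Finset.mem_univ _, by simpa [code, hg.2] using (Finset.mem_filter.1 hv).2⟩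
    · intro v hv
      exact ⟨g.symm v, by simpa [code, ← hg.2, Finset.mem_filter] using (Finset.mem_filter.1 hv).2,
        by simp⟩
  refine le_antisymm (Finset.sup_le fun u _ => ?_) (Finset.sup_le fun u _ => ?_)
  · rw [h]
    exact Finset.le_sup (f := fun u => (Finset.univ.filter fun v => Y.code u v = c).card)
      (Finset.mem_univ (g u))
  · have := h (g.symm u)
    rw [g.apply_symm_apply] at this
    rw [← this]
    exact Finset.le_sup (f := fun u => (Finset.univ.filter fun v => X.code u v = c).card)
      (Finset.mem_univ (g.symm u))

/-- This is why separating the colors after a mismatch loses no isomorphism. The code `0` of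
non-arcs takes part in the comparison, harmlessly, since isomorphisms preserve non-arcs as well. -/
theorem not_mismatch_of_iso {X Y : ColoredDigraph (Fin n)} {g : Fin n ≃ Fin n}
    (hg : g ∈ Iso X Y) : ¬ Mismatch X Y := by
  rintro ⟨u, v, h | h⟩ <;> exact h (maxCount_eq_of_iso hg _)

open Classical in
/-- The shift of the arc colors of `Y`, which separates them from those of `X` if some arc color
has different maximal valencies in `X` and in `Y`. -/
noncomputable def colorShift (X Y : ColoredDigraph (Fin n)) : ℕ :=
  if Mismatch X Y then X.maxCode else 0

/-- The first code that is not used by the arcs of `X` and the shifted arcs of `Y`. -/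
noncomputable def newCode (X Y : ColoredDigraph (Fin n)) : ℕ :=
  max X.maxCode (colorShift X Y + Y.maxCode) + 1

/-- Shifting the code of an arc. -/
def shiftCode (d c : ℕ) : ℕ := if c = 0 then 0 else c + d

theorem colorShift_eq (X Y : ColoredDigraph (Fin n)) :
    (¬ Mismatch X Y ∧ colorShift X Y = 0) ∨ (Mismatch X Y ∧ colorShift X Y = X.maxCode) := by
  by_cases h : Mismatch X Y <;> simp [colorShift, h]

/-! ## The tournaments that rotate three blocks -/

/-- The vertices: two copies of the vertices of `X`, the vertices of `Y`, and one more vertex. -/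
inductive Vtx (n : ℕ) : Type
  | x (u : Fin n) : Vtx n
  | y (u : Fin n) : Vtx n
  | z (u : Fin n) : Vtx n
  | top : Vtx n

namespace Vtx

/-- The number of a vertex. -/
def pos : Vtx n → Fin (3 * n + 1)
  | .x u => block₁ u
  | .y u => block₂ u
  | .z u => block₃ u
  | .top => Fin.last _

theorem pos_bijective : Function.Bijective (pos (n := n)) := by
  constructor
  · rintro (u | u | u | _) (v | v | v | _) h <;>
      simp [pos, block₁, block₂, block₃, Fin.ext_iff] at h ⊢ <;> omega
  · intro i
    by_cases h₁ : (i : ℕ) < n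
    · exact ⟨.x ⟨i, h₁⟩, rfl⟩
    by_cases h₂ : (i : ℕ) < 2 * n
    · exact ⟨.y ⟨i - n, by omega⟩, by ext; simp [pos, block₂]; omega⟩
    by_cases h₃ : (i : ℕ) < 3 * n
    · exact ⟨.z ⟨i - 2 * n, by omega⟩, by ext; simp [pos, block₃]; omega⟩
    · exact ⟨.top, by ext; simp [pos]; omega⟩

/-- The numbering of the vertices. -/
noncomputable def equiv (n : ℕ) : Vtx n ≃ Fin (3 * n + 1) := Equiv.ofBijective pos pos_bijective

@[simp]
theorem equiv_symm_pos (p : Vtx n) : (equiv n).symm p.pos = p :=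
  (equiv n).symm_apply_apply p

/-- The code of the arc color of a pair of vertices, where `d` is the color shift and `s` is the
first new code. -/
def arcCode (X Y : ColoredDigraph (Fin n)) (d s : ℕ) (α β : Fin n) : Vtx n → Vtx n → ℕ
  | .x u, .x v => X.code u v
  | .x u, .y v => if u = α ∧ v = β then s else s + 1
  | .x _, .z _ => 0
  | .x u, .top => if u = α then 0 else s
  | .y _, .x _ => 0
  | .y u, .y v => shiftCode d (Y.code u v)
  | .y u, .z v => if u = β ∧ v = α then s else s + 1
  | .y u, .top => if u = β then 0 else s
  | .z u, .x v => if u = α ∧ v = α then s else s + 1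
  | .z _, .y _ => 0
  | .z u, .z v => X.code u v
  | .z u, .top => if u = α then 0 else s
  | .top, .x v => if v = α then s else 0
  | .top, .y v => if v = β then s else 0
  | .top, .z v => if v = α then s else 0
  | .top, .top => 0

/-- The vertex colors. -/
def color (X Y : ColoredDigraph (Fin n)) : Vtx n → ℕ
  | .x u => X.vertexColor u
  | .y u => Y.vertexColor u
  | .z u => X.vertexColor u
  | .top => max X.maxVertexColor Y.maxVertexColor + 1

end Vtx

theorem arcCode_le (X Y : ColoredDigraph (Fin n)) (α β : Fin n) (p q : Vtx n) :
    Vtx.arcCode X Y (colorShift X Y) (newCode X Y) α β p q ≤ newCode X Y + 1 := by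
  have hX := X.code_le_maxCode
  have hY := Y.code_le_maxCode
  cases p <;> cases q <;> simp only [Vtx.arcCode, newCode, shiftCode] <;> try split_ifs
  all_goals first
    | omega
    | (rename_i u v; have := hX u v; omega)
    | (rename_i u v _; have := hY u v; omega)

/-- There are no gaps between the codes, because the shift is `0` or `X.maxCode`: the codes of `Y`
start at `1` or directly after those of `X`. The last code is attained at an arc into `β` from a
vertex other than `α`, which exists since `2 ≤ n`. -/
theorem exists_arcCode_eq (X Y : ColoredDigraph (Fin n)) (hn : 2 ≤ n) (α β : Fin n) {c : ℕ}
    (h₁ : 1 ≤ c) (h₂ : c ≤ newCode X Y + 1) :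
    ∃ p q, Vtx.arcCode X Y (colorShift X Y) (newCode X Y) α β p q = c := by
  by_cases hX : c ≤ X.maxCode
  · obtain ⟨u, v, h⟩ := X.exists_code_eq h₁ hX
    exact ⟨.x u, .x v, h⟩
  by_cases hY : c ≤ colorShift X Y + Y.maxCode
  · have hd : colorShift X Y ≤ X.maxCode := by
      rcases colorShift_eq X Y with h | h <;> omega
    obtain ⟨u, v, h⟩ := Y.exists_code_eq (c := c - colorShift X Y) (by omega) (by omega)
    exact ⟨.y u, .y v, by simp only [Vtx.arcCode, shiftCode, h]; split_ifs <;> omega⟩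
  by_cases hs : c = newCode X Y
  · exact ⟨.top, .x α, by simp [Vtx.arcCode, hs]⟩
  · have : Nontrivial (Fin n) := Fin.nontrivial_iff_two_le.2 hn
    obtain ⟨u, hu⟩ := exists_ne α
    exact ⟨.x u, .y β, by simp only [Vtx.arcCode, hu, newCode] at *; simp; omega⟩

/-- The tournament in which the three blocks can be rotated by an isomorphism from `X` to `Y` that
maps `α` to `β`. -/
noncomputable def rotationTournament (X Y : ColoredDigraph (Fin n)) (hn : 2 ≤ n) (α β : Fin n) :
    ColoredDigraph (Fin (3 * n + 1)) where
  vertexColor i := ((Vtx.equiv n).symm i).color X Y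
  arcColor i j := decodeColor (Vtx.arcCode X Y (colorShift X Y) (newCode X Y) α β
    ((Vtx.equiv n).symm i) ((Vtx.equiv n).symm j))
  vertexColor_initial := by
    intro v c hc
    suffices h : ∃ p : Vtx n, p.color X Y = c by
      obtain ⟨p, hp⟩ := h
      exact ⟨p.pos, by simpa using hp⟩
    by_cases hX : c ≤ X.maxVertexColor
    · obtain ⟨u, hu⟩ := X.exists_vertexColor_eq (by omega) hX
      exact ⟨.x u, hu⟩
    by_cases hY : c ≤ Y.maxVertexColor
    · obtain ⟨u, hu⟩ := Y.exists_vertexColor_eq (by omega) hY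
      exact ⟨.y u, hu⟩
    -- Here `c` exceeds all colors of `X` and `Y`, and no vertex has a color above that of the top.
    · refine ⟨.top, le_antisymm (by simp only [Vtx.color]; omega) (hc.trans ?_)⟩
      generalize (Vtx.equiv n).symm v = p
      have hX := X.vertexColor_le_max
      have hY := Y.vertexColor_le_max
      cases p with
      | x u => have := hX u; simp only [Vtx.color]; omega
      | y u => have := hY u; simp only [Vtx.color]; omega
      | z u => have := hX u; simp only [Vtx.color]; omega
      | top => exact le_rfl
  arcColor_initial := by
    intro i j d h c hc
    rw [decodeColor_eq_some] at h
    have := arcCode_le X Y α β ((Vtx.equiv n).symm i) ((Vtx.equiv n).symm j)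
    obtain ⟨p, q, hpq⟩ := exists_arcCode_eq X Y hn α β (c := c + 1) (by omega) (by omega)
    exact ⟨p.pos, q.pos, by simp [hpq]⟩

section

variable {X Y : ColoredDigraph (Fin n)} {hn : 2 ≤ n} {α β : Fin n}

theorem rotationTournament_vertexColor (p : Vtx n) :
    (rotationTournament X Y hn α β).vertexColor p.pos = p.color X Y := by
  simp [rotationTournament]

theorem rotationTournament_arcColor (p q : Vtx n) :
    (rotationTournament X Y hn α β).arcColor p.pos q.pos =
      decodeColor (Vtx.arcCode X Y (colorShift X Y) (newCode X Y) α β p q) := by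
  simp [rotationTournament]

theorem rotationTournament_adj (p q : Vtx n) :
    (rotationTournament X Y hn α β).Adj p.pos q.pos ↔
      Vtx.arcCode X Y (colorShift X Y) (newCode X Y) α β p q ≠ 0 := by
  unfold Adj
  rw [rotationTournament_arcColor]
  generalize Vtx.arcCode X Y (colorShift X Y) (newCode X Y) α β p q = c
  cases c <;> simp

theorem newCode_pos : newCode X Y ≠ 0 := by simp [newCode]

/-- Different blocks are joined cyclically, each vertex of a block is joined to the top in exactly
one direction, and shifting codes does not change which pairs are arcs. -/
theorem isTournament_rotationTournament (hX : X.IsTournament) (hY : Y.IsTournament) :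
    (rotationTournament X Y hn α β).IsTournament := by
  have hX₁ : ∀ u, X.code u u = 0 := fun u => by_contra fun h => hX.1 u (code_ne_zero_iff.1 h)
  have hY₁ : ∀ u, Y.code u u = 0 := fun u => by_contra fun h => hY.1 u (code_ne_zero_iff.1 h)
  have hX₂ := hX.2
  have hY₂ := hY.2
  simp only [← code_ne_zero_iff] at hX₂ hY₂
  have hs : ∀ d c, shiftCode d c ≠ 0 ↔ c ≠ 0 := fun d c => by
    unfold shiftCode; split_ifs <;> omega
  refine ⟨?_, ?_⟩
  · rw [Vtx.pos_bijective.2.forall]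
    intro p
    rw [rotationTournament_adj]
    cases p <;> simp [Vtx.arcCode, hX₁, hY₁, shiftCode]
  · rw [Vtx.pos_bijective.2.forall₂]
    intro p q hpq
    replace hpq : p ≠ q := fun h => hpq (h ▸ rfl)
    rw [rotationTournament_adj, rotationTournament_adj]
    have hc := newCode_pos (X := X) (Y := Y)
    cases p <;> cases q <;> simp only [Vtx.arcCode, hs]
    case x.x u v => exact hX₂ u v fun h => hpq (h ▸ rfl)
    case y.y u v => exact hY₂ u v fun h => hpq (h ▸ rfl)
    case z.z u v => exact hX₂ u v fun h => hpq (h ▸ rfl)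
    case top.top => exact absurd rfl hpq
    all_goals split_ifs <;> simp [Xor, hc]

theorem hasSingletonClass_rotationTournament :
    (rotationTournament X Y hn α β).HasSingletonClass := by
  refine ⟨Vtx.pos .top, ?_⟩
  rw [Vtx.pos_bijective.2.forall]
  intro p hp
  rw [rotationTournament_vertexColor, rotationTournament_vertexColor] at hp
  have hX := X.vertexColor_le_max
  have hY := Y.vertexColor_le_max
  cases p with
  | x u => have := hX u; simp only [Vtx.color] at hp; omega
  | y u => have := hY u; simp only [Vtx.color] at hp; omega
  | z u => have := hX u; simp only [Vtx.color] at hp; omega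
  | top => rfl

/-- The arc from `α` to `β` has the first new code in the tournament of `β` and the second one in
all others. -/
theorem rotationTournament_injective (X Y : ColoredDigraph (Fin n)) (hn : 2 ≤ n) (α : Fin n) :
    Function.Injective (rotationTournament X Y hn α) := by
  intro β β' h
  have := congr_arg (fun T => T.arcColor (Vtx.pos (.x α)) (Vtx.pos (.y β))) h
  simp only [rotationTournament_arcColor] at this
  have := congr_arg codeColor this
  by_contra hne
  simp [Vtx.arcCode, hne] at this

theorem rotationTournament_outValency_le {c k : ℕ} (p : Vtx n) (s : Finset (Vtx n))
    (hs : s.card ≤ k)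
    (h : ∀ q, Vtx.arcCode X Y (colorShift X Y) (newCode X Y) α β p q = c + 1 → q ∈ s) :
    (rotationTournament X Y hn α β).outValency c p.pos ≤ k := by
  refine le_trans (Finset.card_le_card (t := s.map ⟨Vtx.pos, Vtx.pos_bijective.1⟩) ?_)
    ((Finset.card_map _).le.trans hs)
  intro i hi
  obtain ⟨q, rfl⟩ := Vtx.pos_bijective.2 i
  rw [Finset.mem_filter, rotationTournament_arcColor, decodeColor_eq_some] at hi
  simpa [Vtx.pos_bijective.1.eq_iff] using h q hi.2

/-- This class is the source of the number 3: the top sends three of its arcs, a marked vertex sends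
one to the next marked vertex, and any other vertex of a block sends one to the top. For block
vertices the cruder bound by the two possible targets is used. -/
theorem smallArc_newCode {k : ℕ} (hk : 3 ≤ k) {p q : Vtx n}
    (h : Vtx.arcCode X Y (colorShift X Y) (newCode X Y) α β p q = newCode X Y) :
    (rotationTournament X Y hn α β).SmallArc k p.pos q.pos := by
  classical
  -- The color with code `newCode X Y`.
  refine ⟨newCode X Y - 1, ?_, ?_⟩
  · rw [rotationTournament_arcColor, h, decodeColor_eq_some]
    have := newCode_pos (X := X) (Y := Y)
    omega
  · rw [Vtx.pos_bijective.2.forall]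
    intro p
    refine rotationTournament_outValency_le p (match p with
      | .x _ => {.y β, .top}
      | .y _ => {.z α, .top}
      | .z _ => {.x α, .top}
      | .top => {.x α, .y β, .z α}) ?_ ?_
    · cases p
      case top => exact Finset.card_le_three.trans hk
      all_goals exact Finset.card_le_two.trans (by omega)
    · intro q hq
      have h₁ := newCode_pos (X := X) (Y := Y)
      rw [show newCode X Y - 1 + 1 = newCode X Y by omega] at hq
      have hX := X.code_le_maxCode
      have hY := Y.code_le_maxCode
      cases p <;> cases q <;> simp only [Vtx.arcCode] at hq
      case x.x u v => have := hX u v; simp only [newCode] at hq; omega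
      case z.z u v => have := hX u v; simp only [newCode] at hq; omega
      case y.y u v =>
        have := hY u v; simp only [newCode, shiftCode] at hq; split_ifs at hq <;> omega
      all_goals first
        | (exfalso; omega)
        | (split_ifs at hq; all_goals simp_all)

/-- The class consists of two copies of a class of `X` and possibly a class of `Y`. If the colors of
`Y` are not shifted, the latter has the same maximal valency; if they are shifted, it does not occur
here, as shifted codes exceed `X.maxCode`. -/
theorem smallArc_of_le_maxCode {k c : ℕ} (hc : c + 1 ≤ X.maxCode)
    (h : ∀ w, X.outValency c w ≤ k) {p q : Vtx n}
    (hpq : Vtx.arcCode X Y (colorShift X Y) (newCode X Y) α β p q = c + 1) :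
    (rotationTournament X Y hn α β).SmallArc k p.pos q.pos := by
  classical
  refine ⟨c, by rw [rotationTournament_arcColor, hpq, decodeColor_eq_some], ?_⟩
  rw [Vtx.pos_bijective.2.forall]
  intro p
  refine rotationTournament_outValency_le p (match p with
      | .x u => (Finset.univ.filter fun v => X.code u v = c + 1).map
        ⟨Vtx.x, fun _ _ h => Vtx.x.inj h⟩
      | .y u => if colorShift X Y = 0 then
        (Finset.univ.filter fun v => Y.code u v = c + 1).map ⟨Vtx.y, fun _ _ h => Vtx.y.inj h⟩
        else ∅
      | .z u => (Finset.univ.filter fun v => X.code u v = c + 1).map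
        ⟨Vtx.z, fun _ _ h => Vtx.z.inj h⟩
      | .top => ∅) ?_ ?_
  · cases p with
    | x u => simpa [← outValency_eq] using h u
    | z u => simpa [← outValency_eq] using h u
    | top => simp
    | y u =>
      dsimp only
      split_ifs with hd
      · rw [Finset.card_map, ← outValency_eq]
        refine (outValency_le_iff Y c k).2 ?_ u
        rw [← maxCount_eq_of_not_mismatch, ← outValency_le_iff]
        · exact h
        -- A zero shift in spite of a mismatch would mean `X.maxCode = 0`, against `hc`.
        · rcases colorShift_eq X Y with h | h
          · exact h.1
          · omega
      · simp
  · intro q hq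
    have hs : newCode X Y > c + 1 := by simp only [newCode]; omega
    cases p <;> cases q <;> simp only [Vtx.arcCode] at hq
    case x.x u v => exact Finset.mem_map.2 ⟨v, by simpa using hq, rfl⟩
    case z.z u v => exact Finset.mem_map.2 ⟨v, by simpa using hq, rfl⟩
    case y.y u v =>
      simp only [shiftCode] at hq
      split_ifs at hq with h0
      have hd : colorShift X Y = 0 := by
        rcases colorShift_eq X Y with h | h <;> omega
      simp only [hd, if_true]
      exact Finset.mem_map.2 ⟨v, by simpa [hd] using hq, rfl⟩
    all_goals exfalso; first | omega | (split_ifs at hq <;> omega)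

/-- Without a mismatch the color is also small in `X`, and the class is handled by
`smallArc_of_le_maxCode`. After a mismatch the shifted class contains arcs of the second block only,
so only valencies in `Y` matter. -/
theorem smallArc_block_y {k c : ℕ} (h : ∀ w, Y.outValency c w ≤ k) {u v : Fin n}
    (huv : Y.code u v = c + 1) :
    (rotationTournament X Y hn α β).SmallArc k (Vtx.y u).pos (Vtx.y v).pos := by
  classical
  have hcode : Vtx.arcCode X Y (colorShift X Y) (newCode X Y) α β (.y u) (.y v) =
    c + colorShift X Y + 1 := by simp [Vtx.arcCode, shiftCode, huv]; omega
  have hc := Y.code_le_maxCode u v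
  rcases colorShift_eq X Y with ⟨hm, hd⟩ | ⟨hm, hd⟩
  · have hX := (outValency_le_iff Y c k).1 h
    rw [← maxCount_eq_of_not_mismatch hm] at hX
    refine smallArc_of_le_maxCode (c := c) ?_ ((outValency_le_iff X c k).2 hX)
      (by rw [hcode, hd])
    -- A code above all codes of `X` has count zero in `X`, but the arc from `u` to `v` makes its
    -- count in `Y` positive.
    by_contra! hlt
    have h₀ : X.maxCount (c + 1) = 0 := maxCount_eq_zero fun u v h => by
      have := X.code_le_maxCode u v; omega
    have h₁ : 0 < (Finset.univ.filter fun v => Y.code u v = c + 1).card :=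
      Finset.card_pos.2 ⟨v, by simpa using huv⟩
    have h₂ := Finset.le_sup (f := fun u => (Finset.univ.filter fun v => Y.code u v = c + 1).card)
      (Finset.mem_univ u)
    rw [maxCount_eq_of_not_mismatch hm, maxCount] at h₀
    omega
  · refine ⟨c + colorShift X Y, ?_, ?_⟩
    · rw [rotationTournament_arcColor, hcode, decodeColor_eq_some]
    · rw [Vtx.pos_bijective.2.forall]
      intro p
      refine rotationTournament_outValency_le p (match p with
        | .y u => (Finset.univ.filter fun v => Y.code u v = c + 1).map
          ⟨Vtx.y, fun _ _ h => Vtx.y.inj h⟩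
        | _ => ∅) ?_ ?_
      · cases p with
        | y u => simpa [← outValency_eq] using h u
        | _ => simp
      · intro q hq
        have hs : newCode X Y > c + colorShift X Y + 1 := by simp only [newCode]; omega
        cases p <;> cases q <;> simp only [Vtx.arcCode] at hq
        case x.x u v => have := X.code_le_maxCode u v; omega
        case z.z u v => have := X.code_le_maxCode u v; omega
        case y.y u v =>
          simp only [shiftCode] at hq
          split_ifs at hq with h0
          exact Finset.mem_map.2 ⟨v, Finset.mem_filter.2 ⟨Finset.mem_univ _, by omega⟩, rfl⟩
        all_goals exfalso; first | omega | (split_ifs at hq <;> omega)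

/-- Every vertex reaches the top and is reached from it. Inside a block one moves along small arcs
of `X` or `Y`; the block is left for the top at an unmarked vertex, which exists since `2 ≤ n`, and
is entered from the top at its marked vertex. -/
theorem isSpanning_rotationTournament {k : ℕ} (hX : X.IsSpanning k) (hY : Y.IsSpanning k) :
    (rotationTournament X Y hn α β).IsSpanning (max 3 k) := by
  set T := rotationTournament X Y hn α β with hT
  set R := T.SmallArc (max 3 k)
  have hmono : ∀ {u v}, T.SmallArc k u v → R u v := fun ⟨c, h₁, h₂⟩ =>
    ⟨c, h₁, fun w => (h₂ w).trans (le_max_right ..)⟩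
  have code_of : ∀ {Z : ColoredDigraph (Fin n)} {u v}, Z.SmallArc k u v →
      ∃ c, Z.code u v = c + 1 ∧ ∀ w, Z.outValency c w ≤ k := fun ⟨c, h₁, h₂⟩ =>
    ⟨c, code_eq_iff.2 h₁, h₂⟩
  have hx : ∀ u v : Fin n, Relation.ReflTransGen R (Vtx.x u).pos (Vtx.x v).pos := fun u v =>
    Relation.ReflTransGen.lift (fun u => (Vtx.x u).pos) (fun u v h => by
      obtain ⟨c, hc, h⟩ := code_of h
      exact hmono (smallArc_of_le_maxCode (hc ▸ X.code_le_maxCode u v) h hc)) _ _ (hX u v)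
  have hz : ∀ u v : Fin n, Relation.ReflTransGen R (Vtx.z u).pos (Vtx.z v).pos := fun u v =>
    Relation.ReflTransGen.lift (fun u => (Vtx.z u).pos) (fun u v h => by
      obtain ⟨c, hc, h⟩ := code_of h
      exact hmono (smallArc_of_le_maxCode (hc ▸ X.code_le_maxCode u v) h hc)) _ _ (hX u v)
  have hy : ∀ u v : Fin n, Relation.ReflTransGen R (Vtx.y u).pos (Vtx.y v).pos := fun u v =>
    Relation.ReflTransGen.lift (fun u => (Vtx.y u).pos) (fun u v h => by
      obtain ⟨c, hc, h⟩ := code_of h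
      exact hmono (smallArc_block_y h hc)) _ _ (hY u v)
  have : Nontrivial (Fin n) := Fin.nontrivial_iff_two_le.2 hn
  obtain ⟨a, ha⟩ := exists_ne α
  obtain ⟨b, hb⟩ := exists_ne β
  have hs : ∀ {p q : Vtx n}, Vtx.arcCode X Y (colorShift X Y) (newCode X Y) α β p q =
      newCode X Y → Relation.ReflTransGen R p.pos q.pos := fun h =>
    .single (smallArc_newCode (le_max_left ..) h)
  have hto : ∀ p : Vtx n, Relation.ReflTransGen R p.pos (Vtx.pos .top) := by
    rintro (u | u | u | _)
    · exact (hx u a).trans (hs (by simp [Vtx.arcCode, ha]))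
    · exact (hy u b).trans (hs (by simp [Vtx.arcCode, hb]))
    · exact (hz u a).trans (hs (by simp [Vtx.arcCode, ha]))
    · exact .refl
  have hfrom : ∀ p : Vtx n, Relation.ReflTransGen R (Vtx.pos .top) p.pos := by
    rintro (u | u | u | _)
    · exact (hs (q := .x α) (by simp [Vtx.arcCode])).trans (hx α u)
    · exact (hs (q := .y β) (by simp [Vtx.arcCode])).trans (hy β u)
    · exact (hs (q := .z α) (by simp [Vtx.arcCode])).trans (hz α u)
    · exact .refl
  unfold IsSpanning
  rw [Vtx.pos_bijective.2.forall₂]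
  exact fun p q => (hto p).trans (hfrom q)

/-! ## Rotating automorphisms and isomorphisms -/

theorem mem_iso_iff_code {Z W : ColoredDigraph (Fin n)} {g : Fin n ≃ Fin n} : g ∈ Iso Z W ↔
    (∀ u, W.vertexColor (g u) = Z.vertexColor u) ∧ ∀ u v, W.code (g u) (g v) = Z.code u v := by
  simp only [Iso, Set.mem_ofPred_eq, code, codeColor_injective.eq_iff]

/-- A rotating automorphism induces an isomorphism from `X` to `Y`. -/
theorem exists_iso_of_rotating (hX : X.IsTournament) {f : Equiv.Perm (Fin (3 * n + 1))}
    (hf : f ∈ (rotationTournament X Y hn α β).rotating (block₁ α) (block₂ β) (block₃ α)) :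
    ∃ g : Fin n ≃ Fin n, g ∈ Iso X Y ∧ ∀ u, f (block₁ u) = block₂ (g u) := by
  obtain ⟨⟨hf₁, hf₂⟩, hα, -, -⟩ := hf
  set F : Vtx n → Vtx n := fun p => (Vtx.equiv n).symm (f p.pos) with hF
  have hFp : ∀ p, f p.pos = (F p).pos := fun p => ((Vtx.equiv n).apply_symm_apply _).symm
  have hcol : ∀ p, (F p).color X Y = p.color X Y := fun p => by
    rw [← rotationTournament_vertexColor (hn := hn) (α := α) (β := β), ← hFp, hf₁,
      rotationTournament_vertexColor]
  have harc : ∀ p q, Vtx.arcCode X Y (colorShift X Y) (newCode X Y) α β (F p) (F q) =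
      Vtx.arcCode X Y (colorShift X Y) (newCode X Y) α β p q := fun p q => by
    have := hf₂ p.pos q.pos
    rw [hFp, hFp, rotationTournament_arcColor, rotationTournament_arcColor] at this
    simpa using congr_arg codeColor this
  have hFα : F (.x α) = .y β := by
    have : f (Vtx.x α).pos = (Vtx.y β).pos := hα
    simp [hF, this]
  have hlt : ∀ u v, X.code u v < newCode X Y := fun u v => by
    have := X.code_le_maxCode u v; simp only [newCode]; omega
  -- The arc between `u` and `α` has a code below `newCode X Y`, and its image joins the image of
  -- `u` to `β` with the same code. All arcs between different blocks, and all arcs at the top, have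
  -- larger codes.
  have hblock : ∀ u, ∃ w, F (.x u) = .y w := by
    intro u
    by_cases hu : u = α
    · exact ⟨β, hu ▸ hFα⟩
    have h₁ := harc (.x u) (.x α)
    have h₂ := harc (.x α) (.x u)
    rw [hFα] at h₁ h₂
    have hadj := hX.2 u α hu
    rw [← code_ne_zero_iff, ← code_ne_zero_iff] at hadj
    have l₁ := hlt u α
    have l₂ := hlt α u
    cases hq : F (.x u) with
    | y w => exact ⟨w, rfl⟩
    | x w =>
      rw [hq] at h₁ h₂
      simp only [Vtx.arcCode] at h₁ h₂
      exfalso; split_ifs at h₁ <;> omega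
    | z w =>
      rw [hq] at h₁ h₂
      simp only [Vtx.arcCode] at h₁ h₂
      exfalso; split_ifs at h₂ <;> omega
    | top =>
      rw [hq] at h₁ h₂
      simp only [Vtx.arcCode] at h₁ h₂
      exfalso; split_ifs at h₁ <;> omega
  choose g hg using hblock
  have hinj : Function.Injective g := by
    intro u v huv
    have h : f (Vtx.x u).pos = f (Vtx.x v).pos := by rw [hFp, hFp, hg, hg, huv]
    exact Vtx.x.inj (Vtx.pos_bijective.1 (f.injective h))
  have hcode : ∀ u v, shiftCode (colorShift X Y) (Y.code (g u) (g v)) = X.code u v := fun u v => by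
    have := harc (.x u) (.x v)
    rwa [hg, hg] at this
  -- An arc at `α` inside the first block has a code of at most `X.maxCode`, and so has its image;
  -- with a shift by `X.maxCode`, all arcs of the second block would have larger codes.
  have hd : colorShift X Y = 0 := by
    have : Nontrivial (Fin n) := Fin.nontrivial_iff_two_le.2 hn
    obtain ⟨a, ha⟩ := exists_ne α
    have hadj := hX.2 a α ha
    rw [← code_ne_zero_iff, ← code_ne_zero_iff] at hadj
    have h₁ := hcode a α
    have h₂ := hcode α a
    have l₁ := X.code_le_maxCode a α
    have l₂ := X.code_le_maxCode α a
    simp only [shiftCode] at h₁ h₂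
    rcases colorShift_eq X Y with h | h
    · exact h.2
    · split_ifs at h₁ h₂ <;> simp only [Xor] at hadj <;> omega
  refine ⟨Equiv.ofBijective g (Finite.injective_iff_bijective.1 hinj), mem_iso_iff_code.2
    ⟨fun u => ?_, fun u v => ?_⟩, fun u => ?_⟩
  · have := hcol (.x u)
    rwa [hg] at this
  · have := hcode u v
    rw [hd] at this
    simp only [shiftCode] at this
    change Y.code (g u) (g v) = _
    split_ifs at this <;> omega
  · have := hFp (.x u)
    rwa [hg] at this

/-- An isomorphism from `X` to `Y` extends to a rotating automorphism. -/
theorem exists_rotating_of_iso (X Y : ColoredDigraph (Fin n)) (hn : 2 ≤ n) (α : Fin n)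
    {g : Fin n ≃ Fin n} (hg : g ∈ Iso X Y) :
    ∃ f ∈ (rotationTournament X Y hn α (g α)).rotating (block₁ α) (block₂ (g α)) (block₃ α),
      ∀ u, f (block₁ u) = block₂ (g u) := by
  -- The third power of this map is the identity, since `g` and its inverse cancel on the way round;
  -- thus the single map `g` determines all three passages consistently.
  let F : Equiv.Perm (Vtx n) :=
    { toFun := fun p => match p with
        | .x u => .y (g u)
        | .y u => .z (g.symm u)
        | .z u => .x u
        | .top => .top
      invFun := fun p => match p with
        | .x u => .z u
        | .y u => .x (g.symm u)
        | .z u => .y (g u)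
        | .top => .top
      left_inv := by rintro (u | u | u | _) <;> simp
      right_inv := by rintro (u | u | u | _) <;> simp }
  let f : Equiv.Perm (Fin (3 * n + 1)) := ((Vtx.equiv n).symm.trans F).trans (Vtx.equiv n)
  have hf : ∀ p : Vtx n, f p.pos = (F p).pos := fun p => by
    simp only [f, Equiv.trans_apply, Vtx.equiv_symm_pos]
    rfl
  have hd : colorShift X Y = 0 := by
    have := not_mismatch_of_iso hg
    simp [colorShift, this]
  obtain ⟨hg₁, hg₂⟩ := mem_iso_iff_code.1 hg
  have hs : ∀ c, shiftCode 0 c = c := fun c => by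
    unfold shiftCode; split_ifs <;> omega
  have hsymm : ∀ u, g.symm u = α ↔ u = g α := fun u => Equiv.symm_apply_eq g
  refine ⟨f, ⟨⟨?_, ?_⟩, hf (.x α), ?_, hf (.z α)⟩, fun u => hf (.x u)⟩
  · rw [Vtx.pos_bijective.2.forall]
    intro p
    rw [hf, rotationTournament_vertexColor, rotationTournament_vertexColor]
    cases p with
    | x u => exact hg₁ u
    | y u => simpa [F, Vtx.color] using (hg₁ (g.symm u)).symm
    | z u => rfl
    | top => rfl
  · rw [Vtx.pos_bijective.2.forall₂]
    intro p q
    rw [hf, hf, rotationTournament_arcColor, rotationTournament_arcColor, hd]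
    congr 1
    cases p <;> cases q <;> simp [F, Vtx.arcCode, hs, hg₂, hsymm]
    case y.y u v => simpa using (hg₂ (g.symm u) (g.symm v)).symm
  · have := hf (.y (g α))
    simp only [F, Equiv.coe_fn_mk, g.symm_apply_apply] at this
    exact this

/-- The isomorphisms from `X` to `Y` are the restrictions of the rotating automorphisms. -/
theorem iso_eq_iUnion_rotating (hX : X.IsTournament) (hn : 2 ≤ n) (α : Fin n) :
    Iso X Y = ⋃ β, {g | ∃ f ∈ (rotationTournament X Y hn α β).rotating
      (block₁ α) (block₂ β) (block₃ α), ∀ u, f (block₁ u) = block₂ (g u)} := by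
  ext g
  simp only [Set.mem_iUnion, Set.mem_ofPred_eq]
  constructor
  · intro hg
    exact ⟨g α, exists_rotating_of_iso X Y hn α hg⟩
  · rintro ⟨β, f, hf, hfg⟩
    obtain ⟨g', hg', h⟩ := exists_iso_of_rotating hX hf
    have : g = g' := by
      ext u
      have := (hfg u).symm.trans (h u)
      simp only [block₂, Fin.mk.injEq] at this
      omega
    rwa [this]

end

end ColoredDigraph

/-! ## Lists -/

theorem List.range_flatMap_eq_finRange {α : Type*} (n : ℕ) (F : ℕ → List α) :
    (List.range n).flatMap F = (List.finRange n).flatMap fun u : Fin n => F u := by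
  rw [← List.map_coe_finRange_eq_range]
  exact List.flatMap_map ..

theorem List.range_map_eq_finRange {α : Type*} (n : ℕ) (f : ℕ → α) :
    (List.range n).map f = (List.finRange n).map fun u : Fin n => f u := by
  rw [← List.map_coe_finRange_eq_range, List.map_map]
  rfl

theorem List.getD_flatMap_range {α : Type*} (F : ℕ → List α) {n i j : ℕ} (a : α) (hi : i < n)
    (hj : j < (F i).length) :
    ((List.range n).flatMap F).getD (((List.range i).flatMap F).length + j) a =
      (F i).getD j a := by
  obtain ⟨k, rfl⟩ : ∃ k, n = i + (k + 1) := ⟨n - i - 1, by omega⟩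
  rw [List.range_add, List.flatMap_append, List.getD_append_right _ _ _ _ (by omega),
    Nat.add_sub_cancel_left, List.range_succ_eq_map, List.map_cons, List.flatMap_cons, add_zero,
    List.getD_append _ _ _ _ hj]

theorem List.length_flatMap_range {α : Type*} (F : ℕ → List α) {i l : ℕ}
    (h : ∀ j < i, (F j).length = l) : ((List.range i).flatMap F).length = i * l := by
  induction i with
  | zero => simp
  | succ i ih =>
    rw [List.range_succ, List.flatMap_append, List.length_append, ih fun j hj => h j (by omega)]
    simp [h i (by omega), add_mul]

/-- Row-major addressing, used for arc-color matrices and for lists of permutations. -/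
theorem List.getD_flatMap_finRange_ofFn {n l : ℕ} (f : Fin n → Fin l → ℕ) (u : Fin n) (v : Fin l) :
    ((List.finRange n).flatMap fun u => List.ofFn (f u)).getD (u * l + v) 0 = f u v := by
  let F : ℕ → List ℕ := fun i => if h : i < n then List.ofFn (f ⟨i, h⟩) else []
  have hF : ∀ u : Fin n, F u = List.ofFn (f u) := fun u => by simp [F]
  have h : (List.finRange n).flatMap (fun u => List.ofFn (f u)) = (List.range n).flatMap F := by
    rw [List.range_flatMap_eq_finRange]
    exact congrArg (List.flatMap · _) (funext fun u => (hF u).symm)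
  have hl : ∀ j < (u : ℕ), (F j).length = l := fun j hj => by
    have := hF ⟨j, by omega⟩
    rw [show F j = _ from this, List.length_ofFn]
  rw [h, ← List.length_flatMap_range F hl, List.getD_flatMap_range F 0 u.2 (by simp [hF]), hF]
  simp [List.getD_eq_getElem?_getD]

theorem Finset.sup_range_eq (n : ℕ) (f : ℕ → ℕ) :
    (Finset.range n).sup f = Finset.univ.sup fun u : Fin n => f u := by
  refine le_antisymm (Finset.sup_le fun i hi => ?_) (Finset.sup_le fun u _ => ?_)
  · exact Finset.le_sup (f := fun u : Fin n => f u)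
      (Finset.mem_univ (⟨i, Finset.mem_range.1 hi⟩ : Fin n))
  · exact Finset.le_sup (f := f) (Finset.mem_range.2 u.2)

/-! ### Terms that read the coded digraphs: entries, largest codes, valencies and mismatches. -/

namespace RAM

namespace Term

theorem eval_lit (b c : ℕ) (m : Memory) : (Term.lit c).eval b m = c := rfl

theorem eval_var (b x : ℕ) (m : Memory) : (Term.var x).eval b m = m x 0 := rfl

theorem eval_cell (b a : ℕ) (i : Term) (m : Memory) :
    (Term.cell a i).eval b m = m a (i.eval b m) := rfl

theorem eval_add (b : ℕ) (s t : Term) (m : Memory) :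
    (Term.add s t).eval b m = s.eval b m + t.eval b m := rfl

theorem eval_sub (b : ℕ) (s t : Term) (m : Memory) :
    (Term.sub s t).eval b m = s.eval b m - t.eval b m := rfl

theorem eval_sum (b x : ℕ) (e t : Term) (m : Memory) : (Term.big false x e t).eval b m =
    ∑ i ∈ Finset.range (min (e.eval b m) (m b 0)), t.eval b (m.write x 0 i) := by
  rw [eval]
  induction min (e.eval b m) (m b 0) with
  | zero => rfl
  | succ k ih => rw [rounds, ih, Finset.sum_range_succ]; rfl

theorem eval_sup (b x : ℕ) (e t : Term) (m : Memory) : (Term.big true x e t).eval b m =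
    (Finset.range (min (e.eval b m) (m b 0))).sup fun i => t.eval b (m.write x 0 i) := by
  rw [eval]
  induction min (e.eval b m) (m b 0) with
  | zero => rfl
  | succ k ih =>
    rw [rounds, ih, Finset.range_add_one, Finset.sup_insert]
    rw [sup_comm]
    simp only [bigOp, if_true]
    exact (show _ = Max.max _ _ by omega)

/-- A term that is nonzero if and only if two terms have different values. -/
def ne (s t : Term) : Term := .add (.sub s t) (.sub t s)

theorem eval_ne_eq_zero {b : ℕ} {s t : Term} {m : Memory} :
    (ne s t).eval b m = 0 ↔ s.eval b m = t.eval b m := by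
  simp only [ne, eval]
  omega

theorem eval_cond_ne (b : ℕ) (s t u v : Term) (m : Memory) : (cond (ne s t) u v).eval b m =
    if s.eval b m = t.eval b m then v.eval b m else u.eval b m := by
  simp only [eval, eval_ne_eq_zero]

/-- A term that is `1` if two terms have the same value, and `0` otherwise. -/
def eq (s t : Term) : Term := .sub (.lit 1) (ne s t)

theorem eval_eq (b : ℕ) (s t : Term) (m : Memory) :
    (eq s t).eval b m = if s.eval b m = t.eval b m then 1 else 0 := by
  simp only [eq, ne, eval]
  split_ifs <;> omega

/-- The number of vertices, multiplied by a number that is not larger. -/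
def mulN (t : Term) : Term := .big false 50 t (.var 0)

/-- The machine cannot multiply, so the product is a sum of equal summands. The cut-off restricts
the factor to at most the number of vertices, which covers row indices and the number of vertices
itself. -/
theorem eval_mulN (t : Term) (m : Memory) :
    (mulN t).eval 0 m = min (t.eval 0 m) (m 0 0) * m 0 0 := by
  simp [mulN, eval_sum, eval, Memory.write_apply]

/-- The entry of a matrix that starts at a given position of the input. -/
def entry (off u v : Term) : Term := .cell 0 (.add off (.add (mulN u) v))

/-- The position of the arc-color matrix of the first digraph. -/
def offX : Term := .add (.lit 2) (.var 0)

/-- The position of the arc-color matrix of the second digraph. -/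
def offY : Term := .add (.lit 2) (.add (.var 0) (.add (mulN (.var 0)) (.var 0)))

/-- The largest number of entries with code `c` in a row. -/
def maxCountT (off c : Term) : Term :=
  .big true 52 (.var 0) (.big false 51 (.var 0) (eq (entry off (.var 52) (.var 51)) c))

/-- The largest entry of a matrix. -/
def maxCodeT (off : Term) : Term :=
  .big true 53 (.var 0) (.big true 54 (.var 0) (entry off (.var 53) (.var 54)))

/-- A term that is nonzero if and only if there is a mismatch. -/
def mismatchT : Term :=
  .big false 53 (.var 0) (.big false 54 (.var 0) (.add
    (ne (maxCountT offX (entry offX (.var 53) (.var 54)))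
      (maxCountT offY (entry offX (.var 53) (.var 54))))
    (ne (maxCountT offX (entry offY (.var 53) (.var 54)))
      (maxCountT offY (entry offY (.var 53) (.var 54))))))

/-- The maximum of two terms. -/
def max (s t : Term) : Term := .add s (.sub t s)

theorem eval_max (b : ℕ) (s t : Term) (m : Memory) :
    (max s t).eval b m = Max.max (s.eval b m) (t.eval b m) := by
  simp only [max, eval]
  omega

end Term

variable {n : ℕ}

open ColoredDigraph

/-- Array `0` contains the code of `X`, `Y` and `α`. -/
structure HasInput (X Y : ColoredDigraph (Fin n)) (α : Fin n) (m : Memory) : Prop where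
  size : m 0 0 = n
  point : m 0 1 = α
  colorX : ∀ u : Fin n, m 0 (2 + u) = X.vertexColor u
  codeX : ∀ u v : Fin n, m 0 (2 + n + (u * n + v)) = X.code u v
  colorY : ∀ u : Fin n, m 0 (2 + n + n * n + u) = Y.vertexColor u
  codeY : ∀ u v : Fin n, m 0 (2 + (n + (n * n + n)) + (u * n + v)) = Y.code u v

theorem length_codeDigraph (X : ColoredDigraph (Fin n)) :
    (codeDigraph X).length = n + n * n := by
  simp [codeDigraph, List.length_flatMap]

theorem getD_codeDigraph_color (X : ColoredDigraph (Fin n)) (u : Fin n) :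
    (codeDigraph X).getD u 0 = X.vertexColor u := by
  rw [codeDigraph, List.getD_append _ _ _ _ (by simp)]
  simp [List.getD_eq_getElem?_getD]

theorem getD_codeDigraph_code (X : ColoredDigraph (Fin n)) (u v : Fin n) :
    (codeDigraph X).getD (n + (u * n + v)) 0 = X.code u v := by
  rw [codeDigraph, List.getD_append_right _ _ _ _ (by simp), List.length_ofFn,
    Nat.add_sub_cancel_left, List.getD_flatMap_finRange_ofFn]
  rfl

theorem hasInput_initial (X Y : ColoredDigraph (Fin n)) (α : Fin n) :
    HasInput X Y α (initial (codeInput X Y α)) := by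
  have h₁ : ∀ j < n + n * n, initial (codeInput X Y α) 0 (2 + j) = (codeDigraph X).getD j 0 := by
    intro j hj
    simp only [initial, if_true, codeInput]
    rw [List.getD_append _ _ _ _ (by simp [length_codeDigraph]; omega),
      List.getD_append_right _ _ _ _ (by simp)]
    simp
  have h₂ : ∀ j, initial (codeInput X Y α) 0 (2 + (n + n * n) + j) = (codeDigraph Y).getD j 0 := by
    intro j
    simp only [initial, if_true, codeInput]
    rw [List.getD_append_right _ _ _ _ (by simp [length_codeDigraph]; omega)]
    congr 1
    simp [length_codeDigraph]
    omega
  have h₃ : ∀ u v : Fin n, (u : ℕ) * n + v < n * n := fun u v => by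
    calc (u : ℕ) * n + v < u * n + n := by omega
      _ = (u + 1) * n := by ring
      _ ≤ n * n := Nat.mul_le_mul_right n u.2
  refine ⟨by simp [initial, codeInput], by simp [initial, codeInput], fun u => ?_, fun u v => ?_,
    fun u => ?_, fun u v => ?_⟩
  · rw [h₁ _ (by omega), getD_codeDigraph_color]
  · rw [add_assoc, h₁ _ (by have := h₃ u v; omega), getD_codeDigraph_code]
  · rw [add_assoc 2, h₂, getD_codeDigraph_color]
  · rw [← getD_codeDigraph_code, ← h₂]
    congr 1
    ring

section

variable {X Y : ColoredDigraph (Fin n)} {α : Fin n} {m : Memory}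

theorem HasInput.congr (h : HasInput X Y α m) {m' : Memory} (hm : m' 0 = m 0) :
    HasInput X Y α m' := by
  constructor <;> rw [hm]
  exacts [h.size, h.point, h.colorX, h.codeX, h.colorY, h.codeY]

theorem HasInput.write (h : HasInput X Y α m) {a : ℕ} (ha : a ≠ 0) (i x : ℕ) :
    HasInput X Y α (m.write a i x) :=
  h.congr (Memory.write_of_ne _ (Ne.symm ha) ..)

open Term

theorem HasInput.eval_entry_X (h : HasInput X Y α m) {s t : Term} {u v : Fin n}
    (hu : s.eval 0 m = u) (hv : t.eval 0 m = v) : (entry offX s t).eval 0 m = X.code u v := by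
  rw [← h.codeX]
  simp [entry, offX, eval, eval_mulN, hu, hv, h.size, u.2.le]

theorem HasInput.eval_entry_Y (h : HasInput X Y α m) {s t : Term} {u v : Fin n}
    (hu : s.eval 0 m = u) (hv : t.eval 0 m = v) : (entry offY s t).eval 0 m = Y.code u v := by
  rw [← h.codeY]
  simp [entry, offY, eval, eval_mulN, hu, hv, h.size, u.2.le]

/-- The matrix at the given position is the arc-color matrix of `Z`. -/
def IsMatrix (n : ℕ) (off : Term) (Z : ColoredDigraph (Fin n)) (m : Memory) : Prop :=
  ∀ m' : Memory, m' 0 = m 0 → ∀ (s t : Term) (u v : Fin n), s.eval 0 m' = u → t.eval 0 m' = v →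
    (entry off s t).eval 0 m' = Z.code u v

theorem HasInput.isMatrix_X (h : HasInput X Y α m) : IsMatrix n offX X m :=
  fun _ hm _ _ _ _ hu hv => (h.congr hm).eval_entry_X hu hv

theorem HasInput.isMatrix_Y (h : HasInput X Y α m) : IsMatrix n offY Y m :=
  fun _ hm _ _ _ _ hu hv => (h.congr hm).eval_entry_Y hu hv

theorem eval_maxCodeT {off : Term} {Z : ColoredDigraph (Fin n)} (h0 : m 0 0 = n)
    (h : IsMatrix n off Z m) : (maxCodeT off).eval 0 m = Z.maxCode := by
  simp only [maxCodeT, eval_sup, eval_var, Memory.write_apply, show (0 : ℕ) ≠ 53 by decide,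
    if_false, h0, min_self, Finset.sup_range_eq]
  refine Finset.sup_congr rfl fun u _ => Finset.sup_congr rfl fun v _ => ?_
  refine h _ ?_ _ _ u v ?_ ?_
  · rw [Memory.write_of_ne _ (by decide), Memory.write_of_ne _ (by decide)]
  · simp [eval, Memory.write_apply]
  · simp [eval, Memory.write_apply]

/-- The term for the code sits under the binders `52` and `51`, so its value must not depend on
these variables. -/
theorem eval_maxCountT {off c : Term} {Z : ColoredDigraph (Fin n)} (h0 : m 0 0 = n)
    (h : IsMatrix n off Z m) (hc : ∀ i j, c.eval 0 ((m.write 52 0 i).write 51 0 j) = c.eval 0 m) :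
    (maxCountT off c).eval 0 m = Z.maxCount (c.eval 0 m) := by
  simp only [maxCountT, eval_sup, eval_sum, eval_eq, hc]
  simp only [eval_var, h0, Memory.write_apply, min_self, Finset.sup_range_eq,
    show (0 : ℕ) ≠ 52 by decide, if_false]
  refine Finset.sup_congr rfl fun u _ => ?_
  rw [Finset.card_filter, Finset.sum_range]
  refine Finset.sum_congr rfl fun v _ => ?_
  rw [h _ ?_ _ _ u v ?_ ?_]
  · rw [Memory.write_of_ne _ (by decide), Memory.write_of_ne _ (by decide)]
  · simp [eval, Memory.write_apply]
  · simp [eval, Memory.write_apply]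

/-- A sum of natural numbers vanishes only if all its summands do; so the sum of the absolute
differences of the counts is zero exactly when there is no mismatch. -/
theorem eval_mismatchT (h : HasInput X Y α m) : mismatchT.eval 0 m ≠ 0 ↔ Mismatch X Y := by
  rw [not_iff_comm]
  simp only [mismatchT, eval_sum, eval_var, eval_add, Memory.write_apply, h.size,
    show (0 : ℕ) ≠ 53 by decide, if_false, min_self, Finset.sum_eq_zero_iff,
    Finset.mem_range, Nat.add_eq_zero_iff, eval_ne_eq_zero]
  have hc : ∀ off ∈ [offX, offY], ∀ (m : Memory) (i j : ℕ),
      (entry off (.var 53) (.var 54)).eval 0 ((m.write 52 0 i).write 51 0 j) =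
      (entry off (.var 53) (.var 54)).eval 0 m := by
    intro off hoff m i j
    apply eval_congr
    · intro a ha
      simp only [List.mem_cons, List.not_mem_nil, or_false] at hoff
      rcases hoff with rfl | rfl <;> 
        simp [entry, offX, offY, mulN, free] at ha <;> subst ha <;>
        rw [Memory.write_of_ne _ (by decide), Memory.write_of_ne _ (by decide)]
    · intro a ha
      simp only [List.mem_cons, List.not_mem_nil, or_false] at hoff
      have : a ≠ 51 ∧ a ≠ 52 := by
        rcases hoff with rfl | rfl <;> simp [entry, offX, offY, mulN, vars] at ha <;> omega
      rw [Memory.write_of_ne _ this.1, Memory.write_of_ne _ this.2]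
    · simp only [List.mem_cons, List.not_mem_nil, or_false] at hoff
      rcases hoff with rfl | rfl <;> simp [entry, offX, offY, mulN, binders]
    · rw [Memory.write_of_ne _ (by decide), Memory.write_of_ne _ (by decide)]
  have key : ∀ u v : Fin n, ∀ m', m' = (m.write 53 0 u).write 54 0 v →
      (maxCountT offX (entry offX (.var 53) (.var 54))).eval 0 m' = X.maxCount (X.code u v) ∧
      (maxCountT offY (entry offX (.var 53) (.var 54))).eval 0 m' = Y.maxCount (X.code u v) ∧
      (maxCountT offX (entry offY (.var 53) (.var 54))).eval 0 m' = X.maxCount (Y.code u v) ∧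
      (maxCountT offY (entry offY (.var 53) (.var 54))).eval 0 m' = Y.maxCount (Y.code u v) := by
    intro u v m' hm'
    have h' : HasInput X Y α m' := by
      rw [hm']
      exact (h.write (by decide) _ _).write (by decide) _ _
    have hX : (entry offX (.var 53) (.var 54)).eval 0 m' = X.code u v :=
      h'.eval_entry_X (by simp [hm', eval, Memory.write_apply])
        (by simp [hm', eval, Memory.write_apply])
    have hY : (entry offY (.var 53) (.var 54)).eval 0 m' = Y.code u v :=
      h'.eval_entry_Y (by simp [hm', eval, Memory.write_apply])
        (by simp [hm', eval, Memory.write_apply])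
    refine ⟨?_, ?_, ?_, ?_⟩
    · rw [eval_maxCountT h'.size h'.isMatrix_X (hc _ (by simp) m'), hX]
    · rw [eval_maxCountT h'.size h'.isMatrix_Y (hc _ (by simp) m'), hX]
    · rw [eval_maxCountT h'.size h'.isMatrix_X (hc _ (by simp) m'), hY]
    · rw [eval_maxCountT h'.size h'.isMatrix_Y (hc _ (by simp) m'), hY]
  unfold Mismatch
  push Not
  constructor
  · intro H u hu v hv
    obtain ⟨k₁, k₂, k₃, k₄⟩ := key ⟨u, hu⟩ ⟨v, hv⟩ _ rfl
    simp only at k₁ k₂ k₃ k₄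
    rw [k₁, k₂, k₃, k₄]
    exact H _ _
  · intro H u v
    obtain ⟨k₁, k₂, k₃, k₄⟩ := key u v _ rfl
    have := H u u.2 v v.2
    rwa [k₁, k₂, k₃, k₄] at this

end

end RAM

namespace List

/-- The vertices of the rotation tournaments in their order. -/
theorem finRange_three_mul_add_one (n : ℕ) : List.finRange (3 * n + 1) =
    (List.finRange n).map block₁ ++ (List.finRange n).map block₂ ++
      (List.finRange n).map block₃ ++ [Fin.last _] := by
  apply List.map_injective_iff.2 Fin.val_injective
  rw [List.map_coe_finRange_eq_range]
  simp only [List.map_append, List.map_map, List.map_cons, List.map_nil]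
  have h : List.range (3 * n + 1) = List.range n ++ (List.range n).map (n + ·) ++
      (List.range n).map (n + n + ·) ++ [3 * n] := by
    rw [List.range_succ, show 3 * n = n + n + n by omega, List.range_add, List.range_add]
  rw [h]
  simp only [← List.map_coe_finRange_eq_range, List.map_map]
  refine congrArg₂ _ (congrArg₂ _ (congrArg₂ _ rfl rfl) ?_) rfl
  refine List.map_congr_left fun u _ => ?_
  simp [block₃]
  omega

end List

namespace RAM

open Term ColoredDigraph

variable {n : ℕ}

theorem written_congr {m m' : Memory} (h₁ : m 1 = m' 1) (h₂ : m 2 = m' 2) :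
    written m = written m' := by
  rw [written, written, h₁, h₂]

theorem Program.computes_of_halts {P : Program} {input output : List ℕ} {t : ℕ}
    (h : Halts P (initial input) t fun m => written m = output) : P.Computes input output t := by
  obtain ⟨s, m, h₁, h₂, h₃⟩ := h
  refine ⟨s, m, h₁, h₂, ?_⟩
  subst h₃
  intro i hi
  simp [written]

/-! ### The program that writes the tournaments. -/

namespace Construction

/-- The given vertex. -/
def point : Term := .cell 0 (.lit 1)

/-- The code of an arc from one block to the next one: `s` or `s + 1`, where `s` is in array `6`. -/
def across (a b : Term) : Term :=
  .cond (ne (.var 11) a) (.add (.var 6) (.lit 1))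
    (.cond (ne (.var 12) b) (.add (.var 6) (.lit 1)) (.var 6))

/-- The code of the pair of a vertex and the top vertex. -/
def toTop (a : Term) : Term := .cond (ne (.var 11) a) (.var 6) (.lit 0)

/-- The code of the pair of the top vertex and a vertex. -/
def fromTop (a : Term) : Term := .cond (ne (.var 12) a) (.lit 0) (.var 6)

/-- The shifted code of an arc of `Y`, where the shift is in array `5`. -/
def shifted : Term := .cond (ne (entry offY (.var 11) (.var 12)) (.lit 0))
  (.add (entry offY (.var 11) (.var 12)) (.var 5)) (.lit 0)

/-- A part of a row that corresponds to a block. -/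
def part (t : Term) : Emit := .loop 12 (.var 0) (.one t)

/-- The rows that correspond to a block. -/
def rows (t₁ t₂ t₃ t₄ : Term) : Emit :=
  .loop 11 (.var 0) (.seq (.seq (.seq (part t₁) (part t₂)) (part t₃)) (.one t₄))

/-- The vertex colors, where the color of the top vertex is in array `7`. -/
def colors : Emit :=
  .seq (.seq (.seq (.loop 11 (.var 0) (.one (.cell 0 (.add (.lit 2) (.var 11)))))
    (.loop 11 (.var 0)
      (.one (.cell 0 (.add (.add (.add (.lit 2) (.var 0)) (mulN (.var 0))) (.var 11))))))
    (.loop 11 (.var 0) (.one (.cell 0 (.add (.lit 2) (.var 11)))))) (.one (.var 7))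

/-- The arc-color matrix of one of the tournaments. -/
def matrix : Emit :=
  .seq (.seq (.seq
    (rows (entry offX (.var 11) (.var 12)) (across point (.var 10)) (.lit 0) (toTop point))
    (rows (.lit 0) shifted (across (.var 10) point) (toTop (.var 10))))
    (rows (across point point) (.lit 0) (entry offX (.var 11) (.var 12)) (toTop point)))
    (.seq (.seq (.seq (part (fromTop point)) (part (fromTop (.var 10)))) (part (fromTop point)))
      (.one (.lit 0)))

/-- The codes of the tournaments. -/
def emit : Emit := .loop 10 (.var 0) (.seq colors matrix)

/-- The computation of the shift, of the first new code, and of the color of the top vertex. -/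
def setup : Cmd :=
  .seq (.set 4 (.lit 0) (maxCodeT offX)) (.seq
    (.set 5 (.lit 0) (.cond mismatchT (.var 4) (.lit 0))) (.seq
    (.set 6 (.lit 0) (.add (Term.max (.var 4) (.add (.var 5) (maxCodeT offY))) (.lit 1)))
    (.set 7 (.lit 0) (.add (Term.max
      (.big true 53 (.var 0) (.cell 0 (.add (.lit 2) (.var 53))))
      (.big true 53 (.var 0)
        (.cell 0 (.add (.add (.add (.lit 2) (.var 0)) (mulN (.var 0))) (.var 53))))) (.lit 1)))))

/-- The construction of the tournaments. -/
def cmd : Cmd := .seq setup emit.toCmd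

theorem ok_emit : emit.ok 0 = true := by decide +kernel

theorem ok_setup : setup.ok 0 = true := by decide +kernel

theorem gen_part {t : Term} {m : Memory} (h0 : m 0 0 = n) :
    (part t).gen 0 m = (List.finRange n).map fun v : Fin n => t.eval 0 (m.write 12 0 v) := by
  simp only [part, Emit.gen, eval_var, h0, min_self, List.range_flatMap_eq_finRange]
  rw [List.map_eq_flatMap]

theorem gen_rows {t₁ t₂ t₃ t₄ : Term} {m : Memory} (h0 : m 0 0 = n) :
    (rows t₁ t₂ t₃ t₄).gen 0 m = (List.finRange n).flatMap fun u : Fin n =>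
      ((List.finRange n).map fun v : Fin n => t₁.eval 0 ((m.write 11 0 u).write 12 0 v)) ++
      ((List.finRange n).map fun v : Fin n => t₂.eval 0 ((m.write 11 0 u).write 12 0 v)) ++
      ((List.finRange n).map fun v : Fin n => t₃.eval 0 ((m.write 11 0 u).write 12 0 v)) ++
      [t₄.eval 0 (m.write 11 0 u)] := by
  have h : ∀ u : Fin n, (m.write 11 0 u) 0 0 = n := fun u => by
    rw [Memory.write_of_ne _ (by decide), h0]
  simp only [rows, Emit.gen, eval_var, h0, min_self, List.range_flatMap_eq_finRange, gen_part (h _)]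

/-- A row of the coded arc-color matrix. -/
noncomputable def row (X Y : ColoredDigraph (Fin n)) (α β : Fin n) (p : Vtx n) : List ℕ :=
  ((List.finRange n).map fun v =>
    Vtx.arcCode X Y (colorShift X Y) (newCode X Y) α β p (.x v)) ++
  ((List.finRange n).map fun v =>
    Vtx.arcCode X Y (colorShift X Y) (newCode X Y) α β p (.y v)) ++
  ((List.finRange n).map fun v =>
    Vtx.arcCode X Y (colorShift X Y) (newCode X Y) α β p (.z v)) ++
  [Vtx.arcCode X Y (colorShift X Y) (newCode X Y) α β p .top]

/-- The numbering `Vtx.pos` lists the blocks one after the other with the top at the end, so the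
code splits into the pieces that the loops of the program produce. -/
theorem codeDigraph_rotationTournament (X Y : ColoredDigraph (Fin n)) (hn : 2 ≤ n) (α β : Fin n) :
    codeDigraph (rotationTournament X Y hn α β) =
      ((List.finRange n).map X.vertexColor ++ (List.finRange n).map Y.vertexColor ++
        (List.finRange n).map X.vertexColor ++ [max X.maxVertexColor Y.maxVertexColor + 1]) ++
      ((List.finRange n).flatMap (fun u => row X Y α β (.x u)) ++
        (List.finRange n).flatMap (fun u => row X Y α β (.y u)) ++
        (List.finRange n).flatMap (fun u => row X Y α β (.z u)) ++ row X Y α β .top) := by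
  have hcol : ∀ p : Vtx n, (rotationTournament X Y hn α β).vertexColor p.pos = p.color X Y :=
    rotationTournament_vertexColor
  have harc : ∀ p q : Vtx n, codeColor ((rotationTournament X Y hn α β).arcColor p.pos q.pos) =
      Vtx.arcCode X Y (colorShift X Y) (newCode X Y) α β p q := fun p q => by
    rw [rotationTournament_arcColor, codeColor_decodeColor]
  have hrow : ∀ p : Vtx n, List.ofFn (fun j =>
      codeColor ((rotationTournament X Y hn α β).arcColor p.pos j)) = row X Y α β p := fun p => by
    rw [List.ofFn_eq_map, List.finRange_three_mul_add_one]
    simp only [List.map_append, List.map_map, List.map_cons, List.map_nil, row, ← harc]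
    rfl
  rw [codeDigraph, List.ofFn_eq_map, List.finRange_three_mul_add_one]
  simp only [List.map_append, List.map_map, List.map_cons, List.map_nil, List.flatMap_append,
    List.flatMap_map, List.flatMap_singleton]
  refine congrArg₂ _ (congrArg₂ _ (congrArg₂ _ (congrArg₂ _ ?_ ?_) ?_) ?_)
    (congrArg₂ _ (congrArg₂ _ (congrArg₂ _ ?_ ?_) ?_) ?_)
  · exact congrArg (List.map · _) (funext fun u => hcol (.x u))
  · exact congrArg (List.map · _) (funext fun u => hcol (.y u))
  · exact congrArg (List.map · _) (funext fun u => hcol (.z u))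
  · exact congrArg (fun c => [c]) (hcol .top)
  · exact congrArg (List.flatMap · _) (funext fun u => hrow (.x u))
  · exact congrArg (List.flatMap · _) (funext fun u => hrow (.y u))
  · exact congrArg (List.flatMap · _) (funext fun u => hrow (.z u))
  · exact hrow .top

/-- What is in the memory after the setup. -/
structure Ready (X Y : ColoredDigraph (Fin n)) (α : Fin n) (m : Memory) : Prop
    extends HasInput X Y α m where
  shift : m 5 0 = colorShift X Y
  new : m 6 0 = newCode X Y
  top : m 7 0 = max X.maxVertexColor Y.maxVertexColor + 1

variable {X Y : ColoredDigraph (Fin n)} {α : Fin n} {m : Memory}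

theorem ready_setup (h : HasInput X Y α m) : Ready X Y α (setup.run 0 m) := by
  have hmax : ∀ (m : Memory), HasInput X Y α m → Term.eval 0 (Term.max
      (.big true 53 (.var 0) (.cell 0 (.add (.lit 2) (.var 53))))
      (.big true 53 (.var 0)
        (.cell 0 (.add (.add (.add (.lit 2) (.var 0)) (mulN (.var 0))) (.var 53))))) m =
      max X.maxVertexColor Y.maxVertexColor := by
    intro m h
    simp only [eval_max, eval_sup, eval_var, eval_cell, eval_add, eval_lit, eval_mulN, h.size,
      min_self, Memory.write_apply, Finset.sup_range_eq, if_true, show (0 : ℕ) ≠ 53 by decide,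
      if_false, h.colorX, h.colorY]
    rfl
  set m₁ := m.write 4 0 X.maxCode with hm₁
  set m₂ := m₁.write 5 0 (colorShift X Y) with hm₂
  set m₃ := m₂.write 6 0 (newCode X Y) with hm₃
  have h₁ : HasInput X Y α m₁ := h.write (by decide) _ _
  have h₂ : HasInput X Y α m₂ := h₁.write (by decide) _ _
  have h₃ : HasInput X Y α m₃ := h₂.write (by decide) _ _
  have e₁ : (maxCodeT offX).eval 0 m = X.maxCode := eval_maxCodeT h.size h.isMatrix_X
  have e₂ : (Term.cond mismatchT (.var 4) (.lit 0)).eval 0 m₁ = colorShift X Y := by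
    have := eval_mismatchT h₁
    rw [eval, colorShift, eval_var, eval_lit]
    simp only [← this, ite_not]
    simp [hm₁, Memory.write_apply]
  have e₃ : (Term.add (Term.max (.var 4) (.add (.var 5) (maxCodeT offY))) (.lit 1)).eval 0 m₂ =
      newCode X Y := by
    rw [eval_add, eval_max, eval_add, eval_maxCodeT h₂.size h₂.isMatrix_Y, newCode]
    simp [eval_var, eval_lit, hm₁, hm₂, Memory.write_apply]
  have hrun : setup.run 0 m =
      m₃.write 7 0 (max X.maxVertexColor Y.maxVertexColor + 1) := by
    simp only [setup, Cmd.run, eval_lit, e₁, ← hm₁, e₂, ← hm₂, e₃, ← hm₃]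
    rw [eval_add, hmax _ h₃, eval_lit]
  rw [hrun]
  refine ⟨h₃.write (by decide) _ _, ?_, ?_, ?_⟩ <;>
    simp [hm₂, hm₃, Memory.write_apply]

theorem gen_emit (hn : 2 ≤ n) (h : Ready X Y α m) :
    emit.gen 0 m = codeFamily (rotationTournament X Y hn α) := by
  -- The precomputed numbers are in arrays up to `7`, and the loop counters lie above.
  have hw : ∀ (u : ℕ) (a i : ℕ), 7 < u → ∀ (m' : Memory), Ready X Y α m' →
      Ready X Y α (m'.write u a i) := fun u a i hu m' h' =>
    ⟨h'.toHasInput.write (by omega) _ _, by rw [Memory.write_of_ne _ (by omega), h'.shift],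
      by rw [Memory.write_of_ne _ (by omega), h'.new],
      by rw [Memory.write_of_ne _ (by omega), h'.top]⟩
  have hiff : ∀ u v : Fin n, (u : ℕ) = v ↔ u = v := fun u v => Fin.ext_iff.symm
  simp only [emit, Emit.gen, eval_var, h.size, min_self, List.range_flatMap_eq_finRange, codeFamily]
  refine congrArg (List.flatMap · _) (funext fun β => ?_)
  rw [codeDigraph_rotationTournament]
  set m' := m.write 10 0 β with hm'
  have h' : Ready X Y α m' := hw _ _ _ (by decide) _ h
  have hβ : m' 10 0 = β := by simp [hm', Memory.write_apply]
  refine congrArg₂ _ ?_ ?_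
  · simp only [colors, Emit.gen, eval_var, h'.size, min_self,
      h'.top, eval_cell, eval_add, eval_lit, eval_mulN, Memory.write_apply, if_true,
      show (0 : ℕ) ≠ 11 by decide, if_false, ← List.map_eq_flatMap, List.range_map_eq_finRange,
      h'.colorX, h'.colorY]
  · have hpt : ∀ m'', m'' 0 = m' 0 → point.eval 0 m'' = α := fun m'' h'' => by
      rw [point, eval_cell, eval_lit, h'', h'.point]
    have hu : ∀ u v : Fin n, (m'.write 11 0 u).write 12 0 v 11 0 = u := fun u v => by
      simp [Memory.write_apply]
    have hv : ∀ u v : Fin n, (m'.write 11 0 u).write 12 0 v 12 0 = v := fun u v => by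
      simp [Memory.write_apply]
    have hR : ∀ u v : Fin n, Ready X Y α ((m'.write 11 0 u).write 12 0 v) := fun u v =>
      hw _ _ _ (by decide) _ (hw _ _ _ (by decide) _ h')
    have hR₁ : ∀ u : Fin n, Ready X Y α (m'.write 11 0 u) := fun u => hw _ _ _ (by decide) _ h'
    have hR₂ : ∀ u : Fin n, Ready X Y α (m'.write 12 0 u) := fun u => hw _ _ _ (by decide) _ h'
    simp only [matrix, Emit.gen, gen_rows h'.size, gen_part h'.size, row, Vtx.arcCode, across,
      toTop, fromTop, shifted, eval_cond_ne, shiftCode, ite_and]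
    have ex : ∀ u v : Fin n, (entry offX (.var 11) (.var 12)).eval 0
        ((m'.write 11 0 u).write 12 0 v) = X.code u v := fun u v =>
      (hR u v).eval_entry_X (hu u v) (hv u v)
    have ey : ∀ u v : Fin n, (entry offY (.var 11) (.var 12)).eval 0
        ((m'.write 11 0 u).write 12 0 v) = Y.code u v := fun u v =>
      (hR u v).eval_entry_Y (hu u v) (hv u v)
    have hp : ∀ u v : Fin n, point.eval 0 ((m'.write 11 0 u).write 12 0 v) = α := fun u v =>
      (hR u v).point
    have hp₁ : ∀ u : Fin n, point.eval 0 (m'.write 11 0 u) = α := fun u => (hR₁ u).point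
    have hp₂ : ∀ u : Fin n, point.eval 0 (m'.write 12 0 u) = α := fun u => (hR₂ u).point
    simp only [ex, ey, hp, hp₁, hp₂, eval_var, eval_add, eval_lit, Memory.write_apply, if_true,
      show (11 : ℕ) ≠ 12 by decide, show (6 : ℕ) ≠ 12 by decide, show (6 : ℕ) ≠ 11 by decide,
      show (5 : ℕ) ≠ 12 by decide, show (5 : ℕ) ≠ 11 by decide, show (10 : ℕ) ≠ 12 by decide,
      show (10 : ℕ) ≠ 11 by decide, if_false, h'.new, h'.shift, hβ, hiff]

/-- The cut-off cell is cell `0` of the input, which contains `n`, so the cost polynomial is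
evaluated at `n` itself, no matter how large the colors or the valencies are. -/
theorem halts (X Y : ColoredDigraph (Fin n)) (hn : 2 ≤ n) (α : Fin n) :
    (cmd.compile 0).Computes (codeInput X Y α) (codeFamily (rotationTournament X Y hn α))
      (cmd.cost.eval n) := by
  have h := hasInput_initial X Y α
  have hok : cmd.ok 0 = true := by
    simp [cmd, Cmd.ok, ok_setup, Emit.ok_toCmd (b := 0) (by decide) emit ok_emit]
  refine Program.computes_of_halts ((Cmd.halts (b := 0) (by decide) cmd _ _ hok
    fun _ _ => rfl).mono (by rw [h.size]) fun m' hm' => ?_)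
  rw [written_congr (hm' 1 (by decide)) (hm' 2 (by decide)), cmd, Cmd.run,
    Emit.written_run (by decide) (by decide) _ _ ok_emit, gen_emit hn (ready_setup h)]
  have : setup.run 0 (initial (codeInput X Y α)) 2 = initial (codeInput X Y α) 2 :=
    Cmd.run_of_notMem _ _ (by decide)
  simp [written, this, initial]

end Construction
end RAM

/-! ## Orbits and Schreier generators -/

namespace Schreier

variable {G T : Type*} [Group G] [MulAction G T]

/-- The elements of the list represent different points, they belong to the group, and one of them
is the neutral element. -/
structure IsReps (x : T) (S L : List G) : Prop where
  one_mem : (1 : G) ∈ L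
  mem_closure : ∀ r ∈ L, r ∈ Subgroup.closure {g | g ∈ S}
  nodup : (L.map (· • x)).Nodup

theorem getD_mem {L : List G} {h : ℕ} (hh : h < L.length) : L.getD h 1 ∈ L := by
  rw [List.getD_eq_getElem _ _ hh]
  exact List.getElem_mem hh

theorem getD_of_prefix {L L' : List G} (h : L <+: L') {i : ℕ} (hi : i < L.length) :
    L'.getD i 1 = L.getD i 1 := by
  obtain ⟨M, rfl⟩ := h
  rw [List.getD_append _ _ _ _ hi]

/-- All products of generators and the representative in position `h` are represented. -/
def Closed (x : T) (S L : List G) (h : ℕ) : Prop :=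
  ∀ g ∈ S, ∃ r ∈ L, r • x = (g * L.getD h 1) • x

theorem Closed.of_prefix {x : T} {S L L' : List G} {h : ℕ} (hc : Closed x S L h)
    (hL : L <+: L') (hh : h < L.length) : Closed x S L' h := by
  intro g hg
  obtain ⟨r, hr, h'⟩ := hc g hg
  exact ⟨r, hL.subset hr, by rw [h', getD_of_prefix hL hh]⟩

theorem IsReps.length_le [Fintype T] {x : T} {S L : List G} (hL : IsReps x S L) :
    L.length ≤ Fintype.card T := by
  simpa using hL.nodup.length_le_card

theorem isReps_one (x : T) (S : List G) : IsReps x S [1] :=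
  ⟨by simp, fun r hr => by rw [List.mem_singleton.1 hr]; exact one_mem _, by simp⟩

variable [DecidableEq T]

/-- Appending a group element to a list of representatives, if the image of `x` is new. -/
def insertRep (x : T) (L : List G) (q : G) : List G :=
  if ∃ r ∈ L, r • x = q • x then L else L ++ [q]

/-- Appending the products of all generators with the representative in position `h`. -/
def expand (x : T) (S : List G) (h : ℕ) (L : List G) : List G :=
  if h < L.length then
    RAM.rounds (fun j L' => insertRep x L' (S.getD j 1 * L'.getD h 1)) L S.length
  else L

/-- A list of representatives, one for each point of the orbit of `x`. -/
def reps (x : T) (S : List G) (B : ℕ) : List G := RAM.rounds (expand x S) [1] B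

/-- The position of the representative that maps `x` to `y`. -/
def position (x : T) (L : List G) (y : T) : ℕ :=
  ∑ h ∈ Finset.range L.length, if L.getD h 1 • x = y then h else 0

/-- The Schreier generators of the stabilizer of `x`. -/
def schreierGens (x : T) (S L : List G) : List G :=
  (List.range L.length).flatMap fun h => (List.range S.length).map fun j =>
    (L.getD (position x L ((S.getD j 1 * L.getD h 1) • x)) 1)⁻¹ * (S.getD j 1 * L.getD h 1)

theorem IsReps.insertRep {x : T} {S L : List G} (hL : IsReps x S L) {q : G}
    (hq : q ∈ Subgroup.closure {g | g ∈ S}) : IsReps x S (insertRep x L q) := by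
  unfold Schreier.insertRep
  split_ifs with h
  · exact hL
  · refine ⟨by simp [hL.one_mem], fun r hr => ?_, ?_⟩
    · rcases List.mem_append.1 hr with hr | hr
      · exact hL.mem_closure r hr
      · rw [List.mem_singleton.1 hr]; exact hq
    · rw [List.map_append, List.nodup_append]
      refine ⟨hL.nodup, by simp, ?_⟩
      intro a ha b hb hab
      obtain ⟨r, hr, rfl⟩ := List.mem_map.1 ha
      simp only [List.map_cons, List.map_nil, List.mem_singleton] at hb
      exact h ⟨r, hr, hab.trans hb⟩

theorem prefix_insertRep (x : T) (L : List G) (q : G) : L <+: insertRep x L q := by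
  unfold insertRep
  split_ifs
  · exact List.prefix_rfl
  · exact List.prefix_append ..

theorem exists_mem_insertRep (x : T) (L : List G) (q : G) :
    ∃ r ∈ insertRep x L q, r • x = q • x := by
  unfold insertRep
  split_ifs with h
  · exact h
  · exact ⟨q, by simp, rfl⟩

/-- Lists grow only at the end. So position `h` denotes the same element throughout the round, and a
product that has once been represented stays represented. -/
theorem expand_spec {x : T} {S L : List G} (hL : IsReps x S L) {h : ℕ} :
    IsReps x S (expand x S h L) ∧ L <+: expand x S h L ∧
      (h < L.length → Closed x S (expand x S h L) h) := by
  unfold expand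
  split_ifs with hh
  swap
  · exact ⟨hL, List.prefix_rfl, fun h' => absurd h' hh⟩
  set f : ℕ → List G → List G := fun j L' => insertRep x L' (S.getD j 1 * L'.getD h 1) with hf
  have key : ∀ k ≤ S.length, IsReps x S (RAM.rounds f L k) ∧ L <+: RAM.rounds f L k ∧
      ∀ j < k, ∃ r ∈ RAM.rounds f L k, r • x = (S.getD j 1 * L.getD h 1) • x := by
    intro k hk
    induction k with
    | zero => exact ⟨hL, List.prefix_rfl, fun j hj => absurd hj (by omega)⟩
    | succ k ih =>
      obtain ⟨i₁, i₂, i₃⟩ := ih (by omega)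
      have hp := prefix_insertRep x (RAM.rounds f L k)
        (S.getD k 1 * (RAM.rounds f L k).getD h 1)
      refine ⟨i₁.insertRep (mul_mem (Subgroup.subset_closure (getD_mem (by omega)))
        (i₁.mem_closure _ (getD_mem (hh.trans_le i₂.length_le)))), i₂.trans hp, fun j hj => ?_⟩
      rcases Nat.lt_succ_iff_lt_or_eq.1 hj with hj | rfl
      · obtain ⟨r, hr, h'⟩ := i₃ j hj
        exact ⟨r, hp.subset hr, h'⟩
      · rw [← getD_of_prefix i₂ hh]
        exact exists_mem_insertRep ..
  obtain ⟨k₁, k₂, k₃⟩ := key _ le_rfl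
  refine ⟨k₁, k₂, fun _ g hg => ?_⟩
  obtain ⟨j, hj, rfl⟩ := List.mem_iff_getElem.1 hg
  obtain ⟨r, hr, h'⟩ := k₃ j hj
  refine ⟨r, hr, ?_⟩
  rw [h', List.getD_eq_getElem _ _ hj, getD_of_prefix k₂ hh]

theorem isReps_reps (x : T) (S : List G) (B : ℕ) : IsReps x S (reps x S B) := by
  induction B with
  | zero => exact isReps_one x S
  | succ h ih => exact (expand_spec ih).1

/-- This is a breadth-first search in which round `h` treats position `h`. The list never gets
longer than the number of points, so that many rounds treat all positions. -/
theorem closed_reps [Fintype T] (x : T) (S : List G) {B : ℕ} (hB : Fintype.card T ≤ B) {h : ℕ}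
    (hh : h < (reps x S B).length) : Closed x S (reps x S B) h := by
  -- In round `k` either position `k` exists and is treated, or the list is already exhausted and
  -- the round changes nothing.
  have key : ∀ k h, h < k → h < (reps x S k).length → Closed x S (reps x S k) h := by
    intro k
    induction k with
    | zero => intro h hk; omega
    | succ k ih =>
      intro h hk hh
      obtain ⟨-, k₂, k₃⟩ := expand_spec (isReps_reps x S k) (h := k)
      by_cases hlen : k < (reps x S k).length
      · rcases Nat.lt_succ_iff_lt_or_eq.1 hk with hk | rfl
        · exact (ih h hk (by omega)).of_prefix k₂ (by omega)
        · exact k₃ hlen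
      · have : reps x S (k + 1) = reps x S k := by
          change expand x S k (reps x S k) = _
          rw [expand, if_neg hlen]
        rw [this] at hh ⊢
        exact ih h (by omega) hh
  exact key B h (hh.trans_le ((isReps_reps x S B).length_le.trans hB)) hh

/-- Since representatives have different images of `x`, at most one summand in `position` satisfies
the condition. -/
theorem IsReps.getD_position {x : T} {S L : List G} (hL : IsReps x S L) {y : T}
    (h : ∃ r ∈ L, r • x = y) :
    position x L y < L.length ∧ L.getD (position x L y) 1 • x = y := by
  obtain ⟨r, hr, rfl⟩ := h
  obtain ⟨i, hi, rfl⟩ := List.mem_iff_getElem.1 hr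
  have : position x L (L[i] • x) = i := by
    unfold position
    rw [Finset.sum_eq_single i, List.getD_eq_getElem _ _ hi, if_pos rfl]
    · intro j hj hji
      rw [Finset.mem_range] at hj
      refine if_neg fun h => hji ?_
      rw [List.getD_eq_getElem _ _ hj] at h
      exact (hL.nodup.getElem_inj_iff (hi := by simpa using hj) (hj := by simpa using hi)).1
        (by simpa using h)
    · intro h
      exact absurd (Finset.mem_range.2 hi) h
  rw [this, List.getD_eq_getElem _ _ hi]
  exact ⟨hi, rfl⟩

theorem IsReps.getD_position_mul {x : T} {S L : List G} (hL : IsReps x S L)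
    (hc : ∀ h < L.length, Closed x S L h) {h j : ℕ} (hh : h < L.length) (hj : j < S.length) :
    L.getD (position x L ((S.getD j 1 * L.getD h 1) • x)) 1 ∈ L ∧
    L.getD (position x L ((S.getD j 1 * L.getD h 1) • x)) 1 • x =
      (S.getD j 1 * L.getD h 1) • x :=
  have h := hL.getD_position (hc h hh _ (getD_mem hj))
  ⟨getD_mem h.1, h.2⟩

theorem closure_schreierGens_le {x : T} {S L : List G} (hL : IsReps x S L)
    (hc : ∀ h < L.length, Closed x S L h) :
    Subgroup.closure {g | g ∈ schreierGens x S L} ≤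
      Subgroup.closure {g | g ∈ S} ⊓ MulAction.stabilizer G x := by
  rw [Subgroup.closure_le]
  intro g hg
  simp only [schreierGens, Set.mem_ofPred_eq, List.mem_flatMap, List.mem_map,
    List.mem_range] at hg
  obtain ⟨h, hh, j, hj, rfl⟩ := hg
  obtain ⟨h₁, h₂⟩ := hL.getD_position_mul hc hh hj
  rw [SetLike.mem_coe, Subgroup.mem_inf, MulAction.mem_stabilizer_iff]
  refine ⟨mul_mem (inv_mem (hL.mem_closure _ h₁)) (mul_mem
    (Subgroup.subset_closure (getD_mem hj)) (hL.mem_closure _ (getD_mem hh))), ?_⟩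
  rw [mul_smul, inv_smul_eq_iff, h₂]

/-- Schreier's argument, by induction on a word in the generators: if `r` represents `g`, and `r'`
represents `s * r`, then `r'⁻¹ * (s * g)` is the product of the Schreier generator `r'⁻¹ * (s * r)`
and `r⁻¹ * g`. -/
theorem exists_inv_mul_mem [Finite G] {x : T} {S L : List G} (hL : IsReps x S L)
    (hc : ∀ h < L.length, Closed x S L h) {g : G} (hg : g ∈ Subgroup.closure {g | g ∈ S}) :
    ∃ r ∈ L, r⁻¹ * g ∈ Subgroup.closure {g | g ∈ schreierGens x S L} ∧ r • x = g • x := by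
  suffices h : ∃ r ∈ L, r⁻¹ * g ∈ Subgroup.closure {g | g ∈ schreierGens x S L} by
    obtain ⟨r, hr, hrg⟩ := h
    have := (Subgroup.mem_inf.1 (closure_schreierGens_le hL hc hrg)).2
    rw [MulAction.mem_stabilizer_iff, mul_smul, inv_smul_eq_iff] at this
    exact ⟨r, hr, hrg, this.symm⟩
  -- In a finite group the generators already generate the subgroup as a monoid, so inverses of
  -- generators need not be considered.
  rw [← Subgroup.mem_toSubmonoid, Subgroup.closure_toSubmonoid_of_finite] at hg
  induction hg using Submonoid.closure_induction_left with
  | one => exact ⟨1, hL.one_mem, by simp⟩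
  | mul_left s hs g _ ih =>
    obtain ⟨r, hr, hrg⟩ := ih
    obtain ⟨j, hj, rfl⟩ := List.mem_iff_getElem.1 (show s ∈ S from hs)
    obtain ⟨h, hh, rfl⟩ := List.mem_iff_getElem.1 hr
    obtain ⟨h₁, -⟩ := hL.getD_position_mul hc hh hj
    refine ⟨_, h₁, ?_⟩
    have hs : (L.getD (position x L ((S.getD j 1 * L.getD h 1) • x)) 1)⁻¹ *
        (S.getD j 1 * L.getD h 1) ∈ Subgroup.closure {g | g ∈ schreierGens x S L} :=
      Subgroup.subset_closure (by
        simp only [schreierGens, Set.mem_ofPred_eq, List.mem_flatMap, List.mem_map,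
          List.mem_range]
        exact ⟨h, hh, j, hj, rfl⟩)
    have := mul_mem hs hrg
    rw [List.getD_eq_getElem S _ hj, List.getD_eq_getElem L _ hh] at this ⊢
    simpa [mul_assoc] using this

/-- An element that fixes `x` has the same representative as `1`. That representative is `1` itself,
because it is in the list and images are distinct. -/
theorem mem_closure_schreierGens [Finite G] {x : T} {S L : List G} (hL : IsReps x S L)
    (hc : ∀ h < L.length, Closed x S L h) {f : G} :
    f ∈ Subgroup.closure {g | g ∈ schreierGens x S L} ↔
      f ∈ Subgroup.closure {g | g ∈ S} ∧ f • x = x := by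
  constructor
  · exact fun hf => closure_schreierGens_le hL hc hf
  · rintro ⟨hf, hx⟩
    obtain ⟨r, hr, hrf, hrx⟩ := exists_inv_mul_mem hL hc hf
    have : r = 1 := List.inj_on_of_nodup_map hL.nodup hr hL.one_mem
      (show r • x = (1 : G) • x by rw [hrx, hx, one_smul])
    simpa [this] using hrf

/-- The description of the set of elements of the group that map `x` to `y`. -/
def transporter (x y : T) (S L : List G) : Option (G × List G) :=
  if ∃ r ∈ L, r • x = y then some (L.getD (position x L y) 1, schreierGens x S L) else none

end Schreier

/-- Two elements that map `x` to `y` differ by a right factor that fixes `x`. If no representative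
maps `x` to `y`, then no element of the group does, because the representatives exhaust the orbit.
-/
theorem describesCoset_transporter {V : Type*} [Finite V] [DecidableEq V]
    {S L : List (Equiv.Perm V)} {x : V × V × V} (y : V × V × V) (hL : Schreier.IsReps x S L)
    (hc : ∀ h < L.length, Schreier.Closed x S L h) {K : Subgroup (Equiv.Perm V)}
    {H : Set (Equiv.Perm V)} (hK : ∀ f, f ∈ K ↔ f ∈ generated S ∧ f • x = x)
    (hH : ∀ f, f ∈ H ↔ f ∈ generated S ∧ f • x = y) :
    DescribesCoset (Schreier.transporter x y S L) K H := by
  unfold Schreier.transporter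
  split_ifs with h
  · obtain ⟨h₁, h₂⟩ := hL.getD_position h
    have h₃ := hL.mem_closure _ (Schreier.getD_mem h₁)
    set r := L.getD (Schreier.position x L y) 1
    refine ⟨?_, ?_⟩
    · ext f
      rw [hK]
      exact Schreier.mem_closure_schreierGens hL hc
    · ext f
      rw [hH, Set.mem_ofPred_eq]
      constructor
      · rintro ⟨k₁, k₂⟩
        refine ⟨r⁻¹ * f, (hK _).2 ⟨mul_mem (inv_mem h₃) k₁, ?_⟩, by simp⟩
        rw [mul_smul, inv_smul_eq_iff, k₂, h₂]
      · rintro ⟨s, hs, rfl⟩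
        obtain ⟨k₁, k₂⟩ := (hK _).1 hs
        exact ⟨mul_mem h₃ k₁, by rw [mul_smul, k₂, h₂]⟩
  · ext f
    simp only [hH, Set.mem_empty_iff_false, iff_false]
    rintro ⟨k₁, k₂⟩
    obtain ⟨r, hr, -, hrx⟩ := Schreier.exists_inv_mul_mem hL hc k₁
    exact h ⟨r, hr, hrx.trans k₂⟩

namespace RAM

open Term

/-! ### The Schreier search as a command, and the values of its terms. -/

namespace CosetSearch

/-- A number multiplied by the degree, which is in array `3`. -/
def mulSize (t : Term) : Term := .big false 50 t (.var 3)

/-- The value of a representative at a point, where the representatives are in array `6`. -/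
def rep (h i : Term) : Term := .cell 6 (.add (mulSize h) i)

/-- The value of a generator at a point, where array `5` contains the position in the input. -/
def gen (j i : Term) : Term := .cell 0 (.add (.add (.var 5) (.lit 1)) (.add (mulSize j) i))

/-- The number of generators. -/
def numGens : Term := .cell 0 (.var 5)

/-- The first point. -/
def pt₁ : Term := .cell 0 (.lit 1)

/-- The second point. -/
def pt₂ : Term := .add (.var 0) (.var 10)

/-- The third point. -/
def pt₃ : Term := .add (.add (.var 0) (.var 0)) (.cell 0 (.lit 1))

/-- The value of the product of the current generator and the current representative. -/
def prod (i : Term) : Term := gen (.var 12) (rep (.var 11) i)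

/-- A term that is `1` if a representative has the given values at the three points. -/
def matching (h t₁ t₂ t₃ : Term) : Term :=
  .sub (.lit 1) (.add (ne (rep h pt₁) t₁) (.add (ne (rep h pt₂) t₂) (ne (rep h pt₃) t₃)))

/-- The number of representatives that have the given values at the three points. -/
def member (t₁ t₂ t₃ : Term) : Term := .big false 51 (.var 7) (matching (.var 51) t₁ t₂ t₃)

/-- The position of the representative that has the given values at the three points. -/
def find (t₁ t₂ t₃ : Term) : Term :=
  .big false 51 (.var 7) (.cond (matching (.var 51) t₁ t₂ t₃) (.var 51) (.lit 0))

/-- Starting with the neutral element. -/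
def firstReps : Cmd :=
  .seq (.loop 13 (.var 3) (.set 6 (.var 13) (.var 13))) (.set 7 (.lit 0) (.lit 1))

/-- Inserting the product of the current generator and the current representative. -/
def insert : Cmd :=
  .ite (member (prod pt₁) (prod pt₂) (prod pt₃)) .skip (.seq
    (.loop 13 (.var 3) (.set 6 (.add (mulSize (.var 7)) (.var 13)) (prod (.var 13))))
    (.set 7 (.lit 0) (.add (.var 7) (.lit 1))))

/-- Inserting all products with the current representative. -/
def expand : Cmd := .ite (.sub (.var 7) (.var 11)) (.loop 12 numGens insert) .skip

/-- The computation of all representatives. -/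
def reps : Cmd := .seq firstReps (.loop 11 (.var 4) expand)

/-- The inverse image of a value under a representative. -/
def preimage (h v : Term) : Term :=
  .big false 52 (.var 3) (.cond (eq (rep h (.var 52)) v) (.var 52) (.lit 0))

/-- The Schreier generators. -/
def emitGens : Emit :=
  .loop 11 (.var 7) (.loop 12 numGens (.loop 13 (.var 3)
    (.one (preimage (find (prod pt₁) (prod pt₂) (prod pt₃)) (prod (.var 13))))))

/-- The code of the coset. -/
def emitCoset : Emit :=
  .seq (.seq (.one (.lit 1)) (.loop 13 (.var 3) (.one (rep (find pt₂ pt₃ pt₁) (.var 13)))))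
    (.seq (.one (.big false 50 (.var 7) numGens)) emitGens)

/-- The search for one of the cosets. -/
def search : Cmd :=
  .seq reps (.ite (member pt₂ pt₃ pt₁) emitCoset.toCmd (Emit.one (.lit 0)).toCmd)

/-- The position in the input after the current list of generators. -/
def next : Cmd :=
  .set 5 (.lit 0) (.add (.add (.var 5) (.lit 1)) (.big false 50 (.var 3) numGens))

/-- The degree. -/
def size : Cmd :=
  .set 3 (.lit 0) (.add (.add (.var 0) (.add (.var 0) (.var 0))) (.lit 1))

/-- The bound for the length of the loops: the sum of the input length and the number of triples
of points. -/
def bound : Cmd :=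
  .seq (.seq (.set 5 (.lit 0) (.lit 2)) (.loop 10 (.var 0) next))
    (.set 4 (.lit 0) (.add (.var 5) (.big false 50 (.var 3) (.big false 51 (.var 3) (.var 3)))))

/-- The search for all the cosets. -/
def main : Cmd :=
  .seq (.set 5 (.lit 0) (.lit 2)) (.loop 10 (.var 0) (.seq search next))

theorem ok_size : size.ok 0 = true := by decide +kernel

theorem ok_bound : bound.ok 3 = true := by decide +kernel

theorem ok_emitCoset : emitCoset.ok 4 = true := by decide +kernel

theorem ok_main : main.ok 4 = true := by decide +kernel

/-- The memory contains the list `S` of generators, the points `α` and `β`, and sufficient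
bounds. -/
structure Ctx {n : ℕ} (α β : Fin n) (S : List (Equiv.Perm (Fin (3 * n + 1)))) (m : Memory) :
    Prop where
  num : m 0 0 = n
  point : m 0 1 = α
  size : m 3 0 = 3 * n + 1
  second : m 10 0 = β
  numGens : m 0 (m 5 0) = S.length
  gens : ∀ j < S.length, ∀ i : Fin (3 * n + 1),
    m 0 (m 5 0 + 1 + (j * (3 * n + 1) + i)) = S.getD j 1 i
  length_le : S.length ≤ m 4 0
  card_le : (3 * n + 1) * ((3 * n + 1) * (3 * n + 1)) ≤ m 4 0

/-- The points that are to be rotated. -/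
def source {n : ℕ} (α β : Fin n) : Fin (3 * n + 1) × Fin (3 * n + 1) × Fin (3 * n + 1) :=
  (block₁ α, block₂ β, block₃ α)

/-- The images of the points. -/
def target {n : ℕ} (α β : Fin n) : Fin (3 * n + 1) × Fin (3 * n + 1) × Fin (3 * n + 1) :=
  (block₂ β, block₃ α, block₁ α)

/-- The memory contains the list `L` of representatives. -/
structure Stored {n : ℕ} (α β : Fin n) (S L : List (Equiv.Perm (Fin (3 * n + 1)))) (m : Memory) :
    Prop extends Ctx α β S m where
  isReps : Schreier.IsReps (source α β) S L
  count : m 7 0 = L.length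
  cells : ∀ h < L.length, ∀ i : Fin (3 * n + 1), m 6 (h * (3 * n + 1) + i) = L.getD h 1 i

variable {n : ℕ} {α β : Fin n} {S L : List (Equiv.Perm (Fin (3 * n + 1)))} {m : Memory}

theorem Ctx.congr (h : Ctx α β S m) {m' : Memory} (hm : ∀ a ∈ [0, 3, 4, 5, 10], m' a = m a) :
    Ctx α β S m' := by
  simp only [List.mem_cons, List.not_mem_nil, or_false, forall_eq_or_imp, forall_eq] at hm
  obtain ⟨h₁, h₂, h₃, h₄, h₅⟩ := hm
  constructor <;> simp only [h₁, h₂, h₃, h₄, h₅]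
  exacts [h.num, h.point, h.size, h.second, h.numGens, h.gens, h.length_le, h.card_le]

theorem Stored.congr (h : Stored α β S L m) {m' : Memory}
    (hm : ∀ a ∈ [0, 3, 4, 5, 10, 6, 7], m' a = m a) : Stored α β S L m' :=
  ⟨h.toCtx.congr fun a ha => hm a (by simp at ha ⊢; tauto), h.isReps,
    by rw [hm 7 (by simp), h.count], by rw [hm 6 (by simp)]; exact h.cells⟩

theorem Stored.write (h : Stored α β S L m) {a : ℕ} (ha : 10 < a) (i x : ℕ) :
    Stored α β S L (m.write a i x) :=
  h.congr fun a' ha' => Memory.write_of_ne _ (by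
    simp only [List.mem_cons, List.not_mem_nil, or_false] at ha'; omega) ..

theorem Ctx.size_le (h : Ctx α β S m) : 3 * n + 1 ≤ m 4 0 :=
  le_trans (Nat.le_mul_of_pos_right _ (by positivity)) h.card_le

theorem Stored.count_le (h : Stored α β S L m) : L.length ≤ m 4 0 := by
  refine le_trans h.isReps.length_le (le_trans (le_of_eq ?_) h.card_le)
  simp

theorem Ctx.eval_mulSize (h : Ctx α β S m) {t : Term} (ht : t.eval 4 m ≤ m 4 0) :
    (mulSize t).eval 4 m = t.eval 4 m * (3 * n + 1) := by
  simp [mulSize, eval_sum, eval_var, Memory.write_apply, h.size, ht]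

theorem Stored.eval_rep (h : Stored α β S L m) {s t : Term} {k : ℕ} {i : Fin (3 * n + 1)}
    (hs : s.eval 4 m = k) (hk : k < L.length) (ht : t.eval 4 m = i) :
    (rep s t).eval 4 m = L.getD k 1 i := by
  rw [rep, eval_cell, eval_add, h.eval_mulSize (by have := h.count_le; omega), hs, ht,
    h.cells k hk]

theorem Ctx.eval_gen (h : Ctx α β S m) {s t : Term} {k : ℕ} {i : Fin (3 * n + 1)}
    (hs : s.eval 4 m = k) (hk : k < S.length) (ht : t.eval 4 m = i) :
    (gen s t).eval 4 m = S.getD k 1 i := by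
  rw [gen, eval_cell, eval_add, eval_add, eval_add, h.eval_mulSize (by have := h.length_le; omega),
    hs, ht, eval_var, eval_lit, h.gens k hk]

theorem Ctx.eval_pt₁ (h : Ctx α β S m) : pt₁.eval 4 m = (block₁ α : Fin (3 * n + 1)) := h.point

theorem Ctx.eval_pt₂ (h : Ctx α β S m) : pt₂.eval 4 m = (block₂ β : Fin (3 * n + 1)) := by
  rw [pt₂, eval_add, eval_var, eval_var, h.num, h.second]
  rfl

theorem Ctx.eval_pt₃ (h : Ctx α β S m) : pt₃.eval 4 m = (block₃ α : Fin (3 * n + 1)) := by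
  rw [pt₃, eval_add, eval_add, eval_var, eval_cell, eval_lit, h.num, h.point, ← two_mul]
  rfl

theorem Stored.eval_prod (h : Stored α β S L m) {t : Term} {i : Fin (3 * n + 1)}
    (h₁ : m 11 0 < L.length) (h₂ : m 12 0 < S.length) (ht : t.eval 4 m = i) :
    (prod t).eval 4 m = (S.getD (m 12 0) 1 * L.getD (m 11 0) 1) i :=
  h.eval_gen rfl h₂ (h.eval_rep rfl h₁ ht)

theorem Stored.eval_matching (h : Stored α β S L m) {s t₁ t₂ t₃ : Term} {k : ℕ}
    {y : Fin (3 * n + 1) × Fin (3 * n + 1) × Fin (3 * n + 1)} (hs : s.eval 4 m = k)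
    (hk : k < L.length) (h₁ : t₁.eval 4 m = y.1) (h₂ : t₂.eval 4 m = y.2.1)
    (h₃ : t₃.eval 4 m = y.2.2) :
    (matching s t₁ t₂ t₃).eval 4 m = if L.getD k 1 • source α β = y then 1 else 0 := by
  obtain ⟨y₁, y₂, y₃⟩ := y
  simp only at h₁ h₂ h₃
  have e₁ := eval_ne_eq_zero (b := 4) (s := rep s pt₁) (t := t₁) (m := m)
  have e₂ := eval_ne_eq_zero (b := 4) (s := rep s pt₂) (t := t₂) (m := m)
  have e₃ := eval_ne_eq_zero (b := 4) (s := rep s pt₃) (t := t₃) (m := m)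
  rw [h.eval_rep hs hk h.eval_pt₁, h₁, Fin.val_inj] at e₁
  rw [h.eval_rep hs hk h.eval_pt₂, h₂, Fin.val_inj] at e₂
  rw [h.eval_rep hs hk h.eval_pt₃, h₃, Fin.val_inj] at e₃
  simp only [matching, eval_sub, eval_add, eval_lit, source, Prod.smul_mk, Equiv.Perm.smul_def,
    Prod.mk.injEq, ← e₁, ← e₂, ← e₃]
  split_ifs <;> omega

/-- The terms have the given values, for all values of the bound variable of `member`. -/
def HasValues (t₁ t₂ t₃ : Term) (m : Memory)
    (y : Fin (3 * n + 1) × Fin (3 * n + 1) × Fin (3 * n + 1)) : Prop :=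
  ∀ i, t₁.eval 4 (m.write 51 0 i) = y.1 ∧ t₂.eval 4 (m.write 51 0 i) = y.2.1 ∧
    t₃.eval 4 (m.write 51 0 i) = y.2.2

theorem Stored.eval_member (h : Stored α β S L m) {t₁ t₂ t₃ : Term}
    {y : Fin (3 * n + 1) × Fin (3 * n + 1) × Fin (3 * n + 1)} (ht : HasValues t₁ t₂ t₃ m y) :
    (member t₁ t₂ t₃).eval 4 m = 0 ↔ ¬ ∃ r ∈ L, r • source α β = y := by
  rw [member, eval_sum, eval_var, h.count, min_eq_left h.count_le, Finset.sum_eq_zero_iff]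
  have key : ∀ i < L.length, (matching (.var 51) t₁ t₂ t₃).eval 4 (m.write 51 0 i) =
      if L.getD i 1 • source α β = y then 1 else 0 := fun i hi =>
    (h.write (by decide) 0 i).eval_matching (by simp [eval_var, Memory.write_apply]) hi
      (ht i).1 (ht i).2.1 (ht i).2.2
  push Not
  constructor
  · intro H r hr hy
    obtain ⟨i, hi, rfl⟩ := List.mem_iff_getElem.1 hr
    have := H i (Finset.mem_range.2 hi)
    rw [key i hi, List.getD_eq_getElem _ _ hi, if_pos hy] at this
    exact one_ne_zero this
  · intro H i hi
    rw [Finset.mem_range] at hi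
    rw [key i hi, if_neg (H _ (Schreier.getD_mem hi))]

theorem Stored.eval_find (h : Stored α β S L m) {t₁ t₂ t₃ : Term}
    {y : Fin (3 * n + 1) × Fin (3 * n + 1) × Fin (3 * n + 1)} (ht : HasValues t₁ t₂ t₃ m y) :
    (find t₁ t₂ t₃).eval 4 m = Schreier.position (source α β) L y := by
  rw [find, eval_sum, eval_var, h.count, min_eq_left h.count_le, Schreier.position]
  refine Finset.sum_congr rfl fun i hi => ?_
  rw [Finset.mem_range] at hi
  rw [eval, (h.write (by decide) 0 i).eval_matching (by simp [eval_var, Memory.write_apply]) hi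
      (ht i).1 (ht i).2.1 (ht i).2.2]
  by_cases hy : L.getD i 1 • source α β = y
  · simp only [if_pos hy, one_ne_zero, if_false, eval_var, Memory.write_apply, if_true]
  · simp only [if_neg hy, if_true, eval_lit]

theorem Stored.hasValues_target (h : Stored α β S L m) :
    HasValues pt₂ pt₃ pt₁ m (target α β) := fun i =>
  ⟨(h.write (by decide) 0 i).eval_pt₂, (h.write (by decide) 0 i).eval_pt₃,
    (h.write (by decide) 0 i).eval_pt₁⟩

theorem Stored.hasValues_prod (h : Stored α β S L m) (h₁ : m 11 0 < L.length)
    (h₂ : m 12 0 < S.length) : HasValues (prod pt₁) (prod pt₂) (prod pt₃) m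
      ((S.getD (m 12 0) 1 * L.getD (m 11 0) 1) • source α β) := fun i => by
  have h' := h.write (a := 51) (by decide) 0 i
  have e₁ : m.write 51 0 i 11 0 = m 11 0 := by simp [Memory.write_apply]
  have e₂ : m.write 51 0 i 12 0 = m 12 0 := by simp [Memory.write_apply]
  rw [← e₁] at h₁
  rw [← e₂] at h₂
  rw [← e₁, ← e₂]
  exact ⟨h'.eval_prod h₁ h₂ h'.eval_pt₁, h'.eval_prod h₁ h₂ h'.eval_pt₂,
    h'.eval_prod h₁ h₂ h'.eval_pt₃⟩

end CosetSearch
end RAM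

namespace RAM

open Term

/-! ### Correctness of the search for one coset. -/

namespace CosetSearch

variable {n : ℕ} {α β : Fin n} {S L : List (Equiv.Perm (Fin (3 * n + 1)))} {m : Memory}

theorem stored_firstReps (h : Ctx α β S m) : Stored α β S [1] (firstReps.run 4 m) := by
  have hloop : ∀ i < 3 * n + 1,
      (Cmd.loop 13 (.var 3) (.set 6 (.var 13) (.var 13))).run 4 m 6 i = i := by
    refine Cmd.run_loop (fun k m' => ∀ i < k, m' 6 i = i) (N := 3 * n + 1) ?_ ?_ ?_
    · rw [eval_var, h.size, min_eq_left h.size_le]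
    · intro m' _ _ i hi
      omega
    · intro k hk m' m'' h₁ h₂ h₃ h₄ h₅ i hi
      rw [h₅ 6 (by decide), Cmd.run, eval_var, h₂, Memory.write_apply, if_pos rfl]
      split_ifs with hik
      · exact hik.symm
      · exact h₃ i (by omega)
  have hfr : ∀ a ∈ [0, 3, 4, 5, 10], firstReps.run 4 m a = m a := fun a ha =>
    Cmd.run_of_notMem _ _ (by
      simp only [List.mem_cons, List.not_mem_nil, or_false] at ha
      rcases ha with rfl | rfl | rfl | rfl | rfl <;> decide)
  refine ⟨h.congr hfr, Schreier.isReps_one _ _, ?_, ?_⟩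
  · simp [firstReps, Cmd.run, Memory.write_apply, eval_lit]
  · intro k hk i
    obtain rfl : k = 0 := by simpa using hk
    simp only [firstReps, Cmd.run, eval_lit]
    rw [Memory.write_of_ne _ (by decide), zero_mul, zero_add]
    exact hloop i i.2

/-- Membership is tested by the image of the triple only. A new element is written into the row
directly behind the stored ones, and the counter is increased after the row is complete. -/
theorem stored_insert (h : Stored α β S L m) (h₁ : m 11 0 < L.length) (h₂ : m 12 0 < S.length) :
    Stored α β S (Schreier.insertRep (source α β) L (S.getD (m 12 0) 1 * L.getD (m 11 0) 1))
      (insert.run 4 m) := by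
  set q := S.getD (m 12 0) 1 * L.getD (m 11 0) 1 with hq
  have hmem := h.eval_member (h.hasValues_prod h₁ h₂)
  have hqS : q ∈ Subgroup.closure {g | g ∈ S} := mul_mem
    (Subgroup.subset_closure (Schreier.getD_mem h₂)) (h.isReps.mem_closure _ (Schreier.getD_mem h₁))
  have hfr : ∀ a ∈ [0, 3, 4, 5, 10], insert.run 4 m a = m a := fun a ha =>
    Cmd.run_of_notMem _ _ (by
      simp only [List.mem_cons, List.not_mem_nil, or_false] at ha
      rcases ha with rfl | rfl | rfl | rfl | rfl <;> decide)
  have hR := h.isReps.insertRep hqS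
  have hC := h.toCtx.congr hfr
  rw [insert, Cmd.run] at hC ⊢
  by_cases hex : ∃ r ∈ L, r • source α β = q • source α β
  · rw [Schreier.insertRep, if_pos hex]
    rw [if_neg fun h' => hmem.1 h' hex]
    exact h
  rw [Schreier.insertRep, if_neg hex] at hR ⊢
  rw [if_pos (hmem.2 hex)] at hC ⊢
  have hlt : ∀ {k i l : ℕ}, k < l → i < 3 * n + 1 → k * (3 * n + 1) + i < l * (3 * n + 1) :=
      fun {k i l} hk hi => by
    calc k * (3 * n + 1) + i < k * (3 * n + 1) + (3 * n + 1) := by omega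
      _ = (k + 1) * (3 * n + 1) := by ring
      _ ≤ l * (3 * n + 1) := Nat.mul_le_mul_right _ hk
  have hloop : (∀ i < L.length * (3 * n + 1), (Cmd.loop 13 (.var 3)
      (.set 6 (.add (mulSize (.var 7)) (.var 13)) (prod (.var 13)))).run 4 m 6 i = m 6 i) ∧
      ∀ i : Fin (3 * n + 1), (i : ℕ) < 3 * n + 1 → (Cmd.loop 13 (.var 3)
      (.set 6 (.add (mulSize (.var 7)) (.var 13)) (prod (.var 13)))).run 4 m 6
        (L.length * (3 * n + 1) + i) = q i := by
    refine Cmd.run_loop (fun k m' => (∀ i < L.length * (3 * n + 1), m' 6 i = m 6 i) ∧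
      ∀ i : Fin (3 * n + 1), (i : ℕ) < k → m' 6 (L.length * (3 * n + 1) + i) = q i)
      (N := 3 * n + 1) ?_ ?_ ?_
    · rw [eval_var, h.size, min_eq_left h.size_le]
    · intro m' _ h'
      exact ⟨fun i _ => by rw [h' 6 (by decide)], fun i hi => absurd hi (by omega)⟩
    · rintro k hk m' m'' k₁ k₂ ⟨k₃, k₄⟩ - k₆
      -- The rows of the old representatives have not been touched, so the product can still be
      -- evaluated while its values are being stored.
      have hS : Stored α β S L m' := by
        refine ⟨h.toCtx.congr fun a ha => k₁ a ?_, h.isReps, by rw [k₁ 7 (by decide), h.count],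
          fun l hl i => by rw [k₃ _ (hlt hl i.2), h.cells l hl i]⟩
        simp only [List.mem_cons, List.not_mem_nil, or_false] at ha
        rcases ha with rfl | rfl | rfl | rfl | rfl <;> decide
      have e₁ : (Term.add (mulSize (.var 7)) (.var 13)).eval 4 m' = L.length * (3 * n + 1) + k := by
        rw [eval_add, hS.eval_mulSize (by rw [eval_var, hS.count]; exact hS.count_le), eval_var,
          eval_var, hS.count, k₂]
      have e₂ : (prod (.var 13)).eval 4 m' = q ⟨k, hk⟩ := by
        have h11 := k₁ 11 (by decide)
        have h12 := k₁ 12 (by decide)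
        rw [hS.eval_prod (t := .var 13) (i := ⟨k, hk⟩) (by rw [h11]; exact h₁)
          (by rw [h12]; exact h₂) k₂, hq,
          h11, h12]
      rw [Cmd.run, e₁, e₂] at k₆
      refine ⟨fun i hi => ?_, fun i hi => ?_⟩
      · rw [k₆ 6 (by decide), Memory.write_apply, if_pos rfl, if_neg (by omega), k₃ i hi]
      · rw [k₆ 6 (by decide), Memory.write_apply, if_pos rfl]
        split_ifs with hik
        · congr 2
          ext
          simp only
          omega
        · exact k₄ i (by omega)
  refine ⟨hC, hR, ?_, ?_⟩
  · have h7 : (Cmd.loop 13 (.var 3)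
        (.set 6 (.add (mulSize (.var 7)) (.var 13)) (prod (.var 13)))).run 4 m 7 = m 7 :=
      Cmd.run_of_notMem _ _ (by decide)
    rw [Cmd.run, Cmd.run, Memory.write_apply, if_pos rfl, eval_lit, if_pos rfl, eval_add,
      eval_var, eval_lit, h7, h.count, List.length_append, List.length_singleton]
  · intro k hk i
    rw [List.length_append, List.length_singleton] at hk
    rw [Cmd.run, Cmd.run, Memory.write_of_ne _ (by decide)]
    rcases Nat.lt_succ_iff_lt_or_eq.1 hk with hk | rfl
    · rw [hloop.1 _ (hlt hk i.2), h.cells k hk, List.getD_append _ _ _ _ hk]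
    · rw [hloop.2 i i.2, List.getD_append_right _ _ _ _ le_rfl]
      simp

/-- The loop invariant also records that the current position remains inside the growing list, which
each insertion needs in order to read the current representative. -/
theorem stored_expand (h : Stored α β S L m) :
    Stored α β S (Schreier.expand (source α β) S (m 11 0) L) (expand.run 4 m) := by
  rw [expand, Cmd.run, eval_sub, eval_var, eval_var, h.count, Schreier.expand]
  by_cases hh : m 11 0 < L.length
  swap
  · rw [if_neg hh, if_pos (by omega)]
    exact h
  rw [if_pos hh, if_neg (by omega)]
  refine Cmd.run_loop (fun j m' => Stored α β S (rounds (fun j L' =>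
    Schreier.insertRep (source α β) L' (S.getD j 1 * L'.getD (m 11 0) 1)) L j) m' ∧
      m 11 0 < (rounds (fun j L' =>
    Schreier.insertRep (source α β) L' (S.getD j 1 * L'.getD (m 11 0) 1)) L j).length)
    (N := S.length) ?_ ?_ ?_ |>.1
  · rw [CosetSearch.numGens, eval_cell, eval_var, h.numGens, min_eq_left h.length_le]
  · intro m' _ h'
    exact ⟨h.congr fun a ha => h' a (by
      simp only [List.mem_cons, List.not_mem_nil, or_false] at ha; omega), hh⟩
  · rintro j hj m' m'' k₁ k₂ ⟨k₃, k₄⟩ - k₆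
    have h11 : m' 11 0 = m 11 0 := by rw [k₁ 11 (by decide)]
    refine ⟨?_, k₄.trans_le (Schreier.prefix_insertRep ..).length_le⟩
    have := stored_insert k₃ (by rw [h11]; exact k₄) (by rw [k₂]; exact hj)
    rw [h11, k₂] at this
    exact this.congr fun a ha => k₆ a (by
      simp only [List.mem_cons, List.not_mem_nil, or_false] at ha; omega)

theorem stored_reps (h : Ctx α β S m) :
    Stored α β S (Schreier.reps (source α β) S (m 4 0)) (reps.run 4 m) := by
  have h₀ := stored_firstReps h
  have h4 : firstReps.run 4 m 4 = m 4 := Cmd.run_of_notMem _ _ (by decide)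
  rw [reps, Cmd.run]
  refine Cmd.run_loop (fun k m' => Stored α β S (Schreier.reps (source α β) S k) m')
    (N := m 4 0) ?_ ?_ ?_
  · rw [eval_var, min_self, h4]
  · intro m' _ h'
    exact h₀.congr fun a ha => h' a (by
      simp only [List.mem_cons, List.not_mem_nil, or_false] at ha; omega)
  · rintro k hk m' m'' - k₂ k₃ - k₆
    have := stored_expand k₃
    rw [k₂] at this
    exact this.congr fun a ha => k₆ a (by
      simp only [List.mem_cons, List.not_mem_nil, or_false] at ha; omega)

/-- A permutation takes each value once, so the sum over all points has one relevant summand, the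
preimage. -/
theorem Stored.eval_preimage (h : Stored α β S L m) {s t : Term} {k : ℕ} {i : Fin (3 * n + 1)}
    (hk : k < L.length) (hs : ∀ l, s.eval 4 (m.write 52 0 l) = k)
    (ht : ∀ l, t.eval 4 (m.write 52 0 l) = i) :
    (preimage s t).eval 4 m = ((L.getD k 1)⁻¹ i : Fin (3 * n + 1)) := by
  have key : ∀ v : Fin (3 * n + 1), (Term.cond (eq (rep s (.var 52)) t) (.var 52) (.lit 0)).eval 4
      (m.write 52 0 v) = if L.getD k 1 v = i then (v : ℕ) else 0 := fun v => by
    rw [eval, eval_eq, (h.write (by decide) 0 _).eval_rep (hs v) hk (i := v)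
      (by simp [eval_var, Memory.write_apply]), ht v]
    simp only [Fin.val_inj]
    by_cases hv : L.getD k 1 v = i
    · simp only [if_pos hv, one_ne_zero, if_false, eval_var, Memory.write_apply, if_true]
    · simp only [if_neg hv, if_true, eval_lit]
  rw [preimage, eval_sum, eval_var, h.size, min_eq_left h.size_le, Finset.sum_range,
    Finset.sum_eq_single ((L.getD k 1)⁻¹ i)]
  · rw [key, if_pos (by simp)]
  · intro v _ hv
    rw [key, if_neg fun h => hv (by rw [← h]; simp)]
  · exact fun h => absurd (Finset.mem_univ _) h

theorem length_schreierGens (x : Fin (3 * n + 1) × Fin (3 * n + 1) × Fin (3 * n + 1)) :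
    (Schreier.schreierGens x S L).length = L.length * S.length := by
  simp [Schreier.schreierGens, List.length_flatMap]

theorem codePerm_eq {N : ℕ} (f : Equiv.Perm (Fin N)) :
    codePerm f = (List.finRange N).map fun i => (f i : ℕ) :=
  List.ofFn_eq_map

/-- Schreier generators are never stored: each value is computed when it is written, as a preimage
under the representative of the product. Closedness of the list ensures that this representative
exists. -/
theorem gen_emitGens (h : Stored α β S L m) (hc : ∀ k < L.length,
    Schreier.Closed (source α β) S L k) :
    emitGens.gen 4 m = (Schreier.schreierGens (source α β) S L).flatMap codePerm := by
  rw [Schreier.schreierGens, List.flatMap_assoc, emitGens, Emit.gen, eval_var, h.count,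
    min_eq_left h.count_le]
  refine List.flatMap_congr fun k hk => ?_
  rw [List.mem_range] at hk
  have h₁ := h.write (a := 11) (by decide) 0 k
  rw [List.flatMap_map, Emit.gen, numGens, eval_cell, eval_var, h₁.numGens,
    min_eq_left h₁.length_le]
  refine List.flatMap_congr fun j hj => ?_
  rw [List.mem_range] at hj
  have h₂ := h₁.write (a := 12) (by decide) 0 j
  rw [Emit.gen, eval_var, h₂.size, min_eq_left h₂.size_le, List.range_flatMap_eq_finRange,
    codePerm_eq, List.map_eq_flatMap]
  refine List.flatMap_congr fun i _ => ?_
  have h₃ := h₂.write (a := 13) (by decide) 0 i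
  set m' := ((m.write 11 0 k).write 12 0 j).write 13 0 i with hm'
  have hval : ∀ l, (m'.write 52 0 l) 11 0 = k ∧ (m'.write 52 0 l) 12 0 = j ∧
      (m'.write 52 0 l) 13 0 = i := fun l => by
    simp [hm', Memory.write_apply]
  have h₄ := fun l => h₃.write (a := 52) (by decide) 0 l
  have hpos : Schreier.position (source α β) L
      ((S.getD j 1 * L.getD k 1) • source α β) < L.length :=
    (h.isReps.getD_position (hc k hk _ (Schreier.getD_mem hj))).1
  rw [Emit.gen, h₃.eval_preimage hpos (i := (S.getD j 1 * L.getD k 1) i) ?_ ?_]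
  · rfl
  · intro l
    obtain ⟨k₁, k₂, k₃⟩ := hval l
    have := (h₄ l).eval_find ((h₄ l).hasValues_prod (by rw [k₁]; exact hk) (by rw [k₂]; exact hj))
    rwa [k₁, k₂] at this
  · intro l
    obtain ⟨k₁, k₂, k₃⟩ := hval l
    have := (h₄ l).eval_prod (t := .var 13) (i := i) (by rw [k₁]; exact hk)
      (by rw [k₂]; exact hj) k₃
    rwa [k₁, k₂] at this

/-- The code of the coset that is found. -/
theorem gen_emitCoset (h : Stored α β S L m) (hc : ∀ k < L.length,
    Schreier.Closed (source α β) S L k) (hex : ∃ r ∈ L, r • source α β = target α β) :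
    emitCoset.gen 4 m = codeCoset (Schreier.transporter (source α β) (target α β) S L) := by
  have hpos : Schreier.position (source α β) L (target α β) < L.length :=
    (h.isReps.getD_position hex).1
  rw [Schreier.transporter, if_pos hex, codeCoset, codePerms, length_schreierGens,
    ← gen_emitGens h hc, emitCoset, Emit.gen, Emit.gen, Emit.gen, Emit.gen, Emit.gen, Emit.gen,
    eval_lit, eval_var, h.size, min_eq_left h.size_le, List.range_flatMap_eq_finRange,
    codePerm_eq, List.map_eq_flatMap]
  rw [List.append_assoc, List.singleton_append]
  refine congrArg _ (congrArg₂ _ (List.flatMap_congr fun i _ => ?_) ?_)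
  · have h' := h.write (a := 13) (by decide) 0 i
    rw [Emit.gen, h'.eval_rep (h'.eval_find h'.hasValues_target) hpos (i := i)
      (by simp [eval_var, Memory.write_apply])]
  · rw [List.singleton_append]
    refine congrArg (· :: _) ?_
    rw [eval_sum, eval_var, h.count, min_eq_left h.count_le]
    simp only [numGens, eval_cell, eval_var, Memory.write_apply, show (0 : ℕ) ≠ 50 by decide,
      show (5 : ℕ) ≠ 50 by decide, if_false, h.numGens]
    simp

end CosetSearch
end RAM

theorem Polynomial.eval_le_eval_of_le (p : Polynomial ℕ) {a b : ℕ} (h : a ≤ b) :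
    p.eval a ≤ p.eval b := by
  rw [Polynomial.eval_eq_sum_range, Polynomial.eval_eq_sum_range]
  gcongr

theorem getD_codePerms {N : ℕ} (S : List (Equiv.Perm (Fin N))) {j : ℕ} (hj : j < S.length)
    (i : Fin N) : (codePerms S).getD (1 + (j * N + i)) 0 = S.getD j 1 i := by
  have h : S.flatMap codePerm = (List.finRange S.length).flatMap fun j : Fin S.length =>
      List.ofFn fun i => (S.getD j 1 i : ℕ) := by
    conv_lhs => rw [← List.map_getElem_finRange S]
    rw [List.flatMap_map]
    refine List.flatMap_congr fun j _ => ?_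
    rw [List.getD_eq_getElem _ _ j.2]
    rfl
  rw [codePerms, h, add_comm 1, List.getD_cons_succ]
  exact List.getD_flatMap_finRange_ofFn (fun (j : Fin S.length) i => (S.getD j 1 i : ℕ)) ⟨j, hj⟩ i

theorem length_codePerms {N : ℕ} (S : List (Equiv.Perm (Fin N))) :
    (codePerms S).length = 1 + S.length * N := by
  simp [codePerms, List.length_flatMap, codePerm, add_comm]

namespace RAM

open Term

/-! ### Running through all lists of generators, and the total running time. -/

namespace CosetSearch

variable {n : ℕ} {α β : Fin n} {m : Memory}

theorem written_search {S : List (Equiv.Perm (Fin (3 * n + 1)))} (h : Ctx α β S m) :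
    written (search.run 4 m) = written m ++ codeCoset (Schreier.transporter (source α β)
      (target α β) S (Schreier.reps (source α β) S (m 4 0))) := by
  have hR := stored_reps h
  have hw : written (reps.run 4 m) = written m :=
    written_congr (Cmd.run_of_notMem _ _ (by decide)) (Cmd.run_of_notMem _ _ (by decide))
  have hmem := hR.eval_member hR.hasValues_target
  have hc : ∀ k < (Schreier.reps (source α β) S (m 4 0)).length, Schreier.Closed (source α β) S
      (Schreier.reps (source α β) S (m 4 0)) k := fun k hk =>
    Schreier.closed_reps _ _ (by simpa using h.card_le) hk
  rw [search, Cmd.run, Cmd.run]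
  by_cases hex : ∃ r ∈ Schreier.reps (source α β) S (m 4 0), r • source α β = target α β
  · rw [if_neg fun h' => hmem.1 h' hex, Emit.written_run (by decide) (by decide) _ _ ok_emitCoset,
      gen_emitCoset hR hc hex, hw]
  · rw [if_pos (hmem.2 hex), Emit.written_run (by decide) (by decide) _ _ (by decide +kernel), hw,
      Schreier.transporter, if_neg hex]
    rfl

/-- The product of the degree and the number of generators is a sum over the degree, not over the
generators. So a cut-off at the degree suffices, and the step can be used before any bound for the
number of generators is known. -/
theorem run_next {b : ℕ} (h3 : m 3 0 = 3 * n + 1) (hb : 3 * n + 1 ≤ m b 0) :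
    next.run b m 5 0 = m 5 0 + (1 + m 0 (m 5 0) * (3 * n + 1)) := by
  simp only [next, Cmd.run, eval_add, eval_var, eval_lit, eval_sum, numGens, eval_cell,
    Memory.write_apply, if_true, h3, min_eq_left hb, show (0 : ℕ) ≠ 50 by decide,
    show (5 : ℕ) ≠ 50 by decide, if_false]
  simp
  ring

variable (S : Fin n → List (Equiv.Perm (Fin (3 * n + 1))))

/-- The part of the input that describes a list of generators. -/
def block (i : ℕ) : List ℕ := if h : i < n then codePerms (S ⟨i, h⟩) else []

/-- The position of this part in the input. -/
def start (k : ℕ) : ℕ := 2 + ((List.range k).flatMap (block S)).length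

theorem block_val (β : Fin n) : block S β = codePerms (S β) := by simp [block]

theorem start_succ (β : Fin n) :
    start S (β + 1) = start S β + (1 + (S β).length * (3 * n + 1)) := by
  simp [start, List.range_succ, block_val, length_codePerms]
  ring

theorem codeGenerators_eq (α : Fin n) :
    codeGenerators α S = [n, (α : ℕ)] ++ (List.range n).flatMap (block S) := by
  rw [codeGenerators, List.range_flatMap_eq_finRange]
  simp only [block_val]

theorem start_eq_length (α : Fin n) : start S n = (codeGenerators α S).length := by
  rw [codeGenerators_eq, start, List.length_append]
  rfl

theorem initial_start (α β : Fin n) {j : ℕ} (hj : j < (codePerms (S β)).length) :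
    initial (codeGenerators α S) 0 (start S β + j) = (codePerms (S β)).getD j 0 := by
  rw [initial, if_pos rfl, codeGenerators_eq, start, add_assoc,
    List.getD_append_right _ _ _ _ (by simp), List.length_cons, List.length_singleton,
    show 2 + (((List.range β).flatMap (block S)).length + j) - (1 + 1) =
      ((List.range β).flatMap (block S)).length + j by omega,
    List.getD_flatMap_range _ _ β.2 (by rw [block_val]; exact hj), block_val]

theorem initial_start_zero (α β : Fin n) :
    initial (codeGenerators α S) 0 (start S β) = (S β).length := by
  have := initial_start S α β (j := 0) (by simp [codePerms])
  simpa [codePerms] using this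

theorem initial_size (α : Fin n) : initial (codeGenerators α S) 0 0 = n := by
  simp [initial, codeGenerators]

/-- The bound for the lengths of the loops. -/
def limit (α : Fin n) : ℕ :=
  (codeGenerators α S).length + (3 * n + 1) * ((3 * n + 1) * (3 * n + 1))

theorem ctx_of_start {α β : Fin n} (h0 : m 0 = initial (codeGenerators α S) 0)
    (h3 : m 3 0 = 3 * n + 1) (h4 : m 4 0 = limit S α) (h5 : m 5 0 = start S β)
    (h10 : m 10 0 = β) : Ctx α β (S β) m := by
  refine ⟨?_, ?_, h3, h10, ?_, ?_, ?_, ?_⟩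
  · rw [h0, initial_size]
  · simp [h0, initial, codeGenerators]
  · rw [h0, h5, initial_start_zero]
  · intro j hj i
    rw [h0, h5, add_assoc, initial_start, getD_codePerms _ hj]
    rw [length_codePerms, Nat.add_lt_add_iff_left]
    calc j * (3 * n + 1) + i < j * (3 * n + 1) + (3 * n + 1) := by omega
      _ = (j + 1) * (3 * n + 1) := by ring
      _ ≤ _ := Nat.mul_le_mul_right _ hj
  -- The code of the list is a part of the input, so its length is at most the input length.
  · have h₁ : start S ((β : ℕ) + 1) ≤ start S n := by
      obtain ⟨k, hk⟩ : ∃ k, n = β + 1 + k := ⟨n - (β + 1), by omega⟩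
      have : List.range n =
          List.range ((β : ℕ) + 1) ++ (List.range k).map ((β : ℕ) + 1 + ·) := by
        rw [← List.range_add, ← hk]
      rw [start, start, this, List.flatMap_append, List.length_append]
      omega
    rw [start_succ, start_eq_length S α] at h₁
    have h₂ : (S β).length ≤ (S β).length * (3 * n + 1) := Nat.le_mul_of_pos_right _ (by omega)
    rw [h4, limit]
    omega
  · rw [h4, limit]
    omega

theorem run_size (α : Fin n) :
    size.run 0 (initial (codeGenerators α S)) 3 0 = 3 * n + 1 := by
  simp only [size, Cmd.run, eval_add, eval_var, eval_lit, initial_size, Memory.write_apply, if_true]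
  ring

/-- Skipping all the lists ends directly behind the input and thus measures its length, which the
machine is not given. This pass works with the cut-off `3 * n + 1` and produces the cut-off for the
search. -/
theorem run_bound {α : Fin n} (h0 : m 0 = initial (codeGenerators α S) 0)
    (h3 : m 3 0 = 3 * n + 1) : bound.run 3 m 4 0 = limit S α := by
  have h5 : (Cmd.loop 10 (.var 0) next).run 3 ((Cmd.set 5 (.lit 0) (.lit 2)).run 3 m) 5 0 =
      start S n := by
    refine Cmd.run_loop (fun k m' => m' 5 0 = start S k) (N := n) ?_ ?_ ?_
    · rw [eval_var, Cmd.run, Memory.write_of_ne _ (by decide), Memory.write_of_ne _ (by decide), h0,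
        h3, initial_size]
      omega
    · intro m' _ h'
      rw [h' 5 (by decide)]
      simp [Cmd.run, eval_lit, Memory.write_apply, start]
    · rintro k hk m' m'' k₁ - k₃ - k₅
      have e0 : m' 0 = initial (codeGenerators α S) 0 := by
        rw [k₁ 0 (by decide), Cmd.run, Memory.write_of_ne _ (by decide), h0]
      have e3 : m' 3 0 = 3 * n + 1 := by
        rw [k₁ 3 (by decide), Cmd.run, Memory.write_of_ne _ (by decide), h3]
      rw [k₅ 5 (by decide), run_next e3 e3.ge, k₃, e0]
      have := initial_start_zero S α ⟨k, hk⟩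
      have h' := start_succ S ⟨k, hk⟩
      simp only at this h'
      rw [this, h']
  have h3' : (Cmd.loop 10 (.var 0) next).run 3 ((Cmd.set 5 (.lit 0) (.lit 2)).run 3 m) 3 = m 3 := by
    rw [Cmd.run_of_notMem _ _ (by decide), Cmd.run_of_notMem _ _ (by decide)]
  rw [bound, Cmd.run, Cmd.run, Cmd.run, limit, ← start_eq_length]
  simp only [eval_add, eval_var, eval_lit, eval_sum, Memory.write_apply, if_true, h5, h3', h3,
    show (3 : ℕ) ≠ 50 by decide, show (3 : ℕ) ≠ 51 by decide, if_false, min_self]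
  simp

/-- The description of one of the cosets that is found. -/
def result (α : Fin n) (β : Fin n) :
    Option (Equiv.Perm (Fin (3 * n + 1)) × List (Equiv.Perm (Fin (3 * n + 1)))) :=
  Schreier.transporter (source α β) (target α β) (S β)
    (Schreier.reps (source α β) (S β) (limit S α))

theorem written_main {α : Fin n} (h0 : m 0 = initial (codeGenerators α S) 0)
    (h3 : m 3 0 = 3 * n + 1) (h4 : m 4 0 = limit S α) (hw : written m = []) :
    written (main.run 4 m) = codeCosets (result S α) := by
  let F : ℕ → List ℕ := fun i => if h : i < n then codeCoset (result S α ⟨i, h⟩) else []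
  have hF : codeCosets (result S α) = (List.range n).flatMap F := by
    rw [codeCosets, List.range_flatMap_eq_finRange]
    exact List.flatMap_congr fun β _ => by simp [F]
  rw [hF, main, Cmd.run]
  refine (Cmd.run_loop (fun k m' => m' 5 0 = start S k ∧ written m' = (List.range k).flatMap F)
    (N := n) ?_ ?_ ?_).2
  · rw [eval_var, Cmd.run, Memory.write_of_ne _ (by decide), Memory.write_of_ne _ (by decide), h0,
      h4, initial_size, limit]
    exact min_eq_left ((show n ≤ 3 * n + 1 by omega).trans
      ((Nat.le_mul_of_pos_right _ (by positivity)).trans (Nat.le_add_left ..)))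
  · intro m' _ h'
    refine ⟨?_, ?_⟩
    · rw [h' 5 (by decide)]
      simp [Cmd.run, eval_lit, Memory.write_apply, start]
    · rw [written_congr (h' 1 (by decide)) (h' 2 (by decide))]
      exact hw
  · rintro k hk m' m'' k₁ k₂ ⟨k₃, k₄⟩ - k₆
    have e0 : m' 0 = initial (codeGenerators α S) 0 := by
      rw [k₁ 0 (by decide), Cmd.run, Memory.write_of_ne _ (by decide), h0]
    have e3 : m' 3 0 = 3 * n + 1 := by
      rw [k₁ 3 (by decide), Cmd.run, Memory.write_of_ne _ (by decide), h3]
    have e4 : m' 4 0 = limit S α := by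
      rw [k₁ 4 (by decide), Cmd.run, Memory.write_of_ne _ (by decide), h4]
    have hctx := ctx_of_start S (β := ⟨k, hk⟩) e0 e3 e4 k₃ k₂
    have hs := written_search hctx
    have hfr : ∀ a ∈ [0, 3, 4, 5], search.run 4 m' a = m' a := fun a ha =>
      Cmd.run_of_notMem _ _ (by
        simp only [List.mem_cons, List.not_mem_nil, or_false] at ha
        rcases ha with rfl | rfl | rfl | rfl <;> decide)
    refine ⟨?_, ?_⟩
    · rw [k₆ 5 (by decide), Cmd.run, run_next (n := n) (by rw [hfr 3 (by simp), e3])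
        (by rw [hfr 4 (by simp)]; exact hctx.size_le), hfr 5 (by simp),
        hfr 0 (by simp), k₃, e0]
      have := initial_start_zero S α ⟨k, hk⟩
      have h' := start_succ S ⟨k, hk⟩
      simp only at this h'
      rw [this, h']
    · have hn : ∀ m₁ : Memory, written (next.run 4 m₁) = written m₁ := fun m₁ =>
        written_congr (Cmd.run_of_notMem _ _ (by decide)) (Cmd.run_of_notMem _ _ (by decide))
      rw [written_congr (k₆ 1 (by decide)) (k₆ 2 (by decide)), Cmd.run, hn, hs, k₄, e4,
        List.range_succ, List.flatMap_append, List.flatMap_singleton]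
      simp only [F, hk, dif_pos, result]

/-- The program that finds the cosets. -/
def program : Program := .seq (size.compile 0) (.seq (bound.compile 3) (main.compile 4))

open Polynomial in
/-- A bound for its number of steps, in terms of the input length. -/
noncomputable def programCost : Polynomial ℕ :=
  size.cost + (bound.cost.comp (3 * X + 1) + main.cost.comp (X + (3 * X + 1) ^ 3))

/-- The three phases use the cut-offs `n`, `3 * n + 1` and `limit`, each present in memory before
its phase starts and polynomially bounded in the input length. Cost polynomials have natural
coefficients, so they are monotone. -/
theorem halts (α : Fin n) : program.Computes (codeGenerators α S) (codeCosets (result S α))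
    (programCost.eval (codeGenerators α S).length) := by
  set m₀ := initial (codeGenerators α S) with hm₀
  set m₁ := size.run 0 m₀ with hm₁
  set m₂ := bound.run 3 m₁ with hm₂
  -- Each of the `n` lists contributes at least the entry that contains its length.
  have hn : n ≤ (codeGenerators α S).length := by
    rw [← start_eq_length S α, start]
    have : ∀ k ≤ n, k ≤ ((List.range k).flatMap (block S)).length := by
      intro k hk
      induction k with
      | zero => omega
      | succ k ih =>
        have := ih (by omega)
        have h' := block_val S ⟨k, by omega⟩
        simp only at h'
        rw [List.range_succ, List.flatMap_append, List.length_append, List.flatMap_singleton, h',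
          length_codePerms]
        omega
    have := this n le_rfl
    omega
  have e3 : m₁ 3 0 = 3 * n + 1 := run_size S α
  have e0 : m₁ 0 = m₀ 0 := Cmd.run_of_notMem _ _ (by decide)
  have e4 : m₂ 4 0 = limit S α := run_bound S e0 e3
  have f0 : m₂ 0 = m₁ 0 := Cmd.run_of_notMem _ _ (by decide)
  have f3 : m₂ 3 = m₁ 3 := Cmd.run_of_notMem _ _ (by decide)
  have hw : written m₂ = [] := by
    have h₁ : m₂ 2 = m₁ 2 := Cmd.run_of_notMem _ _ (by decide)
    have h₂ : m₁ 2 = m₀ 2 := Cmd.run_of_notMem _ _ (by decide)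
    simp [written, h₁, h₂, hm₀, initial]
  refine Program.computes_of_halts ((Halts.seq (Cmd.halts (b := 0) (by decide) size m₀ m₀ ok_size
    fun _ _ => rfl) fun m' h' => Halts.seq (Cmd.halts (b := 3) (by decide) bound m₁ m' ok_bound h')
    fun m'' h'' => Cmd.halts (b := 4) (by decide) main m₂ m'' ok_main h'').mono ?_ ?_)
  · rw [programCost, Polynomial.eval_add, Polynomial.eval_add, Polynomial.eval_comp,
      Polynomial.eval_comp, e3, e4, show m₀ 0 0 = n from initial_size S α]
    refine Nat.add_le_add (Polynomial.eval_le_eval_of_le _ hn) (Nat.add_le_add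
      (Polynomial.eval_le_eval_of_le _ ?_) (Polynomial.eval_le_eval_of_le _ ?_))
    · simp; omega
    · rw [limit, show (3 * n + 1) * ((3 * n + 1) * (3 * n + 1)) = (3 * n + 1) ^ 3 by ring]
      simp
      gcongr
  · intro m' h'
    rw [written_congr (h' 1 (by decide)) (h' 2 (by decide)),
      written_main S (by rw [f0, e0]) (by rw [f3, e3]) e4 hw]

/-- For the diagonal action on triples, three conditions on the images of points become a single
one, both for the stabilizer and for the rotating automorphisms. -/
theorem describesCoset_result (α β : Fin n) {X : ColoredDigraph (Fin (3 * n + 1))}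
    (h : generated (S β) = X.Aut) :
    DescribesCoset (result S α β) (X.stabilizer₃ (block₁ α) (block₂ β) (block₃ α))
      (X.rotating (block₁ α) (block₂ β) (block₃ α)) := by
  refine describesCoset_transporter _ (Schreier.isReps_reps ..)
    (fun k hk => Schreier.closed_reps _ _ ?_ hk) ?_ ?_
  · simp [limit]
  · intro f
    rw [h, ColoredDigraph.stabilizer₃]
    simp only [Subgroup.mem_inf, MulAction.mem_stabilizer_iff, source, Prod.smul_mk, Prod.mk.injEq,
      and_assoc]
  · intro f
    rw [h, ColoredDigraph.rotating]
    simp only [Set.mem_ofPred_eq, source, target, Prod.smul_mk, Prod.mk.injEq,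
      Equiv.Perm.smul_def]

end CosetSearch

end RAM

/-- `P` constructs the tournaments `T β` from `X`, `Y`, `α` (it is not given `k`) in time polynomial
in `n`.  `Q` finds the sets of rotating automorphisms, and thereby the set of isomorphisms from `X`
to `Y`, from generating sets of the groups `Aut (T β)`, in time polynomial in the input length. -/
theorem lemma6 :
    ∃ (P Q : RAM.Program) (p q : Polynomial ℕ),
      ∀ (n k : ℕ), 2 ≤ n → 1 ≤ k →
      ∀ (X Y : ColoredDigraph (Fin n)),
        X.IsTournament → Y.IsTournament → X.IsSpanning k → Y.IsSpanning k →
      ∀ (α : Fin n),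
        ∃ T : Fin n → ColoredDigraph (Fin (3 * n + 1)),
          P.Computes (codeInput X Y α) (codeFamily T) (p.eval n) ∧
          Function.Injective T ∧
          (∀ β, (T β).IsTournament ∧ (T β).IsSpanning (max 3 k) ∧ (T β).HasSingletonClass) ∧
          (∀ β, ∀ f ∈ (T β).rotating (block₁ α) (block₂ β) (block₃ α),
            ∃ g : Fin n ≃ Fin n, ∀ u, f (block₁ u) = block₂ (g u)) ∧
          ColoredDigraph.Iso X Y =
            ⋃ β, {g | ∃ f ∈ (T β).rotating (block₁ α) (block₂ β) (block₃ α),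
              ∀ u, f (block₁ u) = block₂ (g u)} ∧
          ∀ S : Fin n → List (Equiv.Perm (Fin (3 * n + 1))),
            (∀ β, generated (S β) = (T β).Aut) →
            ∃ R : Fin n → Option
                (Equiv.Perm (Fin (3 * n + 1)) × List (Equiv.Perm (Fin (3 * n + 1)))),
              Q.Computes (codeGenerators α S) (codeCosets R)
                (q.eval (codeGenerators α S).length) ∧
              ∀ β, DescribesCoset (R β)
                ((T β).stabilizer₃ (block₁ α) (block₂ β) (block₃ α))
                ((T β).rotating (block₁ α) (block₂ β) (block₃ α)) := by
  refine ⟨RAM.Construction.cmd.compile 0, RAM.CosetSearch.program, RAM.Construction.cmd.cost,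
    RAM.CosetSearch.programCost, ?_⟩
  intro n k hn _ X Y hX hY hXk hYk α
  refine ⟨ColoredDigraph.rotationTournament X Y hn α, RAM.Construction.halts X Y hn α,
    ColoredDigraph.rotationTournament_injective X Y hn α,
    fun β => ⟨ColoredDigraph.isTournament_rotationTournament hX hY,
      ColoredDigraph.isSpanning_rotationTournament hXk hYk,
      ColoredDigraph.hasSingletonClass_rotationTournament⟩,
    fun β f hf => (ColoredDigraph.exists_iso_of_rotating hX hf).imp fun _ h => h.2,
    ColoredDigraph.iso_eq_iUnion_rotating hX hn α, fun S hS =>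
      ⟨RAM.CosetSearch.result S α, RAM.CosetSearch.halts S α,
        fun β => RAM.CosetSearch.describesCoset_result S α β (hS β)⟩⟩
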